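/- **Setting.** Worker types are pairs $\mathbf x=(x_1,x_2)\in I=I_{1}\times I_{2}$ (skill, strength of relative concerns), with $I_1,I_2\subset\mathbb R$ Borel and $x_2>-\tfrac12$ for all $x_2\in I_2$. The population is a probability distribution $H$ on $I$, the law of $\mathbf X=(X_1,X_2)$; the law of $X_2$ conditional on $X_1$ is absolutely continuous. $H$ is said to have full support if every non-empty relatively open subset of $I_1\times I_2$ has positive $H$-measure. Output $F:I_1^2\to\mathbb R$ is symmetric, strictly increasing in each argument and twice continuously differentiable. For intensity of interaction $p\in\{0,1\}$, a worker with own wage $w$ and co-worker's wage $w'$ has utility $w+p\,x_2(w-w')$, and $$\psi_p(\mathbf x^j,\mathbf x^k,v)=\max_{w}\bigl\{F(x_1^k,x_1^j)-w+p x_2^k\,(F(x_1^k,x_1^j)-2w)\;:\; w+p x_2^j\,(2w-F(x_1^k,x_1^j))\ge v\bigr\}.$$ A competitive equilibrium at $p$ is a pair $(\mu,u)$ of a map $\mu:I\to I$ with $\mu(\mu(\mathbf x))=\mathbf x$ and $\mu(\mathbf X)\sim H$, and a function $u:I\to\mathbb R$, such that for every $\mathbf x^k\in I$: $\mu(\mathbf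 x^k)\in\arg\max_{\mathbf x}\psi_p(\mathbf x,\mathbf x^k,u(\mathbf x))$ and $u(\mathbf x^k)=\max_{\mathbf x}\psi_p(\mathbf x,\mathbf x^k,u(\mathbf x))$. Let $L(\mathbf x;a,b)=(F(x_1,a)-F(x_1,b))/(1+2x_2)$ and $V(l;a,b)=\Pr(L(\mathbf X;a,b)\le l)$. Assume: * (Common rankings) for every $\mathbf x\in I$ the value $v_1(\mathbf x):=V(L(\mathbf x;a,b);a,b)$ is the same for all $a>b$ in $I_1$; * (Exchangeable copula) $(X_1,v_1(\mathbf X))$ has an exchangeable copula, i.e. a copula $C$ with $C(s,t)=C(t,s)$. Consider the two specifications: * (Additive) $F(a,b)=K(a)+K(b)$ for some function $K$, and $(X_1,1/(1+2X_2))$ has an exchangeable copula; * (Multiplicative) $I_1\subset(0,\infty)$, $F(a,b)=A+((ab)^c-1)/c$ with $c\ne0$, and $(\ln X_1,\ln(1+2X_2))$ is elliptically distributed, i.e. its characteristic function is $t\mapsto e^{it^T\Delta}\phi(t^T\Omega t)$ with $\Omega$ symmetric positive semidefinite. **Proposition.** Let $(\mu^*,u^*)$ be any competitive equilibrium at $p=1$,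 and let $u_B$ be the payoff function, as a function of skill, of any competitive equilibrium at $p=0$ (the benchmark, without relative concerns). (i) If $F$ is supermodular, then $\Pr(u^*(\mathbf X)\ge u_B(X_1))=1$. If, in addition, $H$ has full support and either the additive specification holds and the distribution of $X_1$ has no atoms, or the multiplicative specification holds and $I_1$ has at least two elements, then $\Pr(u^*(\mathbf X)>u_B(X_1))=1$. (ii) Suppose that $H$ has full support and $I_2$ is an interval. If $F$ is strictly submodular and there is some $\mathbf x'\in I$ with $\mu^*_1(\mathbf x')=x'_1$, then $\Pr(u^*(\mathbf X)>u_B(X_1))<1$. -/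

import Mathlib

open MeasureTheory ProbabilityTheory Set
open scoped Matrix

/-! A worker's type is a pair `x = (x₁, x₂)`: skill `x.1`, strength of relative concerns `x.2`.
The type space is `I₁ ×ˢ I₂` and the population of workers is a probability measure `H` on it. -/

noncomputable section

namespace TeamFormation

/-- Standing assumptions on the population: `H` is a probability distribution on `I₁ × I₂`,
preferences exceed `-1/2`, and the law of `X₂` conditional on `X₁` is absolutely continuous. -/
structure IsPopulation (I₁ I₂ : Set ℝ) (H : Measure (ℝ × ℝ)) [IsProbabilityMeasure H] : Prop where
  measurable_skill : MeasurableSet I₁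
  measurable_pref : MeasurableSet I₂
  pref_gt : ∀ x₂ ∈ I₂, -(1 / 2 : ℝ) < x₂
  concentrated : H (I₁ ×ˢ I₂)ᶜ = 0
  cond_ac : ∀ᵐ x₁ ∂H.fst, H.condKernel x₁ ≪ volume

/-- `H` has full support on `I₁ × I₂`: every relatively open nonempty subset of the type space
has positive mass. -/
def FullSupport (I₁ I₂ : Set ℝ) (H : Measure (ℝ × ℝ)) : Prop :=
  ∀ U : Set (ℝ × ℝ), IsOpen U → (U ∩ I₁ ×ˢ I₂).Nonempty → 0 < H (U ∩ I₁ ×ˢ I₂)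

/-- Output `F x₁ y₁` of a team: symmetric, (strictly) increasing, twice continuously
differentiable. -/
structure IsProduction (I₁ : Set ℝ) (F : ℝ → ℝ → ℝ) : Prop where
  symm : ∀ a ∈ I₁, ∀ b ∈ I₁, F a b = F b a
  increasing : ∀ b ∈ I₁, StrictMonoOn (fun a => F a b) I₁
  smooth : ContDiffOn ℝ 2 (fun p : ℝ × ℝ => F p.1 p.2) (I₁ ×ˢ I₁)

/-- Supermodularity of the production function. -/
def Supermodular (I₁ : Set ℝ) (F : ℝ → ℝ → ℝ) : Prop :=
  ∀ a ∈ I₁, ∀ a' ∈ I₁, ∀ b ∈ I₁, ∀ b' ∈ I₁, a ≤ a' → b ≤ b' →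
    F a' b + F a b' ≤ F a' b' + F a b

/-- Strict submodularity of the production function. -/
def StrictlySubmodular (I₁ : Set ℝ) (F : ℝ → ℝ → ℝ) : Prop :=
  ∀ a ∈ I₁, ∀ a' ∈ I₁, ∀ b ∈ I₁, ∀ b' ∈ I₁, a < a' → b < b' →
    F a' b' + F a b < F a' b + F a b'

/-- Utility from own wage `w`, co-worker's wage `w'`, with relative concerns of strength `r`. -/
def utility (w w' r : ℝ) : ℝ := w + r * (w - w')

/-- Utility possibility frontier at intensity of interaction `p` (a worker of type `x` has
relative concerns of strength `p * x.2`): the highest utility of worker `xk` in a team with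
co-worker `xj` who gets utility at least `v`; `w` is the wage of `xj`. -/
def frontier (F : ℝ → ℝ → ℝ) (p : ℝ) (xj xk : ℝ × ℝ) (v : ℝ) : ℝ :=
  sSup {y | ∃ w : ℝ, v ≤ utility w (F xk.1 xj.1 - w) (p * xj.2) ∧
    y = utility (F xk.1 xj.1 - w) w (p * xk.2)}

/-- Competitive equilibrium at intensity of interaction `p`: a feasible sorting `μ`, individually
rational given the payoff function `u`, and `u` is the maximal attainable payoff. -/
structure IsEquilibrium (I₁ I₂ : Set ℝ) (H : Measure (ℝ × ℝ)) (F : ℝ → ℝ → ℝ) (p : ℝ)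
    (μ : ℝ × ℝ → ℝ × ℝ) (u : ℝ × ℝ → ℝ) : Prop where
  mapsTo : MapsTo μ (I₁ ×ˢ I₂) (I₁ ×ˢ I₂)
  involutive : ∀ x ∈ I₁ ×ˢ I₂, μ (μ x) = x
  feasible : AEMeasurable μ H ∧ H.map μ = H
  rational : ∀ xk ∈ I₁ ×ˢ I₂, ∀ x ∈ I₁ ×ˢ I₂,
    frontier F p x xk (u x) ≤ frontier F p (μ xk) xk (u (μ xk))
  payoff : ∀ xk ∈ I₁ ×ˢ I₂,
    IsGreatest ((fun xj => frontier F p xj xk (u xj)) '' (I₁ ×ˢ I₂)) (u xk)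

/-- `L(x; a, b) = (F(x₁, a) - F(x₁, b)) / (1 + 2 x₂)`. -/
def gain (F : ℝ → ℝ → ℝ) (a b : ℝ) (x : ℝ × ℝ) : ℝ := (F x.1 a - F x.1 b) / (1 + 2 * x.2)

/-- The rank `V(L(x; a, b); a, b)` of worker `x` in the distribution of `L(X; a, b)`. -/
def gainRank (H : Measure (ℝ × ℝ)) (F : ℝ → ℝ → ℝ) (a b : ℝ) (x : ℝ × ℝ) : ℝ :=
  H.real {y | gain F a b y ≤ gain F a b x}

/-- Common rankings: the rank of a worker does not depend on the pair of skills. The common value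
is the skill-preference index `v₁(x)`. -/
def CommonRankings (I₁ I₂ : Set ℝ) (H : Measure (ℝ × ℝ)) (F : ℝ → ℝ → ℝ) : Prop :=
  ∀ a''' ∈ I₁, ∀ a'' ∈ I₁, ∀ a' ∈ I₁, ∀ a ∈ I₁, a'' < a''' → a < a' →
    ∀ x ∈ I₁ ×ˢ I₂, gainRank H F a''' a'' x = gainRank H F a' a x

/-- Bivariate copulas. -/
structure IsCopula (C : ℝ → ℝ → ℝ) : Prop where
  mem : ∀ u ∈ Icc (0 : ℝ) 1, ∀ v ∈ Icc (0 : ℝ) 1, C u v ∈ Icc (0 : ℝ) 1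
  supermodular : ∀ u ∈ Icc (0 : ℝ) 1, ∀ u' ∈ Icc (0 : ℝ) 1, ∀ v ∈ Icc (0 : ℝ) 1,
    ∀ v' ∈ Icc (0 : ℝ) 1, u ≤ u' → v ≤ v' → C u' v + C u v' ≤ C u' v' + C u v
  zero_left : ∀ v ∈ Icc (0 : ℝ) 1, C 0 v = 0
  zero_right : ∀ u ∈ Icc (0 : ℝ) 1, C u 0 = 0
  one_left : ∀ v ∈ Icc (0 : ℝ) 1, C 1 v = v
  one_right : ∀ u ∈ Icc (0 : ℝ) 1, C u 1 = u

/-- Exchangeability of a copula. -/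
def Exchangeable (C : ℝ → ℝ → ℝ) : Prop :=
  ∀ u ∈ Icc (0 : ℝ) 1, ∀ v ∈ Icc (0 : ℝ) 1, C u v = C v u

/-- `C` is a copula of the random vector `(Y₁, Y₂)`. -/
def IsCopulaOf (C : ℝ → ℝ → ℝ) (H : Measure (ℝ × ℝ)) (Y₁ Y₂ : ℝ × ℝ → ℝ) : Prop :=
  IsCopula C ∧ ∀ y₁ y₂ : ℝ,
    C (H.real {x | Y₁ x ≤ y₁}) (H.real {x | Y₂ x ≤ y₂}) = H.real {x | Y₁ x ≤ y₁ ∧ Y₂ x ≤ y₂}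

/-- There is an exchangeable copula of `(X₁, v₁)`. Under common rankings the index
`gainRank H F a b` is the same function on the type space for all skills `b < a`. -/
def ExchangeableIndex (I₁ : Set ℝ) (H : Measure (ℝ × ℝ)) (F : ℝ → ℝ → ℝ) : Prop :=
  ∃ C : ℝ → ℝ → ℝ, Exchangeable C ∧
    ∀ a ∈ I₁, ∀ b ∈ I₁, b < a → IsCopulaOf C H Prod.fst (gainRank H F a b)

/-- Additive production with exchangeable distribution. -/
def AdditiveSpec (I₁ : Set ℝ) (H : Measure (ℝ × ℝ)) (F : ℝ → ℝ → ℝ) : Prop :=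
  (∃ K : ℝ → ℝ, ∀ a ∈ I₁, ∀ b ∈ I₁, F a b = K a + K b) ∧
    ∃ C : ℝ → ℝ → ℝ, Exchangeable C ∧ IsCopulaOf C H Prod.fst (fun x => 1 / (1 + 2 * x.2))

/-- Elliptical distributions on the plane: the characteristic function is
`t ↦ exp(i tᵀΔ) φ(tᵀΩt)`. -/
def IsElliptical (ν : Measure (EuclideanSpace ℝ (Fin 2))) : Prop :=
  ∃ (Δ : EuclideanSpace ℝ (Fin 2)) (Ω : Matrix (Fin 2) (Fin 2) ℝ) (φ : ℝ → ℝ), Ω.PosSemidef ∧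
    ∀ t : EuclideanSpace ℝ (Fin 2), charFun ν t =
      Complex.exp (Complex.I * ((inner ℝ t Δ : ℝ) : ℂ)) * ((φ (t.ofLp ⬝ᵥ (Ω *ᵥ t.ofLp)) : ℝ) : ℂ)

/-- Multiplicative production with log-elliptical distribution. -/
def MultiplicativeSpec (I₁ : Set ℝ) (H : Measure (ℝ × ℝ)) (F : ℝ → ℝ → ℝ) : Prop :=
  (∀ a ∈ I₁, 0 < a) ∧
  (∃ A c : ℝ, c ≠ 0 ∧ ∀ a ∈ I₁, ∀ b ∈ I₁, F a b = A + ((a * b) ^ c - 1) / c) ∧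
  IsElliptical (H.map fun x => !₂[Real.log x.1, Real.log (1 + 2 * x.2)])

end TeamFormation

end

/-! Dividing a payoff by `1 + 2 x₂` makes utility transferable. With `wt x = 1 / (1 + 2 x₂)`, an
equilibrium at `p = 1` is a stable matching for the surplus `F x₁ y₁ (wt x + wt y) / 2`: no pair
produces more than `wt x * u x + wt y * u y`, and matched pairs produce exactly that
(`IsEquilibrium.surplus_le`, `IsEquilibrium.surplus_eq`).

Supermodular output. A worker can always team up with a copy of himself, so `u x ≥ F x₁ x₁ / 2`, and
the benchmark pays exactly this amount. Two workers whose payoff is no more than that cannot gain by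
teaming up (`surplus_swap`). Under either specification this orders such workers comonotonically in
skill and a transform of preferences. A comonotone set is, up to countably many skills, part of the
graph of a monotone function of skill; it is null, because preferences are absolutely continuous
given skill and skills have no atoms (`null_of_comonotone`). In the multiplicative case
`no_atoms_of_elliptical` rules out atoms: an atom of `ln X₁` would give atoms of at least the same
mass to infinitely many projections, hence infinitely many almost disjoint lines of equal positive
mass.

Strictly submodular output. Suppose almost everybody gains. The surplus splits into the terms `F x₁
y₁ wt x` and `F y₁ x₁ wt y`, each an assignment of workers to skills with increasing differences
between the rank of the gain and the skill. The exchangeable copula makes the comonotone assignment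
compatible with one-sided matching, so a duality argument shows that a worker's partner has the
skill rank equal to the worker's gain rank (`ae_partner_rank`).

Matched workers who both gain have different skills, and the more able one has the smaller weight.
Near a skill with `F b b / 2 < uB b` no two workers can be matched, so by continuity all ranks at
that skill lie on one side of it; a limit argument covers the at most one remaining skill
(`ranksAbove_or_below`). As gains fall with skill, skills below the median have ranks of at least
one half and those above it at most one half. Matched preferences are ordered too, which keeps ranks
away from one half and forces two skills `a < b` with mass directly on either side of the median.
Some worker near skill `a` with partner `b` has a smaller weight than some worker near skill `b`
with partner `a`; stability against pairing their two partners then contradicts the benchmark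
inequality `F a b ≤ uB a + uB b` (`IsImproved.false`). -/

noncomputable section

namespace TeamFormation

/-! ### Equilibrium as stable matching with transferable utility -/

section

/-- The weight `1 / (1 + 2 x₂)` that turns payoffs into transferable utility. -/
def wt (x : ℝ × ℝ) : ℝ := 1 / (1 + 2 * x.2)

variable {I₁ I₂ : Set ℝ} {H : Measure (ℝ × ℝ)} {F : ℝ → ℝ → ℝ}

lemma wt_pos_of {x : ℝ × ℝ} (h : -(1 / 2 : ℝ) < x.2) : 0 < wt x := by
  unfold wt; apply one_div_pos.2; linarith

/-- The objective falls in the co-worker's wage `w` since `1 + 2 p x₂ > 0`, so the reservation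
constraint binds and fixes `w`. -/
lemma frontier_eq {p : ℝ} {xj xk : ℝ × ℝ} {v : ℝ}
    (hj : 0 < 1 + 2 * (p * xj.2)) (hk : 0 < 1 + 2 * (p * xk.2)) :
    frontier F p xj xk v = F xk.1 xj.1 * (1 + p * xk.2) -
      (1 + 2 * (p * xk.2)) * ((v + p * xj.2 * F xk.1 xj.1) / (1 + 2 * (p * xj.2))) := by
  unfold frontier utility
  apply IsGreatest.csSup_eq
  constructor
  · refine ⟨(v + p * xj.2 * F xk.1 xj.1) / (1 + 2 * (p * xj.2)), ?_, by ring⟩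
    have := div_mul_cancel₀ (v + p * xj.2 * F xk.1 xj.1) hj.ne'
    linarith
  · rintro y ⟨w, hw, rfl⟩
    have : (v + p * xj.2 * F xk.1 xj.1) / (1 + 2 * (p * xj.2)) ≤ w := by
      rw [div_le_iff₀ hj]; nlinarith
    nlinarith [mul_le_mul_of_nonneg_left this hk.le]

section equilibrium

variable {μ : ℝ × ℝ → ℝ × ℝ}

lemma IsEquilibrium.payoff_eq {p : ℝ} {u : ℝ × ℝ → ℝ} (hu : IsEquilibrium I₁ I₂ H F p μ u)
    {x : ℝ × ℝ} (hx : x ∈ I₁ ×ˢ I₂) : u x = frontier F p (μ x) x (u (μ x)) := by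
  obtain ⟨⟨y, hy, hyx⟩, hmax⟩ := hu.payoff x hx
  apply le_antisymm
  · rw [← hyx]; exact hu.rational x hx y hy
  · exact hmax ⟨μ x, hu.mapsTo hx, rfl⟩

lemma one_add_two_mul_pos (h2 : ∀ x₂ ∈ I₂, -(1 / 2 : ℝ) < x₂) {x : ℝ × ℝ}
    (hx : x ∈ I₁ ×ˢ I₂) : 0 < 1 + 2 * x.2 := by
  have := h2 x.2 hx.2; linarith

/-- Weighting payoffs by `wt` gives the frontier slope `-1`: the weighted payoffs of a team add up
to a surplus that does not depend on how wages are split. -/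
lemma frontier_one (h2 : ∀ x₂ ∈ I₂, -(1 / 2 : ℝ) < x₂) {x y : ℝ × ℝ} (hx : x ∈ I₁ ×ˢ I₂)
    (hy : y ∈ I₁ ×ˢ I₂) (v : ℝ) :
    wt x * frontier F 1 y x v = F x.1 y.1 * (wt x + wt y) / 2 - wt y * v := by
  have h1 := one_add_two_mul_pos h2 hx
  have h3 := one_add_two_mul_pos h2 hy
  rw [frontier_eq (by linarith) (by linarith)]
  unfold wt
  field_simp
  ring

lemma IsEquilibrium.surplus_le {u : ℝ × ℝ → ℝ} (hu : IsEquilibrium I₁ I₂ H F 1 μ u)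
    (h2 : ∀ x₂ ∈ I₂, -(1 / 2 : ℝ) < x₂) {x y : ℝ × ℝ} (hx : x ∈ I₁ ×ˢ I₂)
    (hy : y ∈ I₁ ×ˢ I₂) : F x.1 y.1 * (wt x + wt y) / 2 ≤ wt x * u x + wt y * u y := by
  have h := (hu.payoff x hx).2 ⟨y, hy, rfl⟩
  have h1 := frontier_one (F := F) h2 hx hy (u y)
  have := mul_le_mul_of_nonneg_left h (wt_pos_of (h2 x.2 hx.2)).le
  linarith

lemma IsEquilibrium.surplus_eq {u : ℝ × ℝ → ℝ} (hu : IsEquilibrium I₁ I₂ H F 1 μ u)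
    (h2 : ∀ x₂ ∈ I₂, -(1 / 2 : ℝ) < x₂) {x : ℝ × ℝ} (hx : x ∈ I₁ ×ˢ I₂) :
    wt x * u x + wt (μ x) * u (μ x) = F x.1 (μ x).1 * (wt x + wt (μ x)) / 2 := by
  have h1 := frontier_one (F := F) h2 hx (hu.mapsTo hx) (u (μ x))
  rw [← hu.payoff_eq hx] at h1
  linarith

lemma frontier_zero (x y : ℝ × ℝ) (v : ℝ) : frontier F 0 y x v = F x.1 y.1 - v := by
  rw [frontier_eq (by norm_num) (by norm_num)]; ring

lemma IsEquilibrium.benchmark_le {uB : ℝ → ℝ}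
    (hu : IsEquilibrium I₁ I₂ H F 0 μ fun x => uB x.1) {x y : ℝ × ℝ} (hx : x ∈ I₁ ×ˢ I₂)
    (hy : y ∈ I₁ ×ˢ I₂) : F x.1 y.1 ≤ uB x.1 + uB y.1 := by
  have h := (hu.payoff x hx).2 ⟨y, hy, rfl⟩
  simp only [frontier_zero] at h
  linarith

lemma IsEquilibrium.benchmark_eq {uB : ℝ → ℝ}
    (hu : IsEquilibrium I₁ I₂ H F 0 μ fun x => uB x.1) {x : ℝ × ℝ} (hx : x ∈ I₁ ×ˢ I₂) :
    uB x.1 + uB (μ x).1 = F x.1 (μ x).1 := by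
  have h := hu.payoff_eq hx
  simp only [frontier_zero] at h
  linarith

lemma IsEquilibrium.half_le_benchmark {uB : ℝ → ℝ}
    (hu : IsEquilibrium I₁ I₂ H F 0 μ fun x => uB x.1) {x : ℝ × ℝ} (hx : x ∈ I₁ ×ˢ I₂) :
    F x.1 x.1 / 2 ≤ uB x.1 := by
  have := hu.benchmark_le hx hx
  linarith

/-- Under supermodularity the benchmark is positively assortative: workers share equally. -/
lemma IsEquilibrium.benchmark_eq_half {uB : ℝ → ℝ} (hF : IsProduction I₁ F)
    (hs : Supermodular I₁ F) (hu : IsEquilibrium I₁ I₂ H F 0 μ fun x => uB x.1) {x : ℝ × ℝ}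
    (hx : x ∈ I₁ ×ˢ I₂) : uB x.1 = F x.1 x.1 / 2 := by
  have h1 := hu.half_le_benchmark hx
  have h2 := hu.half_le_benchmark (hu.mapsTo hx)
  have h3 := hu.benchmark_eq hx
  have hy := hu.mapsTo hx
  have h5 := hF.symm _ hx.1 _ hy.1
  have h4 : 2 * F x.1 (μ x).1 ≤ F x.1 x.1 + F (μ x).1 (μ x).1 := by
    rcases le_total x.1 (μ x).1 with h | h
    · linarith [hs _ hx.1 _ hy.1 _ hx.1 _ hy.1 h h]
    · linarith [hs _ hy.1 _ hx.1 _ hy.1 _ hx.1 h h]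
  linarith

lemma IsEquilibrium.half_le {u : ℝ × ℝ → ℝ} (hu : IsEquilibrium I₁ I₂ H F 1 μ u)
    (h2 : ∀ x₂ ∈ I₂, -(1 / 2 : ℝ) < x₂) {x : ℝ × ℝ} (hx : x ∈ I₁ ×ˢ I₂) :
    F x.1 x.1 / 2 ≤ u x := by
  have h := hu.surplus_le h2 hx hx
  have hw := wt_pos_of (h2 x.2 hx.2)
  by_contra! hc
  nlinarith

end equilibrium

/-! ### Null sets of the population -/

section null

variable [IsProbabilityMeasure H]

lemma IsPopulation.ae_mem (hH : IsPopulation I₁ I₂ H) : ∀ᵐ x ∂H, x ∈ I₁ ×ˢ I₂ :=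
  mem_ae_iff.2 hH.concentrated

lemma IsPopulation.measurableSet (hH : IsPopulation I₁ I₂ H) : MeasurableSet (I₁ ×ˢ I₂) :=
  hH.measurable_skill.prod hH.measurable_pref

/-- A measurable set whose vertical slices have at most one point is null. -/
lemma IsPopulation.null_of_ae_slices (hH : IsPopulation I₁ I₂ H) {S : Set (ℝ × ℝ)}
    (hS : MeasurableSet S) (h : ∀ᵐ a ∂H.fst, {t | (a, t) ∈ S}.Subsingleton) : H S = 0 := by
  rw [← H.disintegrate H.condKernel, Measure.compProd_apply hS, lintegral_eq_zero_iff']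
  · filter_upwards [hH.cond_ac, h] with a ha hb
    exact ha (hb.measure_zero volume)
  · exact (Kernel.measurable_kernel_prodMk_left hS).aemeasurable

lemma IsPopulation.null_of_slices (hH : IsPopulation I₁ I₂ H) {S : Set (ℝ × ℝ)}
    (hS : MeasurableSet S) (h : ∀ a, {t | (a, t) ∈ S}.Subsingleton) : H S = 0 :=
  hH.null_of_ae_slices hS (Filter.Eventually.of_forall h)

/-- A comonotone set of skills and (injective transforms of) preferences is null if the
distribution of skills has no atoms. -/
lemma IsPopulation.null_of_comonotone (hH : IsPopulation I₁ I₂ H) (ha : ∀ a, H.fst {a} = 0)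
    {ρ : ℝ × ℝ → ℝ} (hρ : Measurable ρ)
    (hinj : ∀ x ∈ I₁ ×ˢ I₂, ∀ y ∈ I₁ ×ˢ I₂, x.1 = y.1 → ρ x = ρ y → x = y)
    {E : Set (ℝ × ℝ)} (hE : E ⊆ I₁ ×ˢ I₂)
    (hmono : ∀ x ∈ E, ∀ y ∈ E, x.1 < y.1 → ρ x ≤ ρ y) : H E = 0 := by
  -- The skills at which `E` contains two levels of `ρ`. Rationals separating the levels increase
  -- strictly with the skill, so `N` is countable.
  set N : Set ℝ := {a | ∃ x ∈ E, ∃ y ∈ E, x.1 = a ∧ y.1 = a ∧ ρ x < ρ y} with hN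
  have hNc : N.Countable := by
    have hq : ∀ a ∈ N, ∃ q : ℚ, ∃ x ∈ E, ∃ y ∈ E, x.1 = a ∧ y.1 = a ∧ ρ x < q ∧ (q : ℝ) < ρ y := by
      rintro a ⟨x, hx, y, hy, h1, h2, h3⟩
      obtain ⟨q, hq1, hq2⟩ := exists_rat_btwn h3
      exact ⟨q, x, hx, y, hy, h1, h2, hq1, hq2⟩
    choose! q hq using hq
    have key : ∀ a ∈ N, ∀ b ∈ N, a < b → q a < q b := by
      intro a haN b hbN hab
      obtain ⟨x, hx, y, hy, h1, h2, h3, h4⟩ := hq a haN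
      obtain ⟨x', hx', y', hy', h1', h2', h3', h4'⟩ := hq b hbN
      have := hmono y hy x' hx' (by rw [h2, h1']; exact hab)
      exact_mod_cast (h4.trans_le this).trans h3'
    refine (Set.MapsTo.countable_of_injOn (f := q) (t := univ) (fun _ _ => mem_univ _) ?_
      (countable_univ))
    intro a haN b hbN hab
    rcases lt_trichotomy a b with h | h | h
    · exact absurd hab (key a haN b hbN h).ne
    · exact h
    · exact absurd hab (key b hbN a haN h).ne'
  have hN0 : H (Prod.fst ⁻¹' N) = 0 := by
    rw [← Measure.fst_apply hNc.measurableSet]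
    exact (measure_null_iff_singleton hNc).2 fun a _ => ha a
  -- The upper envelope of `ρ` on `E`, with extended values so that the supremum always exists. It
  -- is monotone, hence measurable, and off `N` the set `E` lies on its graph.
  set f : ℝ → EReal := fun a => sSup ((fun x => (ρ x : EReal)) '' {x ∈ E | x.1 ≤ a}) with hf
  have hfm : Monotone f := fun a b hab =>
    sSup_le_sSup (image_mono fun x hx => ⟨hx.1, hx.2.trans hab⟩)
  have hgraph : E ⊆ ({x | (ρ x : EReal) = f x.1} ∩ I₁ ×ˢ I₂) ∪ Prod.fst ⁻¹' N := by
    intro x hx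
    by_cases hxN : x.1 ∈ N
    · exact Or.inr hxN
    · refine Or.inl ⟨?_, hE hx⟩
      apply le_antisymm
      · exact le_sSup ⟨x, ⟨hx, le_rfl⟩, rfl⟩
      · apply sSup_le
        rintro _ ⟨y, ⟨hy, hyx⟩, rfl⟩
        simp only [EReal.coe_le_coe_iff]
        rcases hyx.lt_or_eq with h | h
        · exact hmono y hy x hx h
        · by_contra! hc
          exact hxN ⟨x, hx, y, hy, rfl, h, hc⟩
  have hgm : MeasurableSet ({x : ℝ × ℝ | (ρ x : EReal) = f x.1} ∩ I₁ ×ˢ I₂) :=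
    (measurableSet_eq_fun hρ.coe_real_ereal (hfm.measurable.comp measurable_fst)).inter
      hH.measurableSet
  have hg0 : H ({x : ℝ × ℝ | (ρ x : EReal) = f x.1} ∩ I₁ ×ˢ I₂) = 0 := by
    refine hH.null_of_slices hgm fun a s hs t ht => ?_
    have h1 : ρ (a, s) = ρ (a, t) := EReal.coe_injective (hs.1.trans ht.1.symm)
    exact congrArg Prod.snd (hinj _ hs.2 _ ht.2 rfl h1)
  exact measure_mono_null hgraph (measure_union_null hg0 hN0)

end null

end

/-! ### Strict gains in the additive and multiplicative specifications -/

section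

variable {I₁ I₂ : Set ℝ} {H : Measure (ℝ × ℝ)} {F : ℝ → ℝ → ℝ}

section strict

variable {μ μB : ℝ × ℝ → ℝ × ℝ} {u : ℝ × ℝ → ℝ} {uB : ℝ → ℝ}

/-- Two types whose own-type team is optimal cannot gain from teaming up with each other. -/
lemma surplus_swap (h2 : ∀ x₂ ∈ I₂, -(1 / 2 : ℝ) < x₂) (hu : IsEquilibrium I₁ I₂ H F 1 μ u)
    {x y : ℝ × ℝ} (hx : x ∈ I₁ ×ˢ I₂) (hy : y ∈ I₁ ×ˢ I₂) (hxu : u x ≤ F x.1 x.1 / 2)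
    (hyu : u y ≤ F y.1 y.1 / 2) :
    F x.1 y.1 * (wt x + wt y) ≤ F x.1 x.1 * wt x + F y.1 y.1 * wt y := by
  have h := hu.surplus_le h2 hx hy
  have h3 := mul_le_mul_of_nonneg_left hxu (wt_pos_of (h2 x.2 hx.2)).le
  have h4 := mul_le_mul_of_nonneg_left hyu (wt_pos_of (h2 y.2 hy.2)).le
  linarith

lemma measurable_wt : Measurable wt := by
  unfold wt; fun_prop

lemma wt_inj (h2 : ∀ x₂ ∈ I₂, -(1 / 2 : ℝ) < x₂) {x y : ℝ × ℝ}
    (hx : x ∈ I₁ ×ˢ I₂) (hy : y ∈ I₁ ×ˢ I₂) (h : wt x = wt y) : x.2 = y.2 := by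
  have h1 := one_add_two_mul_pos h2 hx
  have h3 := one_add_two_mul_pos h2 hy
  unfold wt at h
  rw [div_eq_div_iff h1.ne' h3.ne'] at h
  linarith

/-- The linear combination `t₀ ln X₁ + t₁ ln (1 + 2 X₂)`. -/
def logComb (t : EuclideanSpace ℝ (Fin 2)) (x : ℝ × ℝ) : ℝ :=
  t 0 * Real.log x.1 + t 1 * Real.log (1 + 2 * x.2)

lemma measurable_logComb (t : EuclideanSpace ℝ (Fin 2)) : Measurable (logComb t) := by
  unfold logComb; fun_prop

lemma charFun_logComb (t : EuclideanSpace ℝ (Fin 2)) (s : ℝ) :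
    charFun (H.map (logComb t)) s =
      charFun (H.map fun x => !₂[Real.log x.1, Real.log (1 + 2 * x.2)]) (s • t) := by
  have hm : Measurable fun x : ℝ × ℝ =>
      (!₂[Real.log x.1, Real.log (1 + 2 * x.2)] : EuclideanSpace ℝ (Fin 2)) := by
    refine (WithLp.measurable_toLp 2 (Fin 2 → ℝ)).comp ?_
    refine measurable_pi_lambda _ fun i => ?_
    fin_cases i <;> simp <;> fun_prop
  rw [charFun_apply_real, charFun_apply, integral_map (measurable_logComb t).aemeasurable
    (by fun_prop), integral_map hm.aemeasurable (by fun_prop)]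
  refine integral_congr_ae (Filter.Eventually.of_forall fun x => ?_)
  simp only [logComb, PiLp.inner_apply, Fin.sum_univ_two]
  simp
  ring_nf

variable {Δ : EuclideanSpace ℝ (Fin 2)} {Ω : Matrix (Fin 2) (Fin 2) ℝ} {φ : ℝ → ℝ}

/-- The quadratic form of a matrix. -/
def quad (Ω : Matrix (Fin 2) (Fin 2) ℝ) (t : EuclideanSpace ℝ (Fin 2)) : ℝ :=
  t.ofLp ⬝ᵥ (Ω *ᵥ t.ofLp)

lemma quad_smul (s : ℝ) (t : EuclideanSpace ℝ (Fin 2)) : quad Ω (s • t) = s ^ 2 * quad Ω t := by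
  simp [quad, Matrix.mulVec_smul, smul_dotProduct]
  ring

lemma charFun_logComb_elliptical
    (hφ : ∀ t : EuclideanSpace ℝ (Fin 2),
      charFun (H.map fun x => !₂[Real.log x.1, Real.log (1 + 2 * x.2)]) t =
      Complex.exp (Complex.I * ((inner ℝ t Δ : ℝ) : ℂ)) * ((φ (quad Ω t) : ℝ) : ℂ))
    (t : EuclideanSpace ℝ (Fin 2)) (s : ℝ) :
    charFun (H.map (logComb t)) s =
      Complex.exp (Complex.I * ((s * inner ℝ t Δ : ℝ) : ℂ)) *
        ((φ (s ^ 2 * quad Ω t) : ℝ) : ℂ) := by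
  rw [charFun_logComb, hφ, quad_smul, real_inner_smul_left]

variable [IsProbabilityMeasure H]

lemma ae_lt_of_null (hH : IsPopulation I₁ I₂ H) (hF : IsProduction I₁ F)
    (hs : Supermodular I₁ F) (huB : IsEquilibrium I₁ I₂ H F 0 μB fun x => uB x.1)
    (h0 : H {x ∈ I₁ ×ˢ I₂ | u x ≤ F x.1 x.1 / 2} = 0) : ∀ᵐ x ∂H, uB x.1 < u x := by
  filter_upwards [hH.ae_mem, measure_eq_zero_iff_ae_notMem.1 h0] with x hx hxn
  rw [huB.benchmark_eq_half hF hs hx]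
  by_contra! hc
  exact hxn ⟨hx, hc⟩

/-- With additive output `surplus_swap` becomes `(K y₁ - K x₁) (wt y - wt x) ≥ 0`, so weights weakly
increase in skill among these workers. -/
lemma null_self_matched_of_additive (hH : IsPopulation I₁ I₂ H) (hF : IsProduction I₁ F)
    (hu : IsEquilibrium I₁ I₂ H F 1 μ u) {K : ℝ → ℝ}
    (hK : ∀ a ∈ I₁, ∀ b ∈ I₁, F a b = K a + K b) (ha : ∀ a, H.fst {a} = 0) :
    H {x ∈ I₁ ×ˢ I₂ | u x ≤ F x.1 x.1 / 2} = 0 := by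
  refine hH.null_of_comonotone ha measurable_wt (fun x hx y hy h1 h2 =>
    Prod.ext h1 (wt_inj hH.pref_gt hx hy h2)) (fun x hx => hx.1) ?_
  rintro x ⟨hx, hxu⟩ y ⟨hy, hyu⟩ hlt
  have h := surplus_swap hH.pref_gt hu hx hy hxu hyu
  have hmon := hF.increasing y.1 hy.1 hx.1 hy.1 hlt
  simp only [hK _ hx.1 _ hx.1, hK _ hx.1 _ hy.1, hK _ hy.1 _ hy.1] at h hmon
  by_contra! hc
  nlinarith

/-- With `X = x₁ ^ c` and `Y = y₁ ^ c`, `surplus_swap` factors as `(Y - X) / c * (Y wt y - X wt x) ≥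
0`, and the first factor has the sign of `y₁ - x₁`. The comonotone transform is therefore `x₁ ^ c *
wt x`. -/
lemma null_self_matched_of_multiplicative (hH : IsPopulation I₁ I₂ H)
    (hu : IsEquilibrium I₁ I₂ H F 1 μ u) (hpos : ∀ a ∈ I₁, 0 < a) {A c : ℝ} (hc : c ≠ 0)
    (hA : ∀ a ∈ I₁, ∀ b ∈ I₁, F a b = A + ((a * b) ^ c - 1) / c) (ha : ∀ a, H.fst {a} = 0) :
    H {x ∈ I₁ ×ˢ I₂ | u x ≤ F x.1 x.1 / 2} = 0 := by
  have hρ : Measurable fun x : ℝ × ℝ => x.1 ^ c * wt x := by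
    have := measurable_wt
    fun_prop
  refine hH.null_of_comonotone ha hρ ?_ (fun x hx => hx.1) ?_
  · intro x hx y hy h1 h2
    refine Prod.ext h1 (wt_inj hH.pref_gt hx hy ?_)
    simp only [h1] at h2
    exact mul_left_cancel₀ (Real.rpow_pos_of_pos (hpos _ hy.1) c).ne' h2
  rintro x ⟨hx, hxu⟩ y ⟨hy, hyu⟩ hlt
  have h := surplus_swap hH.pref_gt hu hx hy hxu hyu
  have hx0 := hpos _ hx.1
  have hy0 := hpos _ hy.1
  simp only [hA _ hx.1 _ hx.1, hA _ hx.1 _ hy.1, hA _ hy.1 _ hy.1,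
    Real.mul_rpow hx0.le hx0.le, Real.mul_rpow hx0.le hy0.le, Real.mul_rpow hy0.le hy0.le] at h
  set X := x.1 ^ c with hX
  set Y := y.1 ^ c with hY
  have key : 0 ≤ (Y - X) / c * (Y * wt y - X * wt x) := by
    have : (Y - X) / c * (Y * wt y - X * wt x) = (A + (X * X - 1) / c) * wt x +
      (A + (Y * Y - 1) / c) * wt y - (A + (X * Y - 1) / c) * (wt x + wt y) := by
      field_simp
      ring
    rw [this]; linarith
  have hlt' : 0 < (Y - X) / c := by
    rcases lt_or_gt_of_ne hc with hc | hc
    · apply div_pos_of_neg_of_neg _ hc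
      have := Real.rpow_lt_rpow_of_neg hx0 hlt hc
      linarith
    · apply div_pos _ hc
      have := Real.rpow_lt_rpow hx0.le hlt hc
      linarith
  have := nonneg_of_mul_nonneg_right key hlt'
  show X * wt x ≤ Y * wt y
  linarith

/-- Along a ray the elliptical characteristic function depends on the direction only through the
quadratic form and a location, so projections whose forms differ by a square factor differ in law by
an affine map. -/
lemma map_logComb_eq
    (hφ : ∀ t : EuclideanSpace ℝ (Fin 2),
      charFun (H.map fun x => !₂[Real.log x.1, Real.log (1 + 2 * x.2)]) t =
      Complex.exp (Complex.I * ((inner ℝ t Δ : ℝ) : ℂ)) * ((φ (quad Ω t) : ℝ) : ℂ))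
    (t t' : EuclideanSpace ℝ (Fin 2)) (k : ℝ) (hk : quad Ω t = k ^ 2 * quad Ω t') :
    H.map (logComb t) =
      ((H.map (logComb t')).map (fun y => k * y)).map
        (fun y => y + (inner ℝ t Δ - k * inner ℝ t' Δ)) := by
  have := Measure.isProbabilityMeasure_map (μ := H) (measurable_logComb t).aemeasurable
  have := Measure.isProbabilityMeasure_map (μ := H) (measurable_logComb t').aemeasurable
  apply Measure.ext_of_charFun
  ext s
  rw [charFun_map_add_const, charFun_map_mul, charFun_logComb_elliptical hφ,
    charFun_logComb_elliptical hφ, hk]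
  have e1 : (k * s) ^ 2 * quad Ω t' = s ^ 2 * (k ^ 2 * quad Ω t') := by ring
  rw [e1, mul_right_comm, ← Complex.exp_add]
  congr 2
  simp
  ring

/-- Log-elliptical populations with full support and at least two skills have no atoms in the
distribution of skills. -/
lemma no_atoms_of_elliptical (hH : IsPopulation I₁ I₂ H) (hfull : FullSupport I₁ I₂ H)
    (hpos : ∀ a ∈ I₁, 0 < a) (hI : I₁.Nontrivial)
    (hell : IsElliptical (H.map fun x => !₂[Real.log x.1, Real.log (1 + 2 * x.2)])) (a : ℝ) :
    H.fst {a} = 0 := by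
  obtain ⟨Δ, Ω, φ, hΩ, hφ⟩ := hell
  replace hφ : ∀ t : EuclideanSpace ℝ (Fin 2),
      charFun (H.map fun x => !₂[Real.log x.1, Real.log (1 + 2 * x.2)]) t =
      Complex.exp (Complex.I * ((inner ℝ t Δ : ℝ) : ℂ)) * ((φ (quad Ω t) : ℝ) : ℂ) := hφ
  have hq : ∀ s : ℝ, quad Ω !₂[1, s] = Ω 0 0 + 2 * s * Ω 0 1 + s ^ 2 * Ω 1 1 := by
    intro s
    have h10 : Ω 1 0 = Ω 0 1 := by simpa using hΩ.isHermitian.apply 0 1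
    simp [quad, dotProduct, Matrix.mulVec, Fin.sum_univ_two, h10]
    ring
  have h00 : 0 ≤ Ω 0 0 := hΩ.diag_nonneg
  have h11 : 0 ≤ Ω 1 1 := hΩ.diag_nonneg
  rcases h00.eq_or_lt with h0 | h0
  · exfalso
    have hd : H.map (logComb !₂[1, 0]) = Measure.dirac (inner ℝ !₂[1, 0] Δ) := by
      have := Measure.isProbabilityMeasure_map (μ := H)
        (measurable_logComb !₂[1, 0]).aemeasurable
      have hq0 : quad Ω !₂[1, 0] = 0 := by rw [hq]; simp [← h0]
      have hφ0 : ((φ 0 : ℝ) : ℂ) = 1 := by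
        have := charFun_logComb_elliptical hφ !₂[1, 0] 0
        rw [hq0, charFun_zero] at this
        simpa using this.symm
      apply Measure.ext_of_charFun
      ext s
      rw [charFun_logComb_elliptical hφ, hq0, charFun_dirac, mul_zero, hφ0]
      simp
      ring_nf
    have hae : ∀ᵐ x ∂H, x.1 = Real.exp (inner ℝ !₂[1, 0] Δ) := by
      have h1 : ∀ᵐ y ∂(H.map (logComb !₂[1, 0])), y = inner ℝ !₂[1, 0] Δ := by
        rw [hd]
        exact (ae_dirac_iff (p := fun y => y = inner ℝ !₂[1, 0] Δ)
          (measurableSet_singleton _)).2 rfl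
      filter_upwards [ae_of_ae_map (measurable_logComb _).aemeasurable h1, hH.ae_mem]
        with x hx hxI
      rw [← hx]
      simp [logComb, Real.exp_log (hpos _ hxI.1)]
    obtain ⟨b, hb, hne⟩ := hI.exists_ne (Real.exp (inner ℝ !₂[1, 0] Δ))
    obtain ⟨x, hx⟩ := hH.ae_mem.exists
    have hopen : IsOpen {x : ℝ × ℝ | x.1 ≠ Real.exp (inner ℝ !₂[1, 0] Δ)} :=
      isOpen_ne_fun continuous_fst continuous_const
    refine (hfull _ hopen ⟨(b, x.2), hne, hb, hx.2⟩).ne' (measure_mono_null inter_subset_left ?_)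
    exact hae
  · obtain ⟨σ, hσ1, hσ2⟩ : ∃ σ : ℝ, σ ^ 2 = 1 ∧ 0 ≤ σ * Ω 0 1 := by
      rcases le_total 0 (Ω 0 1) with h | h
      · exact ⟨1, by norm_num, by linarith⟩
      · exact ⟨-1, by norm_num, by linarith⟩
    have hqn : ∀ n : ℕ, 0 < quad Ω !₂[1, σ * n] := by
      intro n
      rw [hq]
      have : (0 : ℝ) ≤ n := Nat.cast_nonneg n
      nlinarith [mul_nonneg this hσ2, mul_nonneg (sq_nonneg (σ * n)) h11]
    set k : ℕ → ℝ := fun n => √(quad Ω !₂[1, σ * n] / quad Ω !₂[1, 0]) with hk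
    have hq1 : 0 < quad Ω !₂[1, 0] := by rw [hq]; simpa using h0
    have hksq : ∀ n : ℕ, quad Ω !₂[1, σ * n] = k n ^ 2 * quad Ω !₂[1, 0] := by
      intro n
      simp only [hk]
      rw [Real.sq_sqrt (div_pos (hqn n) hq1).le, div_mul_cancel₀ _ hq1.ne']
    -- The value to which an atom of `ln X₁` at `log a` is carried in direction `(1, σ n)`.
    set c : ℕ → ℝ := fun n => k n * Real.log a +
      (inner ℝ !₂[1, σ * n] Δ - k n * inner ℝ !₂[1, 0] Δ) with hc
    set A : ℕ → Set (ℝ × ℝ) := fun n => {x ∈ I₁ ×ˢ I₂ | logComb !₂[1, σ * n] x = c n} with hA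
    have hAm : ∀ n, MeasurableSet (A n) := fun n =>
      hH.measurableSet.inter ((measurable_logComb _) (measurableSet_singleton _))
    have hmass : ∀ n, H.fst {a} ≤ H (A n) := by
      intro n
      have h1 : H (A n) = H.map (logComb !₂[1, σ * n]) {c n} := by
        rw [Measure.map_apply (measurable_logComb _) (measurableSet_singleton _)]
        exact measure_congr (by
          filter_upwards [hH.ae_mem] with x hx
          exact propext ⟨fun h => h.2, fun h => ⟨hx, h⟩⟩)
      rw [h1, map_logComb_eq hφ _ _ _ (hksq n), Measure.map_apply (by fun_prop)
        (measurableSet_singleton _), Measure.map_apply (by fun_prop)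
        ((measurableSet_singleton _).preimage (by fun_prop)),
        Measure.map_apply (measurable_logComb _)
        (((measurableSet_singleton _).preimage (by fun_prop)).preimage (by fun_prop)),
        Measure.fst_apply (measurableSet_singleton _)]
      apply measure_mono
      rintro x (hx : x.1 = a)
      simp [logComb, hx, hc]
      ring
    -- Two of the level equations determine `log (1 + 2 x₂)`, so the intersection has at most one
    -- point in each slice.
    have hdisj : Pairwise (Function.onFun (AEDisjoint H) A) := by
      intro m n hmn
      refine hH.null_of_slices ((hAm m).inter (hAm n)) ?_
      have hinj : ∀ x ∈ A m ∩ A n, ∀ y ∈ A m ∩ A n, x.2 = y.2 := by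
        rintro x ⟨hxm, hxn⟩ y ⟨hym, hyn⟩
        have e1 := hxm.2.trans hym.2.symm
        have e2 := hxn.2.trans hyn.2.symm
        simp only [logComb] at e1 e2
        simp at e1 e2
        have hne : σ * ((m : ℝ) - n) ≠ 0 := by
          apply mul_ne_zero
          · rintro rfl; norm_num at hσ1
          · exact sub_ne_zero.2 (Nat.cast_injective.ne hmn)
        have e3 : σ * ((m : ℝ) - n) * (Real.log (1 + 2 * x.2) - Real.log (1 + 2 * y.2)) = 0 := by
          linarith
        have e4 := (mul_eq_zero.1 e3).resolve_left hne
        have := Real.log_injOn_pos (one_add_two_mul_pos hH.pref_gt hxm.1)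
          (one_add_two_mul_pos hH.pref_gt hym.1) (sub_eq_zero.1 e4)
        linarith
      intro b s hs t ht
      exact hinj _ hs _ ht
    have hsum : ∑' n, H (A n) ≤ 1 := by
      rw [← measure_iUnion₀ hdisj fun n => (hAm n).nullMeasurableSet]
      exact prob_le_one
    by_contra hne
    have : (∑' _ : ℕ, H.fst {a}) ≤ 1 := (ENNReal.tsum_le_tsum hmass).trans hsum
    rw [ENNReal.tsum_const_eq_top_of_ne_zero hne] at this
    exact absurd this (by simp)

end strict

end

/-! ### Rearrangement and potentials -/

section

section potentials

open Finset Equiv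

/-- Rearrangement inequality for a function with increasing differences. -/
lemma sum_perm_le_of_increasing_differences {ι : Type*} [Fintype ι] [DecidableEq ι]
    (V : ι → ℝ) (p : ι → ι → ℝ)
    (hp : ∀ m i j, V i ≤ V m → V j ≤ V m → p i m + p m j ≤ p m m + p i j)
    (s : Finset ι) (σ : Perm ι) (hσ : {x | σ x ≠ x} ⊆ (s : Set ι)) :
    ∑ i ∈ s, p i (σ i) ≤ ∑ i ∈ s, p i i := by
  induction s using induction_on_max_value V generalizing σ with
  | empty => simp
  | insert a s has hamax hind =>
    -- `τ` cuts the maximal index `a` out of its cycle: it fixes `a`, sends `σ.symm a` to `σ a`, and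
    -- otherwise agrees with `σ`. The hypothesis at `a` says that this does not lower the sum.
    set τ : Perm ι := σ.trans (swap a (σ a)) with hτ
    have hτs : {x | τ x ≠ x} ⊆ (s : Set ι) := by
      intro x hx
      simp only [τ, Ne, Set.mem_ofPred_eq, Equiv.swap_comp_apply] at hx
      split_ifs at hx with h₁ h₂
      · obtain rfl | hax := eq_or_ne x a
        · contradiction
        · exact mem_of_mem_insert_of_ne (hσ fun h ↦ hax <| h.symm.trans h₁) hax
      · exact (hx <| σ.injective h₂.symm).elim
      · exact mem_of_mem_insert_of_ne (hσ hx) (ne_of_apply_ne _ h₂)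
    specialize hind τ hτs
    simp_rw [sum_insert has]
    refine le_trans ?_ (add_le_add_right hind _)
    obtain hσa | hσa := eq_or_ne a (σ a)
    · rw [hτ, ← hσa, swap_self, trans_refl]
    have h1s : σ.symm a ∈ s := by
      refine mem_of_mem_insert_of_ne (hσ fun h ↦ hσa ?_) fun h => hσa ?_
      · rwa [apply_symm_apply, eq_symm_apply, eq_comm] at h
      · rwa [symm_apply_eq] at h
    have h2s : σ a ∈ s :=
      mem_of_mem_insert_of_ne (hσ <| σ.injective.ne hσa.symm) hσa.symm
    rw [← s.sum_erase_add _ h1s, ← s.sum_erase_add (fun x => p x (τ x)) h1s]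
    have e1 : τ (σ.symm a) = σ a := by simp [hτ]
    have e2 : ∑ x ∈ s.erase (σ.symm a), p x (τ x) = ∑ x ∈ s.erase (σ.symm a), p x (σ x) := by
      refine sum_congr rfl fun x hx => ?_
      rw [mem_erase, Ne, eq_symm_apply] at hx
      rw [hτ, Equiv.trans_apply, swap_apply_of_ne_of_ne hx.1 (σ.injective.ne _)]
      rintro rfl
      exact has hx.2
    have := hp a (σ.symm a) (σ a) (hamax _ h1s) (hamax _ h2s)
    rw [e1, e2, apply_symm_apply]
    linarith

/-- Rockafellar potentials for a comonotone relation and a function with increasing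
differences. -/
theorem exists_potential {α β : Type*} [LinearOrder β] (p : α → β → ℝ) (V : α → ℝ)
    (Γ : α → β → Prop)
    (hΓ : ∀ x b x' b', Γ x b → Γ x' b' → V x ≤ V x' → b ≤ b')
    (hp : ∀ x c x' b' z b, Γ x c → Γ x' b' → Γ z b → V x ≤ V x' → b ≤ b' →
      p x b' + p x' b ≤ p x b + p x' b') :
    ∃ φ : α → ℝ, ∀ x b x' c, Γ x b → Γ x' c → p x' b - φ x' ≤ p x b - φ x := by
  classical
  by_cases hne : ∃ x b, Γ x b
  swap
  · exact ⟨fun _ => 0, fun x b x' c h => (hne ⟨x, b, h⟩).elim⟩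
  obtain ⟨x₀, b₀, h₀⟩ := hne
  let N := {n : α × β // Γ n.1 n.2}
  -- The value of a Rockafellar chain; the potential at `x` will be the supremum over chains from a
  -- base node to `x`.
  let len : (ℕ → N) → ℕ → ℝ := fun f k => ∑ i ∈ range k,
    (p (f (i + 1)).1.1 (f i).1.2 - p (f i).1.1 (f i).1.2)
  -- Cyclic monotonicity: a closed chain is the rearrangement by `finRotate` minus the identity
  -- assignment.
  have hclosed : ∀ (f : ℕ → N) (k : ℕ), len f (k + 1) +
      (p (f 0).1.1 (f (k + 1)).1.2 - p (f (k + 1)).1.1 (f (k + 1)).1.2) ≤ 0 := by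
    intro f k
    have h := sum_perm_le_of_increasing_differences (ι := Fin (k + 2))
      (fun i => V (f i).1.1) (fun i j => p (f j).1.1 (f i).1.2) (fun m i j hi hj => by
        have := hp _ _ _ _ _ _ (f j).2 (f m).2 (f i).2 hj (hΓ _ _ _ _ (f i).2 (f m).2 hi)
        linarith) Finset.univ (finRotate (k + 2)) (by simp)
    rw [Fin.sum_univ_castSucc, Fin.sum_univ_castSucc (n := k + 1)] at h
    simp only [finRotate_apply, Fin.coeSucc_eq_succ, Fin.last_add_one, Fin.val_succ,
      Fin.val_castSucc, Fin.val_last, Fin.val_zero] at h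
    rw [Fin.sum_univ_eq_sum_range (fun i => p (f (i + 1)).1.1 (f i).1.2) (k + 1),
      Fin.sum_univ_eq_sum_range (fun i => p (f i).1.1 (f i).1.2) (k + 1)] at h
    simp only [len, sum_sub_distrib]
    linarith
  let chains := {c : (ℕ → N) × ℕ // c.1 0 = ⟨(x₀, b₀), h₀⟩}
  let val : chains → α → ℝ := fun c x => len c.1.1 c.1.2 +
    (p x (c.1.1 c.1.2).1.2 - p (c.1.1 c.1.2).1.1 (c.1.1 c.1.2).1.2)
  have extend : ∀ (c : chains) (n : N), ∃ c' : chains, ∀ x,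
      val c' x = val c n.1.1 + (p x n.1.2 - p n.1.1 n.1.2) := by
    rintro ⟨⟨f, k⟩, hf⟩ n
    have hf0 : f 0 = ⟨(x₀, b₀), h₀⟩ := hf
    refine ⟨⟨⟨fun i => if i ≤ k then f i else n, k + 1⟩, by simp [hf0]⟩, fun x => ?_⟩
    have e : len (fun i => if i ≤ k then f i else n) (k + 1) = len f k +
        (p n.1.1 (f k).1.2 - p (f k).1.1 (f k).1.2) := by
      simp only [len, sum_range_succ]
      congr 1
      · refine sum_congr rfl fun i hi => ?_
        have := mem_range.1 hi
        rw [if_pos (by omega), if_pos (by omega)]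
      · simp
    simp only [val, e]
    simp
  -- Returning from `x` to the base node closes the chain, so `hclosed` bounds its value by that of
  -- the return step.
  have hbdd : ∀ x c, Γ x c → BddAbove (range fun ch : chains => val ch x) := by
    intro x c hx
    refine ⟨p x c - p x₀ c, ?_⟩
    rintro _ ⟨ch, rfl⟩
    obtain ⟨⟨f, k⟩, hf⟩ := ch
    have hf0 : f 0 = ⟨(x₀, b₀), h₀⟩ := hf
    have := hclosed (fun i => if i ≤ k then f i else ⟨(x, c), hx⟩) k
    have e : len (fun i => if i ≤ k then f i else ⟨(x, c), hx⟩) (k + 1) = len f k +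
        (p x (f k).1.2 - p (f k).1.1 (f k).1.2) := by
      simp only [len, sum_range_succ]
      congr 1
      · refine sum_congr rfl fun i hi => ?_
        have := mem_range.1 hi
        rw [if_pos (by omega), if_pos (by omega)]
      · simp
    rw [e] at this
    simp [hf0] at this
    show val ⟨(f, k), hf⟩ x ≤ _
    simp only [val]
    linarith
  have : Nonempty chains := ⟨⟨⟨fun _ => ⟨(x₀, b₀), h₀⟩, 0⟩, rfl⟩⟩
  refine ⟨fun x => ⨆ ch : chains, val ch x, fun x b x' c hx hx' => ?_⟩
  have : (⨆ ch : chains, val ch x) ≤ (⨆ ch : chains, val ch x') - (p x' b - p x b) := by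
    refine ciSup_le fun ch => ?_
    obtain ⟨ch', h'⟩ := extend ch ⟨(x, b), hx⟩
    have := le_ciSup (hbdd x' c hx') ch'
    simp only [h'] at this
    linarith
  simp only
  linarith

end potentials

/-! ### Rigidity, measurability and uniform ranks -/

/-- If `D ∘ μ ≤ -D` for a measure preserving map and `-D` is stochastically dominated by `D`,
then `D ∘ μ = -D`. -/
theorem ae_comp_eq_neg {α : Type*} [MeasurableSpace α] {P : Measure α} [IsProbabilityMeasure P]
    {D : α → ℝ} (hD : Measurable D) {m : α → α} (hm : AEMeasurable m P) (hmap : P.map m = P)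
    (hle : ∀ᵐ x ∂P, D (m x) ≤ -D x) (hdom : ∀ t : ℝ, P {x | D x < -t} ≤ P {x | t < D x}) :
    ∀ᵐ x ∂P, D (m x) = -D x := by
  have key : ∀ t : ℚ, ∀ᵐ x ∂P, D (m x) < -t → (t : ℝ) < D x := by
    intro t
    have hE : MeasurableSet {x | (t : ℝ) < D x} := measurableSet_lt measurable_const hD
    have hF : MeasurableSet {x | D x < -t} := measurableSet_lt hD measurable_const
    have hpre : P (m ⁻¹' {x | D x < -t}) = P {x | D x < -t} := by
      rw [← Measure.map_apply_of_aemeasurable hm hF, hmap]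
    -- The set on the right contains the one on the left and, by invariance and dominance, has no
    -- larger mass. Hence the two agree almost everywhere.
    have hsub : {x | (t : ℝ) < D x} ≤ᵐ[P] m ⁻¹' {x | D x < -t} := by
      filter_upwards [hle] with x hx hxt
      have hxt' : (t : ℝ) < D x := hxt
      show D (m x) < -t
      linarith
    have := ae_eq_of_ae_subset_of_measure_ge hsub (by rw [hpre]; exact hdom t)
      hE.nullMeasurableSet (measure_ne_top _ _)
    filter_upwards [this] with x hx hxt
    have : m ⁻¹' {x | D x < -t} = {x | D x < -t} ∘ m := rfl
    exact (Iff.of_eq hx).2 hxt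
  rw [← ae_all_iff] at key
  filter_upwards [hle, key] with x hx hk
  refine hx.antisymm ?_
  by_contra! hc
  obtain ⟨t, ht1, ht2⟩ := exists_rat_btwn (show D x < -D (m x) by linarith)
  exact (hk t (by linarith)).not_gt ht1

/-- A function that is touched from below at each point by a continuous function is
measurable. -/
lemma measurable_of_touching {X : Type*} [TopologicalSpace X] [MeasurableSpace X]
    [OpensMeasurableSpace X] {f : X → ℝ}
    (h : ∀ x, ∃ g : X → ℝ, Continuous g ∧ g x = f x ∧ ∀ y, g y ≤ f y) : Measurable f := by
  refine LowerSemicontinuous.measurable fun x t ht => ?_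
  obtain ⟨g, hg, hgx, hgf⟩ := h x
  have htx : t < g x := by rw [hgx]; exact ht
  filter_upwards [hg.continuousAt.eventually (lt_mem_nhds htx)] with y hy
  exact hy.trans_le (hgf y)

section rank

variable {Ω : Type*} [MeasurableSpace Ω] {P : Measure Ω} [IsProbabilityMeasure P] {g : Ω → ℝ}

lemma cdf_map_eq (hg : Measurable g) (l : ℝ) : cdf (P.map g) l = P.real {x | g x ≤ l} := by
  have := Measure.isProbabilityMeasure_map (μ := P) hg.aemeasurable
  rw [cdf_eq_real, map_measureReal_apply hg measurableSet_Iic]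
  rfl

lemma continuous_cdf_of_null (hg : Measurable g) (h0 : ∀ l, P {x | g x = l} = 0) :
    Continuous (cdf (P.map g)) := by
  have := Measure.isProbabilityMeasure_map (μ := P) hg.aemeasurable
  rw [continuous_iff_continuousAt]
  intro l
  rw [(monotone_cdf _).continuousAt_iff_leftLim_eq_rightLim, (cdf (P.map g)).rightLim_eq]
  have h1 := (cdf (P.map g)).measure_singleton l
  rw [measure_cdf, Measure.map_apply hg (measurableSet_singleton _)] at h1
  have h2 : P (g ⁻¹' {l}) = 0 := h0 l
  rw [h2, eq_comm, ENNReal.ofReal_eq_zero] at h1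
  exact le_antisymm ((monotone_cdf _).leftLim_le le_rfl) (by linarith)

/-- Ranks in an atomless distribution are uniformly distributed. -/
lemma real_rank_le (hg : Measurable g) (h0 : ∀ l, P {x | g x = l} = 0) {v : ℝ} (hv0 : 0 ≤ v)
    (hv1 : v ≤ 1) : P.real {x | P.real {y | g y ≤ g x} ≤ v} = v := by
  have := Measure.isProbabilityMeasure_map (μ := P) hg.aemeasurable
  simp_rw [← cdf_map_eq hg]
  set R := cdf (P.map g) with hR
  have hcont : Continuous R := continuous_cdf_of_null hg h0
  have hmon : Monotone R := monotone_cdf _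
  have main : ∀ v : ℝ, 0 < v → v < 1 → P.real {x | R (g x) ≤ v} = v := by
    intro v hv0 hv1
    obtain ⟨a, ha⟩ := ((tendsto_cdf_atBot (P.map g)).eventually (gt_mem_nhds hv0)).exists
    obtain ⟨b, hb⟩ := ((tendsto_cdf_atTop (P.map g)).eventually (lt_mem_nhds hv1)).exists
    have hcl : IsClosed {l | R l ≤ v} := isClosed_le hcont continuous_const
    have hbdd : BddAbove {l | R l ≤ v} := ⟨b, fun l hl => by
      by_contra! hc
      exact (lt_of_lt_of_le hb (hmon hc.le)).not_ge hl⟩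
    have hmem := hcl.csSup_mem ⟨a, ha.le⟩ hbdd
    -- The largest point where the distribution function is at most `v`; continuity makes its value
    -- there equal to `v`.
    set s := sSup {l | R l ≤ v} with hs
    have hset : {x | R (g x) ≤ v} = {x | g x ≤ s} := by
      ext x
      exact ⟨fun h => le_csSup hbdd h, fun h => (hmon h).trans hmem⟩
    rw [hset, ← cdf_map_eq hg]
    refine le_antisymm hmem ?_
    by_contra! hc
    have hev := hcont.continuousAt.eventually (gt_mem_nhds hc)
    obtain ⟨ε, hε, hball⟩ := Metric.eventually_nhds_iff.1 hev
    have h1 : R (s + ε / 2) < v := hball (by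
      rw [Real.dist_eq, add_sub_cancel_left, abs_of_pos (half_pos hε)]; linarith)
    have := le_csSup hbdd (show s + ε / 2 ∈ {l | R l ≤ v} from h1.le)
    linarith
  rcases hv1.lt_or_eq with h1 | rfl
  · rcases hv0.lt_or_eq with h2 | rfl
    · exact main v h2 h1
    · refine le_antisymm (le_of_forall_gt_imp_ge_of_dense fun ε hε => ?_) measureReal_nonneg
      rcases lt_or_ge ε 1 with h | h
      · rw [← main ε hε h]
        exact measureReal_mono fun x hx => le_trans hx hε.le
      · exact measureReal_le_one.trans h
  · have : {x | R (g x) ≤ 1} = univ := eq_univ_of_forall fun x => cdf_le_one _ _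
    rw [this, probReal_univ]

end rank

end

/-! ### Ranks of gains -/

section

open Filter Topology

variable {I₁ I₂ : Set ℝ} {H : Measure (ℝ × ℝ)} {F : ℝ → ℝ → ℝ}

/-- The distribution function of skills. -/
def skillCdf (H : Measure (ℝ × ℝ)) (b : ℝ) : ℝ := H.real {x | x.1 ≤ b}

/-- The left limit of the distribution function of skills. -/
def skillCdfLeft (H : Measure (ℝ × ℝ)) (b : ℝ) : ℝ := H.real {x | x.1 < b}

/-- A population with full support that satisfies the assumptions on ranks, with two reference
skills `k₁ < k₂`. -/
structure IsRanked (I₁ I₂ : Set ℝ) (H : Measure (ℝ × ℝ)) [IsProbabilityMeasure H]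
    (F : ℝ → ℝ → ℝ) (k₁ k₂ : ℝ) : Prop where
  pop : IsPopulation I₁ I₂ H
  prod : IsProduction I₁ F
  full : FullSupport I₁ I₂ H
  ord : I₂.OrdConnected
  mem_left : k₁ ∈ I₁
  mem_right : k₂ ∈ I₁
  lt : k₁ < k₂
  rankings : CommonRankings I₁ I₂ H F
  index : ExchangeableIndex I₁ H F

lemma FullSupport.pos_of_eventually (hfull : FullSupport I₁ I₂ H) {S : Set (ℝ × ℝ)} {x : ℝ × ℝ}
    (hx : x ∈ I₁ ×ˢ I₂) (h : ∀ᶠ y in 𝓝[I₁ ×ˢ I₂] x, y ∈ S) : 0 < H S := by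
  obtain ⟨U, hU, hxU, hUS⟩ := mem_nhdsWithin.1 h
  exact (hfull U hU ⟨x, hxU, hx⟩).trans_le (measure_mono hUS)

lemma FullSupport.exists_of_eventually (hfull : FullSupport I₁ I₂ H) {P Q : ℝ × ℝ → Prop}
    {x : ℝ × ℝ} (hx : x ∈ I₁ ×ˢ I₂) (h : ∀ᶠ y in 𝓝[I₁ ×ˢ I₂] x, P y) (hQ : ∀ᵐ y ∂H, Q y) :
    ∃ y, P y ∧ Q y := by
  by_contra! hc
  have h0 : 0 < H {y | P y} := hfull.pos_of_eventually hx h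
  exact h0.ne' (measure_mono_null (fun y hy => hc y hy) hQ)

lemma gain_eq (F : ℝ → ℝ → ℝ) (a b : ℝ) (x : ℝ × ℝ) :
    gain F a b x = (F x.1 a - F x.1 b) * wt x := by
  unfold gain wt; ring

lemma continuousOn_wt (h2 : ∀ x₂ ∈ I₂, -(1 / 2 : ℝ) < x₂) : ContinuousOn wt (I₁ ×ˢ I₂) := by
  unfold wt
  refine ContinuousOn.div (by fun_prop) (by fun_prop) fun x hx => ?_
  exact (one_add_two_mul_pos h2 hx).ne'

namespace IsProduction

variable (hF : IsProduction I₁ F)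
include hF

lemma continuousOn_left {b : ℝ} (hb : b ∈ I₁) : ContinuousOn (fun a => F a b) I₁ :=
  hF.smooth.continuousOn.comp (f := fun a => (a, b)) (by fun_prop) fun _ ha => ⟨ha, hb⟩

lemma continuousOn_right {b : ℝ} (hb : b ∈ I₁) : ContinuousOn (fun a => F b a) I₁ :=
  hF.smooth.continuousOn.comp (f := fun a => (b, a)) (by fun_prop) fun _ ha => ⟨hb, ha⟩

lemma lt_right {a b c : ℝ} (ha : a ∈ I₁) (hb : b ∈ I₁) (hc : c ∈ I₁) (h : b < c) :
    F a b < F a c := by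
  rw [hF.symm a ha b hb, hF.symm a ha c hc]
  exact hF.increasing a ha hb hc h

lemma le_left {a b c : ℝ} (ha : a ∈ I₁) (hb : b ∈ I₁) (hc : c ∈ I₁) (h : b ≤ c) :
    F b a ≤ F c a :=
  (hF.increasing a ha).monotoneOn hb hc h

lemma continuousOn_gain (h2 : ∀ x₂ ∈ I₂, -(1 / 2 : ℝ) < x₂) {a b : ℝ} (ha : a ∈ I₁)
    (hb : b ∈ I₁) : ContinuousOn (gain F a b) (I₁ ×ˢ I₂) := by
  have h1 : ContinuousOn (fun x : ℝ × ℝ => F x.1 a) (I₁ ×ˢ I₂) :=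
    (hF.continuousOn_left ha).comp continuousOn_fst fun x hx => hx.1
  have h3 : ContinuousOn (fun x : ℝ × ℝ => F x.1 b) (I₁ ×ˢ I₂) :=
    (hF.continuousOn_left hb).comp continuousOn_fst fun x hx => hx.1
  exact ((h1.sub h3).mul (continuousOn_wt h2)).congr fun x _ => gain_eq F a b x

end IsProduction

namespace IsRanked

variable [IsProbabilityMeasure H] {k₁ k₂ : ℝ} (h : IsRanked I₁ I₂ H F k₁ k₂)
include h

lemma wt_pos {x : ℝ × ℝ} (hx : x ∈ I₁ ×ˢ I₂) : 0 < wt x := wt_pos_of (h.pop.pref_gt _ hx.2)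

/-- Ranks increase in the gain from any increase in the skill of the partner. -/
lemma rank_le_of_gain_le {a b : ℝ} (ha : a ∈ I₁) (hb : b ∈ I₁) (hab : b < a) {x z : ℝ × ℝ}
    (hx : x ∈ I₁ ×ˢ I₂) (hz : z ∈ I₁ ×ˢ I₂) (hxz : gain F a b x ≤ gain F a b z) :
    gainRank H F k₂ k₁ x ≤ gainRank H F k₂ k₁ z := by
  rw [h.rankings _ h.mem_right _ h.mem_left _ ha _ hb h.lt hab x hx,
    h.rankings _ h.mem_right _ h.mem_left _ ha _ hb h.lt hab z hz]
  exact measureReal_mono fun y hy => le_trans hy hxz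

lemma gain_lt_of_rank_lt {a b : ℝ} (ha : a ∈ I₁) (hb : b ∈ I₁) (hab : b < a) {x z : ℝ × ℝ}
    (hx : x ∈ I₁ ×ˢ I₂) (hz : z ∈ I₁ ×ˢ I₂)
    (hxz : gainRank H F k₂ k₁ x < gainRank H F k₂ k₁ z) : gain F a b x < gain F a b z := by
  by_contra! hc
  exact hxz.not_ge (h.rank_le_of_gain_le ha hb hab hz hx hc)

/-- Nothing is assumed about `F` off `I₁`, so the gain is cut off there to obtain a measurable
function on the plane. -/
lemma measurable_indicator_gain : Measurable ((I₁ ×ˢ I₂).indicator (gain F k₂ k₁)) := by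
  refine measurable_of_restrict_of_restrict_compl h.pop.measurableSet ?_ ?_
  · have : (I₁ ×ˢ I₂).domRestrict ((I₁ ×ˢ I₂).indicator (gain F k₂ k₁)) =
        (I₁ ×ˢ I₂).domRestrict (gain F k₂ k₁) := funext fun x => indicator_of_mem x.2 _
    rw [this]
    exact (continuousOn_iff_continuous_domRestrict.1
      (h.prod.continuousOn_gain h.pop.pref_gt h.mem_right h.mem_left)).measurable
  · have : (I₁ ×ˢ I₂)ᶜ.domRestrict ((I₁ ×ˢ I₂).indicator (gain F k₂ k₁)) = fun _ => 0 := by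
      ext x
      exact indicator_of_notMem x.2 _
    rw [this]
    exact measurable_const

/-- At a fixed skill the gain is injective in the preference, so a level set has at most one point
in each slice. Hence the law of gains is atomless. -/
lemma null_level (l : ℝ) : H {x | (I₁ ×ˢ I₂).indicator (gain F k₂ k₁) x = l} = 0 := by
  set g := (I₁ ×ˢ I₂).indicator (gain F k₂ k₁) with hg
  have hm : MeasurableSet ({x | g x = l} ∩ I₁ ×ˢ I₂) :=
    (h.measurable_indicator_gain (measurableSet_singleton l)).inter h.pop.measurableSet
  have h0 : H ({x | g x = l} ∩ I₁ ×ˢ I₂) = 0 := by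
    refine h.pop.null_of_slices hm fun a s hs t ht => ?_
    have h1 : g (a, s) = g (a, t) := hs.1.trans ht.1.symm
    rw [hg, indicator_of_mem hs.2, indicator_of_mem ht.2, gain_eq, gain_eq] at h1
    have hpos : 0 < F a k₂ - F a k₁ :=
      sub_pos.2 (h.prod.lt_right hs.2.1 h.mem_left h.mem_right h.lt)
    exact wt_inj h.pop.pref_gt hs.2 ht.2 (mul_left_cancel₀ hpos.ne' h1)
  refine measure_mono_null (t := ({x | g x = l} ∩ I₁ ×ˢ I₂) ∪ (I₁ ×ˢ I₂)ᶜ) ?_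
    (measure_union_null h0 h.pop.concentrated)
  intro x hx
  by_cases hxI : x ∈ I₁ ×ˢ I₂
  · exact Or.inl ⟨hx, hxI⟩
  · exact Or.inr hxI

lemma rank_eq (x : ℝ × ℝ) : gainRank H F k₂ k₁ x =
    cdf (H.map ((I₁ ×ˢ I₂).indicator (gain F k₂ k₁))) (gain F k₂ k₁ x) := by
  rw [cdf_map_eq h.measurable_indicator_gain]
  refine measureReal_congr ?_
  filter_upwards [h.pop.ae_mem] with y hy
  refine propext ?_
  show gain F k₂ k₁ y ≤ _ ↔ (I₁ ×ˢ I₂).indicator (gain F k₂ k₁) y ≤ _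
  rw [indicator_of_mem hy]

lemma continuousOn_rank : ContinuousOn (gainRank H F k₂ k₁) (I₁ ×ˢ I₂) :=
  ((continuous_cdf_of_null h.measurable_indicator_gain h.null_level).comp_continuousOn
    (h.prod.continuousOn_gain h.pop.pref_gt h.mem_right h.mem_left)).congr fun x _ => h.rank_eq x

lemma exists_measurable_rank : ∃ V : ℝ × ℝ → ℝ, Measurable V ∧
    (∀ x ∈ I₁ ×ˢ I₂, V x = gainRank H F k₂ k₁ x) := by
  refine ⟨fun x => cdf (H.map ((I₁ ×ˢ I₂).indicator (gain F k₂ k₁)))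
    ((I₁ ×ˢ I₂).indicator (gain F k₂ k₁) x),
    (monotone_cdf _).measurable.comp h.measurable_indicator_gain, fun x hx => ?_⟩
  simp only [h.rank_eq x, indicator_of_mem hx]

/-- Ranks are uniformly distributed. -/
lemma real_rank_le_eq {v : ℝ} (hv0 : 0 ≤ v) (hv1 : v ≤ 1) :
    H.real {x | gainRank H F k₂ k₁ x ≤ v} = v := by
  refine Eq.trans ?_ (real_rank_le h.measurable_indicator_gain h.null_level hv0 hv1)
  refine measureReal_congr ?_
  filter_upwards [h.pop.ae_mem] with x hx
  refine propext ?_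
  show gainRank H F k₂ k₁ x ≤ v ↔
    H.real {y | (I₁ ×ˢ I₂).indicator (gain F k₂ k₁) y ≤
      (I₁ ×ˢ I₂).indicator (gain F k₂ k₁) x} ≤ v
  rw [h.rank_eq x, cdf_map_eq h.measurable_indicator_gain, indicator_of_mem hx]

lemma nullMeasurableSet_rank_le (v : ℝ) :
    NullMeasurableSet {x | gainRank H F k₂ k₁ x ≤ v} H := by
  obtain ⟨V, hV, hVe⟩ := h.exists_measurable_rank
  refine (measurableSet_le hV (measurable_const (a := v))).nullMeasurableSet.congr ?_
  filter_upwards [h.pop.ae_mem] with x hx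
  refine propext ?_
  show V x ≤ v ↔ gainRank H F k₂ k₁ x ≤ v
  rw [hVe x hx]

omit h [IsProbabilityMeasure H] in
lemma rank_nonneg (x : ℝ × ℝ) : 0 ≤ gainRank H F k₂ k₁ x := measureReal_nonneg

omit h in
lemma rank_le_one (x : ℝ × ℝ) : gainRank H F k₂ k₁ x ≤ 1 := measureReal_le_one

lemma real_lt_rank_eq {v : ℝ} (hv0 : 0 ≤ v) (hv1 : v ≤ 1) :
    H.real {x | v < gainRank H F k₂ k₁ x} = 1 - v := by
  have e : {x | v < gainRank H F k₂ k₁ x} = {x | gainRank H F k₂ k₁ x ≤ v}ᶜ := by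
    ext x; simp
  rw [e, probReal_compl_eq_one_sub₀ (h.nullMeasurableSet_rank_le v), h.real_rank_le_eq hv0 hv1]

/-- Any single rank is attained with probability zero. -/
lemma ae_rank_ne (v : ℝ) : ∀ᵐ x ∂H, gainRank H F k₂ k₁ x ≠ v := by
  rcases lt_or_ge v 0 with hv | hv0
  · exact Eventually.of_forall fun x => (hv.trans_le (rank_nonneg x)).ne'
  rcases lt_or_ge 1 v with hv | hv1
  · exact Eventually.of_forall fun x => ((rank_le_one x).trans_lt hv).ne
  suffices hs : H.real {x | gainRank H F k₂ k₁ x = v} = 0 by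
    rw [measureReal_eq_zero_iff] at hs
    exact measure_eq_zero_iff_ae_notMem.1 hs
  rcases hv0.lt_or_eq with hv0 | rfl
  · refine le_antisymm (le_of_forall_gt_imp_ge_of_dense fun ε hε => ?_) measureReal_nonneg
    set w := max 0 (v - ε) with hw
    have hwv : w < v := max_lt hv0 (by linarith)
    have hsub : {x | gainRank H F k₂ k₁ x = v} ⊆
        {x | gainRank H F k₂ k₁ x ≤ v} \ {x | gainRank H F k₂ k₁ x ≤ w} := by
      rintro x (hx : _ = v)
      exact ⟨hx.le, fun hc : _ ≤ w => by linarith⟩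
    have hle : {x | gainRank H F k₂ k₁ x ≤ w} ⊆ {x | gainRank H F k₂ k₁ x ≤ v} :=
      fun x (hx : _ ≤ w) => hx.trans hwv.le
    have h1 := measureReal_mono (μ := H) hsub
    rw [measureReal_def H (_ \ _), measure_sdiff hle (h.nullMeasurableSet_rank_le w)
      (measure_ne_top _ _), ENNReal.toReal_sub_of_le (measure_mono hle) (measure_ne_top _ _),
      ← measureReal_def, ← measureReal_def, h.real_rank_le_eq hv0.le hv1,
      h.real_rank_le_eq (le_max_left _ _) (hwv.le.trans hv1)] at h1
    linarith [le_max_right 0 (v - ε)]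
  · have := h.real_rank_le_eq le_rfl zero_le_one
    refine le_antisymm ?_ measureReal_nonneg
    refine le_trans ?_ this.le
    exact measureReal_mono fun x (hx : _ = _) => hx.le

/-- Non-degenerate intervals of ranks contain good types. -/
lemma exists_rank_mem {v w : ℝ} (hv : 0 ≤ v) (hvw : v < w) (hw : w ≤ 1) {Q : ℝ × ℝ → Prop}
    (hQ : ∀ᵐ x ∂H, Q x) :
    ∃ x, Q x ∧ v < gainRank H F k₂ k₁ x ∧ gainRank H F k₂ k₁ x < w := by
  by_contra! hc
  have h1 : ∀ᵐ x ∂H, v < gainRank H F k₂ k₁ x → w < gainRank H F k₂ k₁ x := by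
    filter_upwards [hQ, h.ae_rank_ne w] with x hx hne hvx
    exact lt_of_le_of_ne (hc x hx hvx) (Ne.symm hne)
  have h2 : H.real {x | v < gainRank H F k₂ k₁ x} ≤ H.real {x | w < gainRank H F k₂ k₁ x} := by
    refine ENNReal.toReal_mono (measure_ne_top _ _) (measure_mono_ae ?_)
    exact h1
  rw [h.real_lt_rank_eq hv (hvw.le.trans hw), h.real_lt_rank_eq (hv.trans hvw.le) hw] at h2
  linarith

/-- By continuity and full support, types with gains close to that of `w` have positive mass, and
they are counted in the rank of `z` but not in that of `x`. -/
lemma rank_lt_of_between {x z w : ℝ × ℝ} (hw : w ∈ I₁ ×ˢ I₂)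
    (h1 : gain F k₂ k₁ x < gain F k₂ k₁ w) (h2 : gain F k₂ k₁ w < gain F k₂ k₁ z) :
    gainRank H F k₂ k₁ x < gainRank H F k₂ k₁ z := by
  have hcont := h.prod.continuousOn_gain h.pop.pref_gt h.mem_right h.mem_left w hw
  have hpos : 0 < H {y | gain F k₂ k₁ x < gain F k₂ k₁ y ∧ gain F k₂ k₁ y < gain F k₂ k₁ z ∧
      y ∈ I₁ ×ˢ I₂} := by
    refine h.full.pos_of_eventually hw ?_
    filter_upwards [hcont.eventually (lt_mem_nhds h1), hcont.eventually (gt_mem_nhds h2),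
      self_mem_nhdsWithin] with y hy1 hy2 hy3
    exact ⟨hy1, hy2, hy3⟩
  have hm := measurableSet_lt (measurable_const (a := gain F k₂ k₁ x)) h.measurable_indicator_gain
  have hm2 := measurableSet_lt h.measurable_indicator_gain (measurable_const (a := gain F k₂ k₁ z))
  have hmeas : MeasurableSet {y | gain F k₂ k₁ x < gain F k₂ k₁ y ∧
      gain F k₂ k₁ y < gain F k₂ k₁ z ∧ y ∈ I₁ ×ˢ I₂} := by
    convert (hm.inter hm2).inter h.pop.measurableSet using 1
    ext y
    by_cases hy : y ∈ I₁ ×ˢ I₂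
    · simp only [mem_ofPred_eq, mem_inter_iff, indicator_of_mem hy, hy, and_true]
    · simp only [mem_ofPred_eq, mem_inter_iff, hy, and_false]
  unfold gainRank
  calc H.real {y | gain F k₂ k₁ y ≤ gain F k₂ k₁ x}
      < H.real {y | gain F k₂ k₁ y ≤ gain F k₂ k₁ x} +
        H.real {y | gain F k₂ k₁ x < gain F k₂ k₁ y ∧ gain F k₂ k₁ y < gain F k₂ k₁ z ∧
          y ∈ I₁ ×ˢ I₂} := by
        have := ENNReal.toReal_pos hpos.ne' (measure_ne_top _ _)
        exact lt_add_of_pos_right _ this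
    _ = H.real ({y | gain F k₂ k₁ y ≤ gain F k₂ k₁ x} ∪
        {y | gain F k₂ k₁ x < gain F k₂ k₁ y ∧ gain F k₂ k₁ y < gain F k₂ k₁ z ∧
          y ∈ I₁ ×ˢ I₂}) := by
        rw [measureReal_union _ hmeas]
        exact disjoint_left.2 fun y hy hy' => (not_lt.2 hy) hy'.1
    _ ≤ _ := by
        refine measureReal_mono ?_
        rintro y (hy | hy)
        · exact le_trans hy (h1.trans h2).le
        · exact hy.2.1.le

lemma wt_lt_iff {x z : ℝ × ℝ} (hx : x ∈ I₁ ×ˢ I₂) (hz : z ∈ I₁ ×ˢ I₂) :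
    wt x < wt z ↔ z.2 < x.2 := by
  unfold wt
  rw [one_div_lt_one_div (one_add_two_mul_pos h.pop.pref_gt hx)
    (one_add_two_mul_pos h.pop.pref_gt hz)]
  constructor <;> intro h <;> linarith

lemma gain_lt_of_pref_lt {a b : ℝ} (ha : a ∈ I₁) (hb : b ∈ I₁) (hab : b < a) {c s t : ℝ}
    (hc : c ∈ I₁) (hs : s ∈ I₂) (ht : t ∈ I₂) (hst : s < t) :
    gain F a b (c, t) < gain F a b (c, s) := by
  rw [gain_eq, gain_eq]
  exact mul_lt_mul_of_pos_left ((h.wt_lt_iff ⟨hc, ht⟩ ⟨hc, hs⟩).2 hst)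
    (sub_pos.2 (h.prod.lt_right hc hb ha hab))

/-- Ranks strictly decrease in the strength of relative concerns. -/
lemma rank_lt_of_pref_lt {c s t : ℝ} (hc : c ∈ I₁) (hs : s ∈ I₂) (ht : t ∈ I₂) (hst : s < t) :
    gainRank H F k₂ k₁ (c, t) < gainRank H F k₂ k₁ (c, s) := by
  have hm : (s + t) / 2 ∈ I₂ := h.ord.out hs ht ⟨by linarith, by linarith⟩
  exact h.rank_lt_of_between (w := (c, (s + t) / 2)) ⟨hc, hm⟩
    (h.gain_lt_of_pref_lt h.mem_right h.mem_left h.lt hc hm ht (by linarith))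
    (h.gain_lt_of_pref_lt h.mem_right h.mem_left h.lt hc hs hm (by linarith))

/-- If the gain of `z` were smaller, a slightly weaker relative concern would keep it below that of
`x` while strictly raising the rank of `z`, against monotonicity of ranks. The room to move down is
why `z.2` must not be the infimum of `I₂`. -/
lemma gain_le_of_rank_le {a b : ℝ} (ha : a ∈ I₁) (hb : b ∈ I₁) (hab : b < a) {x z : ℝ × ℝ}
    (hx : x ∈ I₁ ×ˢ I₂) (hz : z ∈ I₁ ×ˢ I₂) (hz2 : z.2 ≠ sInf I₂)
    (hxz : gainRank H F k₂ k₁ x ≤ gainRank H F k₂ k₁ z) : gain F a b x ≤ gain F a b z := by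
  by_contra! hc
  have hbdd : BddBelow I₂ := ⟨-(1 / 2), fun t ht => (h.pop.pref_gt t ht).le⟩
  have hlt : sInf I₂ < z.2 := lt_of_le_of_ne (csInf_le hbdd hz.2) hz2.symm
  obtain ⟨s, hs, hsz⟩ := exists_lt_of_csInf_lt ⟨_, hz.2⟩ hlt
  have hcont : Tendsto (fun t : ℝ => (F z.1 a - F z.1 b) * wt (z.1, t)) (𝓝 z.2)
      (𝓝 ((F z.1 a - F z.1 b) * wt (z.1, z.2))) := by
    refine Tendsto.const_mul _ ?_
    have hz0 := one_add_two_mul_pos h.pop.pref_gt hz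
    unfold wt
    exact (continuousAt_const.div (by fun_prop) hz0.ne')
  have hev := hcont.eventually (gt_mem_nhds (show (F z.1 a - F z.1 b) * wt (z.1, z.2) < _ by
    rw [← gain_eq F a b (z.1, z.2)]; exact hc))
  obtain ⟨ε, hε, hball⟩ := Metric.eventually_nhds_iff.1 hev
  set t := max s (z.2 - ε / 2) with ht
  have htz : t < z.2 := max_lt hsz (by linarith)
  have htI : t ∈ I₂ := h.ord.out hs hz.2 ⟨le_max_left _ _, htz.le⟩
  have h1 : gain F a b (z.1, t) < gain F a b x := by
    rw [gain_eq]
    refine hball ?_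
    rw [Real.dist_eq, abs_sub_comm, abs_of_pos (by linarith)]
    linarith [le_max_right s (z.2 - ε / 2)]
  have h2 := h.rank_le_of_gain_le (x := (z.1, t)) ha hb hab ⟨hz.1, htI⟩ hx h1.le
  have h3 := h.rank_lt_of_pref_lt hz.1 htI hz.2 htz
  linarith

end IsRanked

end

/-! ### The distribution of skills and exchangeability -/

section

open Filter Topology

variable {I₁ I₂ : Set ℝ} {H : Measure (ℝ × ℝ)} {F : ℝ → ℝ → ℝ}

section skills

variable [IsProbabilityMeasure H]

lemma skillCdf_mono : Monotone (skillCdf H) := fun _ _ hab =>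
  measureReal_mono fun _ (hx : _ ≤ _) => le_trans hx hab

lemma skillCdfLeft_mono : Monotone (skillCdfLeft H) := fun _ _ hab =>
  measureReal_mono fun _ (hx : _ < _) => lt_of_lt_of_le hx hab

lemma skillCdfLeft_le_skillCdf (b : ℝ) : skillCdfLeft H b ≤ skillCdf H b :=
  measureReal_mono fun x (hx : x.1 < b) => (show x.1 ≤ b from hx.le)

lemma skillCdf_le_skillCdfLeft {a b : ℝ} (hab : a < b) : skillCdf H a ≤ skillCdfLeft H b :=
  measureReal_mono fun _ (hx : _ ≤ _) => lt_of_le_of_lt hx hab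

lemma skillCdf_eq_cdf (b : ℝ) : skillCdf H b = cdf H.fst b := by
  have : IsProbabilityMeasure (H.map Prod.fst) :=
    Measure.isProbabilityMeasure_map measurable_fst.aemeasurable
  exact (cdf_map_eq measurable_fst b).symm

omit [IsProbabilityMeasure H] in
lemma skillCdf_nonneg (b : ℝ) : 0 ≤ skillCdf H b := measureReal_nonneg

lemma skillCdf_le_one (b : ℝ) : skillCdf H b ≤ 1 := measureReal_le_one

omit [IsProbabilityMeasure H] in
lemma skillCdfLeft_nonneg (b : ℝ) : 0 ≤ skillCdfLeft H b := measureReal_nonneg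

lemma skillCdfLeft_le_one (b : ℝ) : skillCdfLeft H b ≤ 1 := measureReal_le_one

lemma continuousWithinAt_skillCdf (b : ℝ) : ContinuousWithinAt (skillCdf H) (Ici b) b := by
  have : skillCdf H = cdf H.fst := funext skillCdf_eq_cdf
  rw [this]
  exact (cdf H.fst).right_continuous b

lemma skillCdfLeft_eq_leftLim (b : ℝ) :
    skillCdfLeft H b = Function.leftLim (skillCdf H) b := by
  have e : skillCdf H = cdf H.fst := funext skillCdf_eq_cdf
  have h1 := (cdf H.fst).measure_Iio (tendsto_cdf_atBot H.fst) b
  rw [measure_cdf, Measure.fst_apply measurableSet_Iio, sub_zero] at h1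
  have h2 : 0 ≤ Function.leftLim (cdf H.fst) b :=
    (cdf_nonneg H.fst (b - 1)).trans ((monotone_cdf H.fst).le_leftLim (by linarith))
  rw [e, skillCdfLeft, measureReal_def]
  show (H (Prod.fst ⁻¹' Iio b)).toReal = _
  rw [h1, ENNReal.toReal_ofReal h2]

lemma tendsto_skillCdfLeft (b : ℝ) :
    Tendsto (skillCdf H) (𝓝[<] b) (𝓝 (skillCdfLeft H b)) := by
  rw [skillCdfLeft_eq_leftLim]
  exact skillCdf_mono.tendsto_leftLim b

lemma skillCdfLeft_le_of_forall_lt {b v : ℝ} (hv : ∀ t < b, skillCdf H t ≤ v) :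
    skillCdfLeft H b ≤ v :=
  le_of_tendsto (tendsto_skillCdfLeft b) (by
    filter_upwards [self_mem_nhdsWithin] with t ht using hv t ht)

lemma le_skillCdf_of_forall_gt {b v : ℝ} (hv : ∀ t > b, v ≤ skillCdf H t) :
    v ≤ skillCdf H b := by
  refine ge_of_tendsto ((continuousWithinAt_skillCdf (H := H) b).mono_left
    (nhdsWithin_mono _ Ioi_subset_Ici_self)) ?_
  filter_upwards [self_mem_nhdsWithin] with t ht using hv t ht

/-- The quantile function of the distribution of skills, on the open unit interval. -/
def skillQuantile (H : Measure (ℝ × ℝ)) (v : ℝ) : ℝ :=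
  open Classical in if v ∈ Ioo (0 : ℝ) 1 then sInf {b | v ≤ skillCdf H b} else 0

lemma skillQuantile_le_iff {v b : ℝ} (hv : v ∈ Ioo (0 : ℝ) 1) :
    skillQuantile H v ≤ b ↔ v ≤ skillCdf H b := by
  rw [skillQuantile, if_pos hv]
  have e : skillCdf H = cdf H.fst := funext skillCdf_eq_cdf
  have hne : {b | v ≤ skillCdf H b}.Nonempty := by
    obtain ⟨b, hb⟩ := ((tendsto_cdf_atTop H.fst).eventually (lt_mem_nhds hv.2)).exists
    exact ⟨b, by rw [← e] at hb; exact hb.le⟩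
  have hbdd : BddBelow {b | v ≤ skillCdf H b} := by
    obtain ⟨a, ha⟩ := ((tendsto_cdf_atBot H.fst).eventually (gt_mem_nhds hv.1)).exists
    rw [← e] at ha
    refine ⟨a, fun b hb => ?_⟩
    by_contra! hc
    exact (ha.trans_le hb).not_ge (skillCdf_mono hc.le)
  constructor
  · intro h
    refine le_skillCdf_of_forall_gt fun t ht => ?_
    obtain ⟨b', hb', hbt⟩ := exists_lt_of_csInf_lt hne (h.trans_lt ht)
    exact le_trans hb' (skillCdf_mono hbt.le)
  · exact fun h => csInf_le hbdd h

lemma le_skillCdf_skillQuantile {v : ℝ} (hv : v ∈ Ioo (0 : ℝ) 1) :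
    v ≤ skillCdf H (skillQuantile H v) :=
  (skillQuantile_le_iff hv).1 le_rfl

lemma skillCdfLeft_skillQuantile_le {v : ℝ} (hv : v ∈ Ioo (0 : ℝ) 1) :
    skillCdfLeft H (skillQuantile H v) ≤ v := by
  refine skillCdfLeft_le_of_forall_lt fun t ht => ?_
  by_contra! hc
  exact ht.not_ge ((skillQuantile_le_iff hv).2 hc.le)

lemma measurable_skillQuantile : Measurable (skillQuantile H) := by
  refine measurable_of_Iic fun b => ?_
  have : skillQuantile H ⁻¹' Iic b = (Ioo 0 1 ∩ Iic (skillCdf H b)) ∪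
      ((Ioo 0 1)ᶜ ∩ {_v | (0 : ℝ) ≤ b}) := by
    ext v
    by_cases hv : v ∈ Ioo (0 : ℝ) 1
    · simp only [mem_preimage, mem_Iic, skillQuantile_le_iff hv, mem_union, mem_inter_iff, hv,
        true_and, mem_compl_iff, not_true, false_and, or_false]
    · simp only [mem_preimage, mem_Iic, mem_union, mem_inter_iff, hv,
        mem_compl_iff, not_false_iff, true_and, false_and, false_or, mem_ofPred_eq]
      rw [skillQuantile, if_neg hv]
  rw [this]
  exact (measurableSet_Ioo.inter measurableSet_Iic).union
    (measurableSet_Ioo.compl.inter (MeasurableSet.const _))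

end skills

/-- Finite measures on the plane that agree on quadrants are equal. -/
lemma ext_of_quadrants {P Q : Measure (ℝ × ℝ)} [IsProbabilityMeasure P] [IsProbabilityMeasure Q]
    (h : ∀ a b : ℝ, P (Iic a ×ˢ Iic b) = Q (Iic a ×ˢ Iic b)) : P = Q := by
  have hspan : IsCountablySpanning (range (Iic : ℝ → Set ℝ)) := by
    refine ⟨fun n : ℕ => Iic (n : ℝ), fun n => ⟨n, rfl⟩, ?_⟩
    refine eq_univ_of_forall fun x => ?_
    obtain ⟨n, hn⟩ := exists_nat_ge x
    exact mem_iUnion.2 ⟨n, hn⟩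
  have hgen : MeasurableSpace.generateFrom (range (Iic : ℝ → Set ℝ)) =
      (inferInstance : MeasurableSpace ℝ) := by
    rw [← borel_eq_generateFrom_Iic, BorelSpace.measurable_eq (α := ℝ)]
  refine ext_of_generate_finite _ (generateFrom_eq_prod hgen hgen hspan hspan).symm
    (isPiSystem_Iic.prod isPiSystem_Iic) ?_ (by simp)
  rintro _ ⟨_, ⟨a, rfl⟩, _, ⟨b, rfl⟩, rfl⟩
  exact h a b

namespace IsRanked

variable [IsProbabilityMeasure H] {k₁ k₂ : ℝ} (h : IsRanked I₁ I₂ H F k₁ k₂)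
include h

lemma ae_rank_mem_Ioo : ∀ᵐ x ∂H, gainRank H F k₂ k₁ x ∈ Ioo (0 : ℝ) 1 := by
  filter_upwards [h.ae_rank_ne 0, h.ae_rank_ne 1] with x h0 h1
  exact ⟨lt_of_le_of_ne (rank_nonneg x) h0.symm, lt_of_le_of_ne (rank_le_one x) h1⟩

/-- The joint distribution of a worker's skill and the skill quantile at the worker's rank is
exchangeable. -/
lemma map_swap_eq {V : ℝ × ℝ → ℝ} (hV : Measurable V)
    (hVe : ∀ x ∈ I₁ ×ˢ I₂, V x = gainRank H F k₂ k₁ x) :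
    H.map (fun x => (x.1, skillQuantile H (V x))) =
      H.map (fun x => (skillQuantile H (V x), x.1)) := by
  have hq : Measurable fun x => skillQuantile H (V x) := measurable_skillQuantile.comp hV
  have hm1 : Measurable fun x : ℝ × ℝ => (x.1, skillQuantile H (V x)) := measurable_fst.prodMk hq
  have hm2 : Measurable fun x : ℝ × ℝ => (skillQuantile H (V x), x.1) := hq.prodMk measurable_fst
  have := Measure.isProbabilityMeasure_map (μ := H) hm1.aemeasurable
  have := Measure.isProbabilityMeasure_map (μ := H) hm2.aemeasurable
  obtain ⟨C, hC, hCop⟩ := h.index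
  obtain ⟨-, hCop⟩ := hCop _ h.mem_right _ h.mem_left h.lt
  -- The event for the quantile says that the rank is at most `skillCdf H b`, which is also its
  -- probability because ranks are uniform. So `C` is evaluated at two values of the same
  -- distribution function, and exchangeability applies.
  have key : ∀ a b : ℝ, H.real {x | x.1 ≤ a ∧ skillQuantile H (V x) ≤ b} =
      C (skillCdf H a) (skillCdf H b) := by
    intro a b
    have h1 := hCop a (skillCdf H b)
    rw [h.real_rank_le_eq (skillCdf_nonneg b) (skillCdf_le_one b)] at h1
    refine Eq.trans ?_ h1.symm
    refine measureReal_congr ?_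
    filter_upwards [h.pop.ae_mem, h.ae_rank_mem_Ioo] with x hx hx01
    refine propext ?_
    show (x.1 ≤ a ∧ skillQuantile H (V x) ≤ b) ↔ (x.1 ≤ a ∧ gainRank H F k₂ k₁ x ≤ skillCdf H b)
    rw [hVe x hx, skillQuantile_le_iff hx01]
  refine ext_of_quadrants fun a b => ?_
  rw [Measure.map_apply hm1 (measurableSet_Iic.prod measurableSet_Iic),
    Measure.map_apply hm2 (measurableSet_Iic.prod measurableSet_Iic)]
  rw [← measureReal_eq_measureReal_iff]
  have e1 := key a b
  have e2 := key b a
  rw [hC _ ⟨skillCdf_nonneg _, skillCdf_le_one _⟩ _ ⟨skillCdf_nonneg _, skillCdf_le_one _⟩] at e2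
  refine (e1.trans e2.symm).trans ?_
  congr 1
  ext x
  exact and_comm

end IsRanked

end

/-! ### Partners have the rank of the worker's gain -/

section

open Filter Topology

variable {I₁ I₂ : Set ℝ} {H : Measure (ℝ × ℝ)} {F : ℝ → ℝ → ℝ}

lemma measurable_indicator_of_domRestrict {α : Type*} [MeasurableSpace α] {s : Set α}
    (hs : MeasurableSet s) {f : α → ℝ} (hf : Measurable (s.domRestrict f)) :
    Measurable (s.indicator f) := by
  refine measurable_of_restrict_of_restrict_compl hs ?_ ?_
  · have : s.domRestrict (s.indicator f) = s.domRestrict f :=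
      funext fun x => indicator_of_mem x.2 _
    rwa [this]
  · have : sᶜ.domRestrict (s.indicator f) = fun _ => 0 :=
      funext fun x => indicator_of_notMem x.2 _
    rw [this]
    exact measurable_const

lemma IsProduction.continuousOn_output_mul_wt (hF : IsProduction I₁ F)
    (h2 : ∀ x₂ ∈ I₂, -(1 / 2 : ℝ) < x₂) {b : ℝ} (hb : b ∈ I₁) :
    ContinuousOn (fun x : ℝ × ℝ => F x.1 b * wt x) (I₁ ×ˢ I₂) :=
  ((hF.continuousOn_left hb).comp continuousOn_fst fun _ hx => hx.1).mul (continuousOn_wt h2)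

/-- Equilibrium payoffs are not assumed measurable, but the weighted payoff is touched from below at
each type by the continuous value of joining that type's partner. -/
lemma IsEquilibrium.measurable_weighted_payoff (hF : IsProduction I₁ F)
    (h2 : ∀ x₂ ∈ I₂, -(1 / 2 : ℝ) < x₂) {μ : ℝ × ℝ → ℝ × ℝ} {u : ℝ × ℝ → ℝ}
    (hu : IsEquilibrium I₁ I₂ H F 1 μ u) {J : Set (ℝ × ℝ)} (hJ : J ⊆ I₁ ×ˢ I₂) :
    Measurable (J.domRestrict fun x => wt x * u x) := by
  refine measurable_of_touching fun x => ?_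
  have hx := hJ x.2
  have hm := hu.mapsTo hx
  refine ⟨J.domRestrict fun z => (F z.1 (μ x).1 * wt z + F z.1 (μ x).1 * wt (μ x)) / 2 -
    wt (μ x) * u (μ x), ?_, ?_, fun y => ?_⟩
  · refine (continuousOn_iff_continuous_domRestrict.1 ?_)
    refine ContinuousOn.mono ?_ hJ
    refine (ContinuousOn.div_const ?_ _).sub continuousOn_const
    exact (hF.continuousOn_output_mul_wt h2 hm.1).add
      (((hF.continuousOn_left hm.1).comp continuousOn_fst fun _ hz => hz.1).mul
        continuousOn_const)
  · have := hu.surplus_eq h2 hx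
    simp only [domRestrict_apply]
    linarith
  · have := hu.surplus_le h2 (hJ y.2) hm
    simp only [domRestrict_apply]
    linarith

lemma IsEquilibrium.measurable_benchmark (hF : IsProduction I₁ F) {μ : ℝ × ℝ → ℝ × ℝ}
    {uB : ℝ → ℝ} (hu : IsEquilibrium I₁ I₂ H F 0 μ fun x => uB x.1) :
    Measurable ((I₁ ×ˢ I₂).domRestrict fun x => uB x.1) := by
  refine measurable_of_touching fun x => ?_
  have hm := hu.mapsTo x.2
  refine ⟨(I₁ ×ˢ I₂).domRestrict fun z => F z.1 (μ x).1 - uB (μ x).1, ?_, ?_, fun y => ?_⟩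
  · exact continuousOn_iff_continuous_domRestrict.1
      (((hF.continuousOn_left hm.1).comp continuousOn_fst fun _ hz => hz.1).sub continuousOn_const)
  · have := hu.benchmark_eq x.2
    simp only [domRestrict_apply]
    linarith
  · have := hu.benchmark_le y.2 hm
    simp only [domRestrict_apply]
    linarith

/-- A worker of type `x` and a skill `b` at the same rank. -/
def SameRank (I₁ I₂ : Set ℝ) (H : Measure (ℝ × ℝ)) (F : ℝ → ℝ → ℝ) (k₁ k₂ : ℝ) (x : ℝ × ℝ)
    (b : ℝ) : Prop :=
  x ∈ I₁ ×ˢ I₂ ∧ x.2 ≠ sInf I₂ ∧ (∀ q : ℚ, gainRank H F k₂ k₁ x ≠ skillCdf H q) ∧ b ∈ I₁ ∧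
    skillCdfLeft H b ≤ gainRank H F k₂ k₁ x ∧ gainRank H F k₂ k₁ x ≤ skillCdf H b

/-- A rational skill `q` with `b' < q < b` would force the rank of `x` to equal `skillCdf H q`;
excluding these countably many ranks in `SameRank` gives monotonicity even when ranks tie. -/
lemma SameRank.mono [IsProbabilityMeasure H] {k₁ k₂ : ℝ} {x : ℝ × ℝ} {b : ℝ} {x' : ℝ × ℝ} {b' : ℝ}
    (hx : SameRank I₁ I₂ H F k₁ k₂ x b) (hx' : SameRank I₁ I₂ H F k₁ k₂ x' b')
    (hle : gainRank H F k₂ k₁ x ≤ gainRank H F k₂ k₁ x') : b ≤ b' := by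
  by_contra! hc
  obtain ⟨q, hq1, hq2⟩ := exists_rat_btwn hc
  have h1 := hx'.2.2.2.2.2.trans (skillCdf_mono hq1.le)
  have h2 := (skillCdf_le_skillCdfLeft hq2).trans hx.2.2.2.2.1
  exact hx.2.2.1 q (by linarith)

namespace IsRanked

variable [IsProbabilityMeasure H] {k₁ k₂ : ℝ} (h : IsRanked I₁ I₂ H F k₁ k₂)
include h

/-- The inequality compares gains from raising the partner's skill from `b` to `b'`, which are
ordered as the ranks. -/
lemma increasing_differences {x x' : ℝ × ℝ} {b b' : ℝ} (hx : x ∈ I₁ ×ˢ I₂) (hx' : x' ∈ I₁ ×ˢ I₂)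
    (hx2 : x'.2 ≠ sInf I₂) (hb : b ∈ I₁) (hb' : b' ∈ I₁)
    (hle : gainRank H F k₂ k₁ x ≤ gainRank H F k₂ k₁ x') (hbb : b ≤ b') :
    F x.1 b' * wt x + F x'.1 b * wt x' ≤ F x.1 b * wt x + F x'.1 b' * wt x' := by
  rcases hbb.eq_or_lt with rfl | hbb
  · rfl
  have := h.gain_le_of_rank_le hb' hb hbb hx hx' hx2 hle
  rw [gain_eq, gain_eq] at this
  linarith

/-- In equilibrium, the skill of a worker's partner has the same rank as the worker's gain. -/
theorem ae_partner_rank {μ : ℝ × ℝ → ℝ × ℝ} {u : ℝ × ℝ → ℝ}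
    (hu : IsEquilibrium I₁ I₂ H F 1 μ u) :
    ∀ᵐ x ∂H, skillCdfLeft H (μ x).1 ≤ gainRank H F k₂ k₁ x ∧
      gainRank H F k₂ k₁ x ≤ skillCdf H (μ x).1 := by
  obtain ⟨V, hVm, hV⟩ := h.exists_measurable_rank
  obtain ⟨φ, hφ⟩ := exists_potential (fun (x : ℝ × ℝ) b => F x.1 b * wt x) (gainRank H F k₂ k₁)
    (SameRank I₁ I₂ H F k₁ k₂) (fun x b x' b' hx hx' hle => hx.mono hx' hle)
    (fun x c x' b' z b hx hx' hz hle hbb =>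
      h.increasing_differences hx.1 hx'.1 hx'.2.1 hz.2.2.2.1 hx'.2.2.2.1 hle hbb)
  let dom := {x // ∃ c, SameRank I₁ I₂ H F k₁ k₂ x c}
  let f : dom → ℝ → ℝ := fun i b => F i.1.1 b * wt i.1 - φ i.1
  -- Together with `φ` this is the dual price of a skill in the worker-skill assignment: `F x₁ b wt
  -- x ≤ φ x + π b`, with equality when `x` and `b` have the same rank. `B` collects the skills
  -- where the supremum is finite.
  let π : ℝ → ℝ := fun b => ⨆ i, f i b
  let B : Set ℝ := {b ∈ I₁ | BddAbove (range fun i => f i b)}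
  have hπle : ∀ b ∈ B, ∀ i : dom, f i b ≤ π b := fun b hb i => le_ciSup hb.2 i
  have hnode : ∀ x b, SameRank I₁ I₂ H F k₁ k₂ x b → b ∈ B ∧ π b = F x.1 b * wt x - φ x := by
    intro x b hx
    have hub : ∀ i : dom, f i b ≤ F x.1 b * wt x - φ x := fun i => by
      obtain ⟨c, hc⟩ := i.2
      exact hφ x b i.1 c hx hc
    have hB : b ∈ B := ⟨hx.2.2.2.1, _, forall_mem_range.2 hub⟩
    have : Nonempty dom := ⟨⟨x, b, hx⟩⟩
    exact ⟨hB, le_antisymm (ciSup_le hub) (hπle b hB ⟨x, b, hx⟩)⟩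
  have hfc : ∀ i, ContinuousOn (f i) I₁ := fun i => by
    obtain ⟨c, hc⟩ := i.2
    exact ((h.prod.continuousOn_right hc.1.1).mul continuousOn_const).sub continuousOn_const
  have hBm : MeasurableSet B := by
    have : B = Subtype.val '' {b : I₁ | BddAbove (range fun i => f i b)} := by
      ext b
      simp [B, and_comm]
    rw [this]
    refine MeasurableSet.subtype_image h.pop.measurable_skill ?_
    have : {b : I₁ | BddAbove (range fun i => f i b)} =
        ⋃ n : ℕ, ⋂ i, {b : I₁ | f i b ≤ n} := by
      ext b
      simp only [mem_iUnion, mem_iInter, mem_ofPred_eq]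
      constructor
      · rintro ⟨c, hc⟩
        obtain ⟨n, hn⟩ := exists_nat_ge c
        exact ⟨n, fun i => (hc ⟨i, rfl⟩).trans hn⟩
      · rintro ⟨n, hn⟩
        exact ⟨n, forall_mem_range.2 hn⟩
    rw [this]
    refine MeasurableSet.iUnion fun n => IsClosed.measurableSet (isClosed_iInter fun i => ?_)
    exact isClosed_le (continuousOn_iff_continuous_domRestrict.1 (hfc i)) continuous_const
  let T : ℝ × ℝ → ℝ × ℝ := fun x => (x.1, skillQuantile H (V x))
  have hqm : Measurable fun x => skillQuantile H (V x) := measurable_skillQuantile.comp hVm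
  have hT : Measurable T := measurable_fst.prodMk hqm
  have hT' : Measurable fun x : ℝ × ℝ => (skillQuantile H (V x), x.1) := hqm.prodMk measurable_fst
  have hswap := h.map_swap_eq hVm hV
  have hswap' : ∀ W : Set (ℝ × ℝ), MeasurableSet W →
      H (T ⁻¹' W) = H ((fun x : ℝ × ℝ => (skillQuantile H (V x), x.1)) ⁻¹' W) := by
    intro W hW
    rw [← Measure.map_apply hT hW, ← Measure.map_apply hT' hW, hswap]
  -- The workers for whom all dual relations hold: each has the same rank as its own skill quantile,
  -- and its own skill has a finite price. `J` has full measure because the quantile is distributed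
  -- as the skill.
  let J : Set (ℝ × ℝ) := {x | x ∈ I₁ ×ˢ I₂ ∧ x.2 ≠ sInf I₂ ∧ (∀ q : ℚ, V x ≠ skillCdf H q) ∧
    V x ∈ Ioo (0 : ℝ) 1 ∧ skillQuantile H (V x) ∈ I₁ ∧ x.1 ∈ B}
  have hJI : J ⊆ I₁ ×ˢ I₂ := fun x hx => hx.1
  have hJm : MeasurableSet J := by
    refine h.pop.measurableSet.inter (MeasurableSet.inter ?_ (MeasurableSet.inter ?_
      (MeasurableSet.inter (hVm measurableSet_Ioo) (MeasurableSet.inter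
        (hqm h.pop.measurable_skill) (measurable_fst hBm)))))
    · exact measurable_snd (measurableSet_singleton _).compl
    · have : MeasurableSet (⋂ q : ℚ, {x | V x ≠ skillCdf H q}) :=
        MeasurableSet.iInter fun q => hVm (measurableSet_singleton _).compl
      rwa [iInter_ofPred] at this
  have hJnode : ∀ x ∈ J, SameRank I₁ I₂ H F k₁ k₂ x (skillQuantile H (V x)) := by
    intro x hx
    obtain ⟨h1, h2, h3, h4, h5, -⟩ := hx
    have e := hV x h1
    rw [e] at h3 h4 h5 ⊢
    exact ⟨h1, h2, h3, h5, skillCdfLeft_skillQuantile_le h4, le_skillCdf_skillQuantile h4⟩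
  have hJae : ∀ᵐ x ∂H, x ∈ J := by
    have e1 : ∀ᵐ x : ℝ × ℝ ∂H, x.2 ≠ sInf I₂ := by
      refine measure_eq_zero_iff_ae_notMem (s := {x : ℝ × ℝ | x.2 = sInf I₂}) |>.1
        (h.pop.null_of_slices (measurable_snd (measurableSet_singleton _)) ?_)
      intro a s hs t ht
      exact Eq.trans hs (Eq.symm ht)
    have e2 : ∀ᵐ x ∂H, ∀ q : ℚ, gainRank H F k₂ k₁ x ≠ skillCdf H q :=
      ae_all_iff.2 fun q => h.ae_rank_ne _
    have e3 : ∀ᵐ x ∂H, skillQuantile H (V x) ∈ I₁ := by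
      refine ((measure_eq_zero_iff_ae_notMem (s := {x | skillQuantile H (V x) ∉ I₁})).1 ?_).mono
        fun x hx => not_not.1 hx
      have := hswap' (Prod.fst ⁻¹' I₁ᶜ) (measurable_fst h.pop.measurable_skill.compl)
      refine Eq.trans this.symm ?_
      refine measure_mono_null (fun x hx => ?_) h.pop.concentrated
      exact fun hxI => hx hxI.1
    have e4 := h.ae_rank_mem_Ioo
    have e5 : ∀ᵐ x ∂H, skillQuantile H (V x) ∈ B := by
      filter_upwards [h.pop.ae_mem, e1, e2, e3, e4] with x h1 h2 h3 h5 h4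
      rw [hV x h1] at h5 ⊢
      exact (hnode x _ ⟨h1, h2, h3, h5, skillCdfLeft_skillQuantile_le h4,
        le_skillCdf_skillQuantile h4⟩).1
    have e6 : ∀ᵐ x : ℝ × ℝ ∂H, x.1 ∈ B := by
      refine ((measure_eq_zero_iff_ae_notMem (s := {x : ℝ × ℝ | x.1 ∉ B})).1 ?_).mono
        fun x hx => not_not.1 hx
      exact (hswap' (Prod.fst ⁻¹' Bᶜ) (measurable_fst hBm.compl)).trans
        (measure_eq_zero_iff_ae_notMem.2 (e5.mono fun x hx => not_not.2 hx))
    filter_upwards [h.pop.ae_mem, e1, e2, e3, e4, e6] with x h1 h2 h3 h4 h5 h6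
    rw [← hV x h1] at h3 h5
    exact ⟨h1, h2, h3, h5, h4, h6⟩
  have hφm : Measurable (J.domRestrict φ) := by
    refine measurable_of_touching fun x => ?_
    have hx := hJnode x x.2
    set b := skillQuantile H (V x)
    refine ⟨J.domRestrict fun z => F z.1 b * wt z - (F x.1.1 b * wt x.1 - φ x), ?_, ?_,
      fun y => ?_⟩
    · exact continuousOn_iff_continuous_domRestrict.1
        (((h.prod.continuousOn_output_mul_wt h.pop.pref_gt hx.2.2.2.1).sub
          continuousOn_const).mono hJI)
    · simp only [domRestrict_apply]; ring
    · have := hφ x b y _ hx (hJnode y y.2)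
      simp only [domRestrict_apply]
      linarith
  have hπm : Measurable (J.domRestrict fun x => π x.1) := by
    refine LowerSemicontinuous.measurable ?_
    refine lowerSemicontinuous_ciSup (f := fun (i : dom) (x : J) => f i x.1.1)
      (fun x => x.2.2.2.2.2.2.2) fun i => Continuous.lowerSemicontinuous ?_
    exact continuousOn_iff_continuous_domRestrict.1
      ((hfc i).comp (s := J) continuousOn_fst fun x hx => hx.1.1)
  -- Twice the weighted equilibrium payoff, less the dual payoff from both roles of the worker. On a
  -- matched pair `D` sums to minus the two dual slacks, so `D ∘ μ ≤ -D`.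
  let D : ℝ × ℝ → ℝ := J.indicator fun x => 2 * (wt x * u x) - φ x - π x.1
  have hDm : Measurable D := measurable_indicator_of_domRestrict hJm
    ((((hu.measurable_weighted_payoff h.prod h.pop.pref_gt hJI).const_mul 2).sub hφm).sub hπm)
  have hD : ∀ x ∈ J, D x = 2 * (wt x * u x) - φ x - π x.1 := fun x hx => indicator_of_mem hx _
  have hslack : ∀ x ∈ J, ∀ b ∈ B, F x.1 b * wt x ≤ φ x + π b := by
    intro x hx b hb
    have := hπle b hb ⟨x, _, hJnode x hx⟩
    simp only [f] at this
    linarith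
  have hμJ : ∀ᵐ x ∂H, μ x ∈ J := by
    refine ae_of_ae_map hu.feasible.1 ?_
    rw [hu.feasible.2]
    exact hJae
  have hpair : ∀ x ∈ J, μ x ∈ J → D x + D (μ x) = F x.1 (μ x).1 * wt x - φ x - π (μ x).1 +
      (F (μ x).1 x.1 * wt (μ x) - φ (μ x) - π x.1) := by
    intro x hx hm
    have := hu.surplus_eq h.pop.pref_gt hx.1
    rw [hD x hx, hD _ hm, h.prod.symm _ hm.1.1 _ hx.1.1]
    linarith
  have hle : ∀ᵐ x ∂H, D (μ x) ≤ -D x := by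
    filter_upwards [hJae, hμJ] with x hx hm
    have h1 := hslack x hx _ hm.2.2.2.2.2
    have h2 := hslack _ hm _ hx.2.2.2.2.2
    have h3 := hpair x hx hm
    linarith
  have hdom : ∀ t : ℝ, H {x | D x < -t} ≤ H {x | t < D x} := by
    intro t
    have hA := (((measurableSet_lt hDm (measurable_const (a := -t))).inter hJm).analyticSet_image
      hT)
    have hB := (((measurableSet_le hDm (measurable_const (a := t))).inter hJm).analyticSet_image
      hT')
    -- If each of `x` and `y` has as skill the quantile of the other, both dual inequalities bind
    -- and stability gives `D x + D y ≥ 0`; hence the images do not meet. They are analytic, so a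
    -- Borel set separates them, and by exchangeability that set has the same mass under both maps.
    have hdisj : Disjoint (T '' ({x | D x < -t} ∩ J))
        ((fun x : ℝ × ℝ => (skillQuantile H (V x), x.1)) '' ({x | D x ≤ t} ∩ J)) := by
      refine disjoint_left.2 ?_
      rintro _ ⟨x, ⟨hxt, hx⟩, rfl⟩ ⟨y, ⟨hyt, hy⟩, hxy⟩
      obtain ⟨h1, h2⟩ := Prod.ext_iff.1 hxy
      simp only [T] at h1 h2
      have hx' := (hnode x _ (hJnode x hx)).2
      have hy' := (hnode y _ (hJnode y hy)).2
      rw [← h2] at hx'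
      rw [h1] at hy'
      have := hu.surplus_le h.pop.pref_gt hx.1 hy.1
      have hxt' : D x < -t := hxt
      have hyt' : D y ≤ t := hyt
      rw [hD x hx] at hxt'
      rw [hD y hy] at hyt'
      rw [h.prod.symm _ hy.1.1 _ hx.1.1] at hy'
      linarith
    obtain ⟨W, hAW, hBW, hW⟩ := hA.measurablySeparable hB hdisj
    calc H {x | D x < -t} ≤ H (T ⁻¹' W) := by
          refine measure_mono_ae ?_
          filter_upwards [hJae] with x hx hxt
          exact hAW ⟨x, ⟨hxt, hx⟩, rfl⟩
      _ = H ((fun x : ℝ × ℝ => (skillQuantile H (V x), x.1)) ⁻¹' W) := hswap' W hW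
      _ ≤ H {x | t < D x} := by
          refine measure_mono_ae ?_
          filter_upwards [hJae] with x hx hxW
          by_contra hc
          exact disjoint_left.1 hBW ⟨x, ⟨not_lt.1 hc, hx⟩, rfl⟩ hxW
  filter_upwards [hJae, hμJ, ae_comp_eq_neg hDm hu.feasible.1 hu.feasible.2 hle hdom]
    with x hx hm heq
  -- Equality `D ∘ μ = -D` leaves no slack: the actual partner's skill is optimal for `x` at the
  -- dual prices.
  have hs : F x.1 (μ x).1 * wt x = φ x + π (μ x).1 := by
    have h1 := hslack x hx _ hm.2.2.2.2.2
    have h2 := hslack _ hm _ hx.2.2.2.2.2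
    have h3 := hpair x hx hm
    linarith
  -- Hence exchanging skills between `x` and any worker `z` at its own quantile is not profitable. A
  -- `z` with rank strictly between the worker's and the partner's would make it so.
  have hex : ∀ z ∈ J, F x.1 (skillQuantile H (V z)) * wt x + F z.1 (μ x).1 * wt z ≤
      F x.1 (μ x).1 * wt x + F z.1 (skillQuantile H (V z)) * wt z := by
    intro z hz
    have h1 := hnode z _ (hJnode z hz)
    have h2 := hslack x hx _ h1.1
    have h3 := hslack z hz _ hm.2.2.2.2.2
    linarith
  constructor
  · by_contra! hc
    obtain ⟨z, hz, hz1, hz2⟩ := h.exists_rank_mem (rank_nonneg x) hc (skillCdfLeft_le_one _) hJae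
    have hn := hJnode z hz
    have hlt : skillQuantile H (V z) < (μ x).1 := by
      by_contra! hle'
      have := (skillCdfLeft_mono (H := H) hle').trans hn.2.2.2.2.1
      linarith
    have := h.gain_lt_of_rank_lt hm.1.1 hn.2.2.2.1 hlt hx.1 hz.1 hz1
    rw [gain_eq, gain_eq] at this
    linarith [hex z hz]
  · by_contra! hc
    obtain ⟨z, hz, hz1, hz2⟩ := h.exists_rank_mem (skillCdf_nonneg _) hc (rank_le_one x) hJae
    have hn := hJnode z hz
    have hlt : (μ x).1 < skillQuantile H (V z) := by
      by_contra! hle'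
      have := hn.2.2.2.2.2.trans (skillCdf_mono (H := H) hle')
      linarith
    have := h.gain_lt_of_rank_lt hn.2.2.2.1 hm.1.1 hlt hz.1 hx.1 hz2
    rw [gain_eq, gain_eq] at this
    linarith [hex z hz]

end IsRanked

end

/-! ### Pairs better off than in the benchmark -/

section

open Filter Topology

variable {I₁ I₂ : Set ℝ} {H : Measure (ℝ × ℝ)} {F : ℝ → ℝ → ℝ}

/-- Two workers matched in equilibrium, both better off than in the benchmark, the skill of each
having the same rank as the gain of the other. -/
structure IsBetterPair (I₁ I₂ : Set ℝ) (H : Measure (ℝ × ℝ)) (F : ℝ → ℝ → ℝ) (k₁ k₂ : ℝ)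
    (u : ℝ × ℝ → ℝ) (uB : ℝ → ℝ) (x y : ℝ × ℝ) : Prop where
  mem_left : x ∈ I₁ ×ˢ I₂
  mem_right : y ∈ I₁ ×ˢ I₂
  le_rank_left : skillCdfLeft H y.1 ≤ gainRank H F k₂ k₁ x
  rank_left_le : gainRank H F k₂ k₁ x ≤ skillCdf H y.1
  le_rank_right : skillCdfLeft H x.1 ≤ gainRank H F k₂ k₁ y
  rank_right_le : gainRank H F k₂ k₁ y ≤ skillCdf H x.1
  rank_left_ne : gainRank H F k₂ k₁ x ≠ 1 / 2
  rank_right_ne : gainRank H F k₂ k₁ y ≠ 1 / 2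
  better_left : uB x.1 < u x
  better_right : uB y.1 < u y
  surplus : wt x * u x + wt y * u y = F x.1 y.1 * (wt x + wt y) / 2

/-- A ranked population with strictly submodular production in which almost all workers are
better off in an equilibrium with social comparisons than in the benchmark. -/
structure IsImproved (I₁ I₂ : Set ℝ) (H : Measure (ℝ × ℝ)) [IsProbabilityMeasure H]
    (F : ℝ → ℝ → ℝ) (k₁ k₂ : ℝ) (μ : ℝ × ℝ → ℝ × ℝ) (u : ℝ × ℝ → ℝ) (μB : ℝ × ℝ → ℝ × ℝ)
    (uB : ℝ → ℝ) : Prop where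
  ranked : IsRanked I₁ I₂ H F k₁ k₂
  eqm : IsEquilibrium I₁ I₂ H F 1 μ u
  benchmark : IsEquilibrium I₁ I₂ H F 0 μB fun x => uB x.1
  submodular : StrictlySubmodular I₁ F
  better : ∀ᵐ x ∂H, uB x.1 < u x

namespace IsImproved

variable [IsProbabilityMeasure H] {k₁ k₂ : ℝ} {μ μB : ℝ × ℝ → ℝ × ℝ} {u : ℝ × ℝ → ℝ} {uB : ℝ → ℝ}
  (h : IsImproved I₁ I₂ H F k₁ k₂ μ u μB uB)
include h

lemma ae_isBetterPair : ∀ᵐ x ∂H, IsBetterPair I₁ I₂ H F k₁ k₂ u uB x (μ x) := by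
  have hμ : ∀ {p : ℝ × ℝ → Prop}, (∀ᵐ x ∂H, p x) → ∀ᵐ x ∂H, p (μ x) := fun {p} hp =>
    ae_of_ae_map h.eqm.feasible.1 (by rw [h.eqm.feasible.2]; exact hp)
  have hr := h.ranked.ae_partner_rank h.eqm
  have hn := h.ranked.ae_rank_ne (1 / 2)
  filter_upwards [h.ranked.pop.ae_mem, hr, hμ hr, hn, hμ hn, h.better, hμ h.better]
    with x h1 h2 h3 h4 h5 h6 h7
  rw [h.eqm.involutive x h1] at h3
  exact ⟨h1, h.eqm.mapsTo h1, h2.1, h2.2, h3.1, h3.2, h4, h5, h6, h7,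
    h.eqm.surplus_eq h.ranked.pop.pref_gt h1⟩

lemma exists_isBetterPair {x : ℝ × ℝ} (hx : x ∈ I₁ ×ˢ I₂) {p : ℝ × ℝ → Prop}
    (hp : ∀ᶠ y in 𝓝[I₁ ×ˢ I₂] x, p y) :
    ∃ y z, p y ∧ IsBetterPair I₁ I₂ H F k₁ k₂ u uB y z := by
  obtain ⟨y, hy, hyz⟩ := h.ranked.full.exists_of_eventually hx hp h.ae_isBetterPair
  exact ⟨y, _, hy, hyz⟩

omit h [IsProbabilityMeasure H] in
lemma _root_.TeamFormation.IsBetterPair.symm (hF : IsProduction I₁ F) {x y : ℝ × ℝ}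
    (hxy : IsBetterPair I₁ I₂ H F k₁ k₂ u uB x y) : IsBetterPair I₁ I₂ H F k₁ k₂ u uB y x := by
  refine ⟨hxy.2, hxy.1, hxy.5, hxy.6, hxy.3, hxy.4, hxy.8, hxy.7, hxy.10, hxy.9, ?_⟩
  rw [hF.symm _ hxy.2.1 _ hxy.1.1, add_comm, hxy.surplus, add_comm (wt x)]

lemma nonempty_pref : I₂.Nonempty := by
  obtain ⟨x, hx⟩ := h.ranked.pop.ae_mem.exists
  exact ⟨_, hx.2⟩

/-- A single preference would be an atom of the conditional law of `X₂`. -/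
lemma exists_pref_lt : ∃ s ∈ I₂, ∃ t ∈ I₂, s < t := by
  by_contra! hc
  have : H (I₁ ×ˢ I₂) = 0 := h.ranked.pop.null_of_slices h.ranked.pop.measurableSet
    fun a s hs t ht => le_antisymm (hc t ht.2 s hs.2) (hc s hs.2 t ht.2)
  exact measure_eq_zero_iff_ae_notMem.1 this |>.and h.ranked.pop.ae_mem |>.exists.elim
    fun x hx => hx.1 hx.2

lemma benchmark_le {a b : ℝ} (ha : a ∈ I₁) (hb : b ∈ I₁) : F a b ≤ uB a + uB b := by
  obtain ⟨t, ht⟩ := h.nonempty_pref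
  exact h.benchmark.benchmark_le (x := (a, t)) (y := (b, t)) ⟨ha, ht⟩ ⟨hb, ht⟩

lemma exists_benchmark_partner {a : ℝ} (ha : a ∈ I₁) : ∃ m ∈ I₁, uB a + uB m = F a m := by
  obtain ⟨t, ht⟩ := h.nonempty_pref
  exact ⟨_, (h.benchmark.mapsTo (x := (a, t)) ⟨ha, ht⟩).1,
    h.benchmark.benchmark_eq (x := (a, t)) ⟨ha, ht⟩⟩

/-- A more able worker can replace `a` in the team with the benchmark partner of `a`, where output
rises. -/
lemma benchmark_strictMonoOn : StrictMonoOn uB I₁ := by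
  intro a ha b hb hab
  obtain ⟨m, hm, he⟩ := h.exists_benchmark_partner ha
  have h1 := h.benchmark_le hb hm
  have h2 : F a m < F b m := h.ranked.prod.increasing m hm ha hb hab
  linarith

/-- Lower semicontinuity: the option to join the benchmark partner of `b` is continuous in skill and
bounds `uB` from below. -/
lemma eventually_benchmark_gt {b l : ℝ} (hb : b ∈ I₁) (hl : l < uB b) :
    ∀ᶠ c in 𝓝[I₁] b, l < uB c := by
  obtain ⟨m, hm, he⟩ := h.exists_benchmark_partner hb
  have hc := (h.ranked.prod.continuousOn_left hm b hb).eventually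
    (lt_mem_nhds (show l + uB m < F b m by linarith))
  filter_upwards [hc, self_mem_nhdsWithin] with c hc hcI
  linarith [h.benchmark_le hcI hm]

/-- Otherwise both would earn more than half the output, and their weighted payoffs would exceed the
surplus. -/
lemma min_benchmark_lt {x y : ℝ × ℝ} (hxy : IsBetterPair I₁ I₂ H F k₁ k₂ u uB x y) :
    min (uB x.1) (uB y.1) < F x.1 y.1 / 2 := by
  by_contra! hc
  have hx := h.ranked.wt_pos hxy.mem_left
  have hy := h.ranked.wt_pos hxy.mem_right
  have h1 := mul_lt_mul_of_pos_left ((hc.trans (min_le_left _ _)).trans_lt hxy.better_left) hx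
  have h2 := mul_lt_mul_of_pos_left ((hc.trans (min_le_right _ _)).trans_lt hxy.better_right) hy
  linarith [hxy.surplus]

lemma skill_ne {x y : ℝ × ℝ} (hxy : IsBetterPair I₁ I₂ H F k₁ k₂ u uB x y) : x.1 ≠ y.1 := by
  intro he
  have h1 := h.min_benchmark_lt hxy
  have h2 := h.benchmark.half_le_benchmark hxy.mem_left
  rw [← he, min_self] at h1
  linarith

/-- Within a pair the more able worker has the stronger relative concerns. -/
lemma wt_lt_of_skill_lt {x y : ℝ × ℝ} (hxy : IsBetterPair I₁ I₂ H F k₁ k₂ u uB x y)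
    (hlt : x.1 < y.1) : wt y < wt x := by
  have hx := h.ranked.wt_pos hxy.mem_left
  have hy := h.ranked.wt_pos hxy.mem_right
  have h1 := mul_lt_mul_of_pos_left hxy.better_left hx
  have h2 := mul_lt_mul_of_pos_left hxy.better_right hy
  have h3 := h.benchmark_le hxy.mem_left.1 hxy.mem_right.1
  have h4 := h.benchmark_strictMonoOn hxy.mem_left.1 hxy.mem_right.1 hlt
  have h5 := hxy.surplus
  by_contra! hc
  have h6 := mul_le_mul_of_nonneg_right h3 (add_pos hx hy).le
  nlinarith

lemma pref_lt_of_skill_lt {x y : ℝ × ℝ} (hxy : IsBetterPair I₁ I₂ H F k₁ k₂ u uB x y)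
    (hlt : x.1 < y.1) : x.2 < y.2 :=
  (h.ranked.wt_lt_iff hxy.mem_right hxy.mem_left).1 (h.wt_lt_of_skill_lt hxy hlt)

lemma gain_lt_of_skill_lt {c c' t : ℝ} (hc : c ∈ I₁) (hc' : c' ∈ I₁) (ht : t ∈ I₂)
    (hlt : c < c') : gain F k₂ k₁ (c', t) < gain F k₂ k₁ (c, t) := by
  rw [gain_eq, gain_eq]
  have h1 := h.submodular c hc c' hc' k₁ h.ranked.mem_left k₂ h.ranked.mem_right hlt h.ranked.lt
  exact mul_lt_mul_of_pos_right (by simp only; linarith) (h.ranked.wt_pos (x := (c, t)) ⟨hc, ht⟩)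

lemma rank_le_of_skill_le {c c' t : ℝ} (hc : c ∈ I₁) (hc' : c' ∈ I₁) (ht : t ∈ I₂)
    (hle : c ≤ c') : gainRank H F k₂ k₁ (c', t) ≤ gainRank H F k₂ k₁ (c, t) := by
  rcases hle.lt_or_eq with hlt | rfl
  · exact h.ranked.rank_le_of_gain_le h.ranked.mem_right h.ranked.mem_left h.ranked.lt ⟨hc', ht⟩
      ⟨hc, ht⟩ (h.gain_lt_of_skill_lt hc hc' ht hlt).le
  · rfl

lemma continuousOn_rank_pref {b : ℝ} (hb : b ∈ I₁) :
    ContinuousOn (fun t => gainRank H F k₂ k₁ (b, t)) I₂ :=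
  h.ranked.continuousOn_rank.comp (f := fun t => (b, t)) (by fun_prop) fun _ ht => ⟨hb, ht⟩

lemma continuousOn_rank_skill {t : ℝ} (ht : t ∈ I₂) :
    ContinuousOn (fun b => gainRank H F k₂ k₁ (b, t)) I₁ :=
  h.ranked.continuousOn_rank.comp (f := fun b => (b, t)) (by fun_prop) fun _ hb => ⟨hb, ht⟩

/-- The ranks of the workers of skill `b` lie on one side of an interval they do not meet. -/
lemma rank_le_or_ge {b v w : ℝ} (hb : b ∈ I₁) (hvw : v < w)
    (hn : ∀ t ∈ I₂, ¬ (v < gainRank H F k₂ k₁ (b, t) ∧ gainRank H F k₂ k₁ (b, t) < w)) :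
    (∀ t ∈ I₂, gainRank H F k₂ k₁ (b, t) ≤ v) ∨ (∀ t ∈ I₂, w ≤ gainRank H F k₂ k₁ (b, t)) := by
  by_contra! hc
  obtain ⟨⟨s, hs, hsv⟩, t, ht, htw⟩ := hc
  have hsw : w ≤ gainRank H F k₂ k₁ (b, s) := not_lt.1 fun hlt => hn s hs ⟨hsv, hlt⟩
  have htv : gainRank H F k₂ k₁ (b, t) ≤ v := not_lt.1 fun hlt => hn t ht ⟨hlt, htw⟩
  obtain ⟨r, hr, hrv⟩ := h.ranked.ord.isPreconnected.intermediate_value ht hs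
    (h.continuousOn_rank_pref hb) (show (v + w) / 2 ∈ Icc _ _ from ⟨by linarith, by linarith⟩)
  simp only at hrv
  exact hn r hr ⟨by linarith, by linarith⟩

/-- Full support puts mass on every neighbourhood of the skill `b` in between. -/
lemma skillCdf_lt_skillCdfLeft {a b c : ℝ} (hb : b ∈ I₁) (hab : a < b) (hbc : b < c) :
    skillCdf H a < skillCdfLeft H c := by
  obtain ⟨t, ht⟩ := h.nonempty_pref
  have hpos : 0 < H {x | a < x.1 ∧ x.1 < c} := by
    refine h.ranked.full.pos_of_eventually (x := (b, t)) ⟨hb, ht⟩ (mem_nhdsWithin_of_mem_nhds ?_)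
    exact continuous_fst.continuousAt.eventually (Ioo_mem_nhds hab hbc)
  have hm : MeasurableSet {x : ℝ × ℝ | a < x.1 ∧ x.1 < c} := measurable_fst measurableSet_Ioo
  have h1 := measureReal_union (μ := H) (s₁ := {x : ℝ × ℝ | x.1 ≤ a})
    (disjoint_left.2 fun x (hx : x.1 ≤ a) hx' => hx.not_gt hx'.1) hm
  have h2 : H.real ({x : ℝ × ℝ | x.1 ≤ a} ∪ {x | a < x.1 ∧ x.1 < c}) ≤ skillCdfLeft H c := by
    refine measureReal_mono ?_
    rintro x (hx | hx)
    · exact lt_of_le_of_lt hx (hab.trans hbc)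
    · exact hx.2
  have h3 := ENNReal.toReal_pos hpos.ne' (measure_ne_top _ _)
  rw [h1] at h2
  have h4 : skillCdf H a = H.real {x | x.1 ≤ a} := rfl
  have h5 : (H {x : ℝ × ℝ | a < x.1 ∧ x.1 < c}).toReal = H.real {x | a < x.1 ∧ x.1 < c} := rfl
  linarith

end IsImproved

/-- Workers of skill `b` have ranks above the rank of their skill. -/
def RanksAbove (I₂ : Set ℝ) (H : Measure (ℝ × ℝ)) (F : ℝ → ℝ → ℝ) (k₁ k₂ b : ℝ) : Prop :=
  ∀ t ∈ I₂, skillCdf H b ≤ gainRank H F k₂ k₁ (b, t)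

/-- Workers of skill `b` have ranks below the rank of their skill. -/
def RanksBelow (I₂ : Set ℝ) (H : Measure (ℝ × ℝ)) (F : ℝ → ℝ → ℝ) (k₁ k₂ b : ℝ) : Prop :=
  ∀ t ∈ I₂, gainRank H F k₂ k₁ (b, t) ≤ skillCdfLeft H b

namespace IsImproved

variable [IsProbabilityMeasure H] {k₁ k₂ : ℝ} {μ μB : ℝ × ℝ → ℝ × ℝ} {u : ℝ × ℝ → ℝ} {uB : ℝ → ℝ}
  (h : IsImproved I₁ I₂ H F k₁ k₂ μ u μB uB)
include h

lemma ranksAbove_of_le {a b : ℝ} (ha : a ∈ I₁) (hb : b ∈ I₁) (hab : a ≤ b)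
    (hB : RanksAbove I₂ H F k₁ k₂ b) : RanksAbove I₂ H F k₁ k₂ a := fun t ht =>
  (skillCdf_mono hab).trans ((hB t ht).trans (h.rank_le_of_skill_le ha hb ht hab))

lemma ranksBelow_of_le {a b : ℝ} (ha : a ∈ I₁) (hb : b ∈ I₁) (hab : a ≤ b)
    (hA : RanksBelow I₂ H F k₁ k₂ a) : RanksBelow I₂ H F k₁ k₂ b := fun t ht =>
  (h.rank_le_of_skill_le ha hb ht hab).trans ((hA t ht).trans (skillCdfLeft_mono hab))

/-- Close to `b` both benchmark payoffs would exceed half the output, so `min_benchmark_lt` excludes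
pairs with both skills near `b`. A worker of skill `b` whose rank falls among those of nearby skills
would produce such a pair, and continuity in the preference does not let ranks jump over this gap.
-/
lemma ranksAbove_or_below_of_lt {b : ℝ} (hb : b ∈ I₁) (hub : F b b / 2 < uB b) :
    RanksAbove I₂ H F k₁ k₂ b ∨ RanksBelow I₂ H F k₁ k₂ b := by
  obtain ⟨l, hl1, hl2⟩ := exists_between hub
  have hF : ∀ᶠ p in 𝓝[I₁ ×ˢ I₁] (b, b), F p.1 p.2 / 2 < l :=
    (h.ranked.prod.smooth.continuousOn.div_const 2 (b, b) ⟨hb, hb⟩).eventually (gt_mem_nhds hl1)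
  have hU := h.eventually_benchmark_gt hb hl2
  obtain ⟨δ₁, hδ₁, h1⟩ := Metric.mem_nhdsWithin_iff.1 hF
  obtain ⟨δ₂, hδ₂, h2⟩ := Metric.mem_nhdsWithin_iff.1 hU
  set δ := min δ₁ δ₂ with hδ
  have hδ0 : 0 < δ := lt_min hδ₁ hδ₂
  have key : ∀ x y, IsBetterPair I₁ I₂ H F k₁ k₂ u uB x y → dist x.1 b < δ → ¬ dist y.1 b < δ := by
    intro x y hxy hx hy
    have e1 : F x.1 y.1 / 2 < l := h1 ⟨show dist (x.1, y.1) (b, b) < δ₁ from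
      max_lt (hx.trans_le (min_le_left _ _)) (hy.trans_le (min_le_left _ _)),
      hxy.mem_left.1, hxy.mem_right.1⟩
    have e2 : l < uB x.1 := h2 ⟨hx.trans_le (min_le_right _ _), hxy.mem_left.1⟩
    have e3 : l < uB y.1 := h2 ⟨hy.trans_le (min_le_right _ _), hxy.mem_right.1⟩
    have := h.min_benchmark_lt hxy
    linarith [lt_min e2 e3]
  have hvw := h.skillCdf_lt_skillCdfLeft hb (show b - δ < b by linarith)
    (show b < b + δ by linarith)
  refine (h.rank_le_or_ge hb hvw fun t ht hv => ?_).symm.imp ?_ ?_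
  · have hc := h.ranked.continuousOn_rank (b, t) ⟨hb, ht⟩
    have hd : ∀ᶠ y : ℝ × ℝ in 𝓝[I₁ ×ˢ I₂] (b, t), dist y.1 b < δ :=
      mem_nhdsWithin_of_mem_nhds (continuous_fst.continuousAt.eventually
        (Metric.eventually_nhds_iff_ball.2 ⟨δ, hδ0, fun _ hy => hy⟩))
    obtain ⟨x, y, ⟨hx, hx1, hx2⟩, hxy⟩ := h.exists_isBetterPair ⟨hb, ht⟩
      (hd.and ((hc.eventually (lt_mem_nhds hv.1)).and (hc.eventually (gt_mem_nhds hv.2))))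
    refine key x y hxy hx ?_
    rw [Real.dist_eq, abs_lt]
    constructor
    · by_contra! hle
      have := skillCdf_mono (H := H) (show y.1 ≤ b - δ by linarith)
      linarith [hxy.rank_left_le]
    · by_contra! hle
      have := skillCdfLeft_mono (H := H) (show b + δ ≤ y.1 by linarith)
      linarith [hxy.le_rank_left]
  · exact fun hw t ht => (skillCdf_le_skillCdfLeft (by linarith)).trans (hw t ht)
  · exact fun hw t ht => (hw t ht).trans (skillCdf_le_skillCdfLeft (by linarith))

/-- Either all workers of a given skill have ranks above the rank of the skill, or all have ranks
below it. -/
lemma ranksAbove_or_below {b : ℝ} (hb : b ∈ I₁) :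
    RanksAbove I₂ H F k₁ k₂ b ∨ RanksBelow I₂ H F k₁ k₂ b := by
  obtain ⟨t₀, ht₀⟩ := h.nonempty_pref
  have hhalf : ∀ c ∈ I₁, F c c / 2 ≤ uB c := fun c hc =>
    h.benchmark.half_le_benchmark (x := (c, t₀)) ⟨hc, ht₀⟩
  rcases (hhalf b hb).lt_or_eq with hlt | heq
  · exact h.ranksAbove_or_below_of_lt hb hlt
  -- By strict submodularity equality `F c c / 2 = uB c` cannot hold at two skills, since the two
  -- workers would then block the benchmark together.
  have hother : ∀ c ∈ I₁, c ≠ b → RanksAbove I₂ H F k₁ k₂ c ∨ RanksBelow I₂ H F k₁ k₂ c := by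
    intro c hc hne
    refine h.ranksAbove_or_below_of_lt hc (lt_of_le_of_ne (hhalf c hc) fun he => ?_)
    have h1 := h.benchmark_le hb hc
    have h2 := h.ranked.prod.symm b hb c hc
    rcases hne.lt_or_gt with hcb | hcb
    · linarith [h.submodular c hc b hb c hc b hb hcb hcb]
    · linarith [h.submodular b hb c hc b hb c hc hcb hcb]
  by_contra! hcon
  obtain ⟨hnA, hnB⟩ := hcon
  have hleft : ∀ c ∈ I₁, c < b → RanksAbove I₂ H F k₁ k₂ c := fun c hc hcb =>
    (hother c hc hcb.ne).resolve_right fun hB => hnB (h.ranksBelow_of_le hc hb hcb.le hB)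
  have hright : ∀ c ∈ I₁, b < c → RanksBelow I₂ H F k₁ k₂ c := fun c hc hcb =>
    (hother c hc hcb.ne').resolve_left fun hA => hnA (h.ranksAbove_of_le hb hc hcb.le hA)
  -- Where skills accumulate at `b` from below, their ranks pass to the limit; `hR` does the same
  -- from above.
  have hL : (𝓝[I₁ ∩ Iio b] b).NeBot → ∀ t ∈ I₂, skillCdfLeft H b ≤ gainRank H F k₂ k₁ (b, t) := by
    intro hne t ht
    refine skillCdfLeft_le_of_forall_lt fun c hcb => ?_
    refine ge_of_tendsto ((h.continuousOn_rank_skill ht b hb).mono_left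
      (nhdsWithin_mono b (inter_subset_left (t := Iio b)))) ?_
    filter_upwards [self_mem_nhdsWithin, mem_nhdsWithin_of_mem_nhds (lt_mem_nhds hcb)]
      with c' hc' hcc
    exact (skillCdf_mono hcc.le).trans (hleft c' hc'.1 hc'.2 t ht)
  have hR : (𝓝[I₁ ∩ Ioi b] b).NeBot → ∀ t ∈ I₂, gainRank H F k₂ k₁ (b, t) ≤ skillCdf H b := by
    intro hne t ht
    refine le_skillCdf_of_forall_gt fun c hcb => ?_
    refine le_of_tendsto ((h.continuousOn_rank_skill ht b hb).mono_left
      (nhdsWithin_mono b (inter_subset_left (t := Ioi b)))) ?_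
    filter_upwards [self_mem_nhdsWithin, mem_nhdsWithin_of_mem_nhds (gt_mem_nhds hcb)]
      with c' hc' hcc
    exact (hright c' hc'.1 hc'.2 t ht).trans
      ((skillCdfLeft_le_skillCdf c').trans (skillCdf_mono hcc.le))
  have hnbL : ∀ t, ∀ᶠ x : ℝ × ℝ in 𝓝[I₁ ×ˢ I₂] (b, t), x.1 < b → (𝓝[I₁ ∩ Iio b] b).NeBot := by
    intro t
    by_cases hne : (𝓝[I₁ ∩ Iio b] b).NeBot
    · exact Eventually.of_forall fun _ _ => hne
    · rw [not_neBot, ← empty_mem_iff_bot, mem_nhdsWithin_iff_eventually] at hne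
      filter_upwards [mem_nhdsWithin_of_mem_nhds (continuous_fst.continuousAt.eventually hne),
        self_mem_nhdsWithin] with x hx hxI hlt
      exact (hx ⟨hxI.1, hlt⟩).elim
  have hnbR : ∀ t, ∀ᶠ x : ℝ × ℝ in 𝓝[I₁ ×ˢ I₂] (b, t), b < x.1 → (𝓝[I₁ ∩ Ioi b] b).NeBot := by
    intro t
    by_cases hne : (𝓝[I₁ ∩ Ioi b] b).NeBot
    · exact Eventually.of_forall fun _ _ => hne
    · rw [not_neBot, ← empty_mem_iff_bot, mem_nhdsWithin_iff_eventually] at hne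
      filter_upwards [mem_nhdsWithin_of_mem_nhds (continuous_fst.continuousAt.eventually hne),
        self_mem_nhdsWithin] with x hx hxI hlt
      exact (hx ⟨hxI.1, hlt⟩).elim
  rcases (skillCdfLeft_le_skillCdf (H := H) b).lt_or_eq with hatom | hatom
  -- An atom at `b`: a rank strictly inside the jump yields a pair with a partner of skill exactly
  -- `b`. The worker then has another skill, arbitrarily close, and the partner's rank contradicts
  -- `hL` or `hR`.
  · obtain ⟨t, ht, hv⟩ : ∃ t ∈ I₂, skillCdfLeft H b < gainRank H F k₂ k₁ (b, t) ∧
        gainRank H F k₂ k₁ (b, t) < skillCdf H b := by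
      by_contra! hc
      rcases h.rank_le_or_ge hb hatom fun t ht hv => (hc t ht hv.1).not_gt hv.2 with hB | hA
      · exact hnB hB
      · exact hnA hA
    have hc := h.ranked.continuousOn_rank (b, t) ⟨hb, ht⟩
    obtain ⟨x, y, ⟨hx1, hx2, hx3, hx4⟩, hxy⟩ := h.exists_isBetterPair ⟨hb, ht⟩
      ((hc.eventually (lt_mem_nhds hv.1)).and ((hc.eventually (gt_mem_nhds hv.2)).and
        ((hnbL t).and (hnbR t))))
    have hy : y.1 = b := by
      refine le_antisymm ?_ ?_
      · by_contra! hlt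
        linarith [skillCdf_le_skillCdfLeft (H := H) hlt, hxy.le_rank_left]
      · by_contra! hlt
        linarith [skillCdf_le_skillCdfLeft (H := H) hlt, hxy.rank_left_le]
    have hye : y = (b, y.2) := Prod.ext hy rfl
    rcases lt_trichotomy x.1 b with hlt | he | hlt
    · have hne := hx3 hlt
      obtain ⟨c, hc, hxc⟩ : ∃ c ∈ I₁ ∩ Iio b, x.1 < c :=
        ((eventually_mem_nhdsWithin (s := I₁ ∩ Iio b) (a := b)).and
          (mem_nhdsWithin_of_mem_nhds (lt_mem_nhds hlt))).exists
      have h1 := h.skillCdf_lt_skillCdfLeft hc.1 hxc hc.2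
      have h2 := hL hne y.2 hxy.mem_right.2
      rw [← hye] at h2
      linarith [hxy.rank_right_le]
    · exact h.skill_ne hxy (he.trans hy.symm)
    · have hne := hx4 hlt
      obtain ⟨c, hc, hxc⟩ : ∃ c ∈ I₁ ∩ Ioi b, c < x.1 :=
        ((eventually_mem_nhdsWithin (s := I₁ ∩ Ioi b) (a := b)).and
          (mem_nhdsWithin_of_mem_nhds (gt_mem_nhds hlt))).exists
      have h1 := h.skillCdf_lt_skillCdfLeft hc.1 hc.2 hxc
      have h2 := hR hne y.2 hxy.mem_right.2
      rw [← hye] at h2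
      linarith [hxy.le_rank_right]
  -- No atom at `b`: types near `(b, t₀)` have other skills, so skills accumulate at `b` from some
  -- side and the limit ranks decide the case.
  · have hnull : ∀ᵐ x : ℝ × ℝ ∂H, x.1 ≠ b := by
      have hm : MeasurableSet {x : ℝ × ℝ | x.1 = b} := measurable_fst (measurableSet_singleton b)
      have h1 := measureReal_union (μ := H) (s₁ := {x : ℝ × ℝ | x.1 < b})
        (s₂ := {x | x.1 = b}) (disjoint_left.2 fun x (hx : x.1 < b) (hx' : x.1 = b) => hx.ne hx') hm
      have h2 : {x : ℝ × ℝ | x.1 < b} ∪ {x | x.1 = b} = {x | x.1 ≤ b} := by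
        ext x; exact (le_iff_lt_or_eq (a := x.1)).symm
      rw [h2] at h1
      have h3 : skillCdf H b = skillCdfLeft H b + H.real {x | x.1 = b} := h1
      refine (measure_eq_zero_iff_ae_notMem (s := {x : ℝ × ℝ | x.1 = b})).1 ?_
      rw [← measureReal_eq_zero_iff]
      linarith
    obtain ⟨x, ⟨hx1, hx2⟩, hx3⟩ := h.ranked.full.exists_of_eventually (x := (b, t₀)) ⟨hb, ht₀⟩
      ((hnbL t₀).and (hnbR t₀)) hnull
    rcases hx3.lt_or_gt with hlt | hlt
    · exact hnA fun t ht => hatom.ge.trans (hL (hx1 hlt) t ht)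
    · exact hnB fun t ht => (hR (hx2 hlt) t ht).trans hatom.ge

end IsImproved

end

/-! ### Skills below and above the median -/

section

open Filter Topology

variable {I₁ I₂ : Set ℝ} {H : Measure (ℝ × ℝ)} {F : ℝ → ℝ → ℝ}

section skills

variable [IsProbabilityMeasure H]

lemma tendsto_skillCdf_atTop : Tendsto (skillCdf H) atTop (𝓝 1) := by
  have : skillCdf H = cdf H.fst := funext skillCdf_eq_cdf
  rw [this]
  exact tendsto_cdf_atTop _

lemma tendsto_skillCdf_atBot : Tendsto (skillCdf H) atBot (𝓝 0) := by
  have : skillCdf H = cdf H.fst := funext skillCdf_eq_cdf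
  rw [this]
  exact tendsto_cdf_atBot _

lemma real_skill_ge (b : ℝ) : H.real {x | b ≤ x.1} = 1 - skillCdfLeft H b := by
  have : {x : ℝ × ℝ | b ≤ x.1} = {x | x.1 < b}ᶜ := by ext x; exact (not_lt (a := x.1)).symm
  rw [this, probReal_compl_eq_one_sub (s := {x : ℝ × ℝ | x.1 < b})
    (measurable_fst measurableSet_Iio)]
  rfl

lemma real_skill_gt (b : ℝ) : H.real {x | b < x.1} = 1 - skillCdf H b := by
  have : {x : ℝ × ℝ | b < x.1} = {x | x.1 ≤ b}ᶜ := by ext x; exact (not_le (a := x.1)).symm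
  rw [this, probReal_compl_eq_one_sub (s := {x : ℝ × ℝ | x.1 ≤ b})
    (measurable_fst measurableSet_Iic)]
  rfl

/-- `S` lies in a lower half-line of skills, open or closed at the supremum of the sublevel set
according to whether the bound holds there. -/
lemma real_le_of_skillCdf_le {S : Set (ℝ × ℝ)} {m : ℝ} (hm : 0 ≤ m)
    (hS : ∀ x ∈ S, skillCdf H x.1 ≤ m) : H.real S ≤ m := by
  rcases S.eq_empty_or_nonempty with rfl | ⟨x₀, hx₀⟩
  · simpa using hm
  set A := {b | skillCdf H b ≤ m} with hA
  by_cases hbdd : BddAbove A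
  · by_cases hs : skillCdf H (sSup A) ≤ m
    · exact (measureReal_mono (s₂ := {x : ℝ × ℝ | x.1 ≤ sSup A})
        fun x hx => le_csSup hbdd (hS x hx)).trans hs
    · have hsub : S ⊆ {x | x.1 < sSup A} := fun x hx =>
        lt_of_le_of_ne (le_csSup hbdd (hS x hx)) fun he => hs (he ▸ hS x hx)
      refine (measureReal_mono hsub).trans (skillCdfLeft_le_of_forall_lt fun t ht => ?_)
      obtain ⟨a, ha, hta⟩ := exists_lt_of_lt_csSup (s := A) ⟨_, hS x₀ hx₀⟩ ht
      exact (skillCdf_mono hta.le).trans ha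
  · refine measureReal_le_one.trans (le_of_tendsto (tendsto_skillCdf_atTop (H := H)) ?_)
    refine Eventually.of_forall fun b => ?_
    obtain ⟨a, ha, hba⟩ := not_bddAbove_iff.1 hbdd b
    exact (skillCdf_mono hba.le).trans ha

lemma real_le_of_le_skillCdfLeft {S : Set (ℝ × ℝ)} {m : ℝ} (hm : 0 ≤ m)
    (hS : ∀ x ∈ S, 1 - m ≤ skillCdfLeft H x.1) : H.real S ≤ m := by
  rcases S.eq_empty_or_nonempty with rfl | ⟨x₀, hx₀⟩
  · simpa using hm
  set A := {b | 1 - m ≤ skillCdfLeft H b} with hA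
  by_cases hbdd : BddBelow A
  · by_cases hs : 1 - m ≤ skillCdfLeft H (sInf A)
    · have h1 := measureReal_mono (μ := H) (s₁ := S) (s₂ := {x | sInf A ≤ x.1})
        fun x hx => csInf_le hbdd (hS x hx)
      rw [real_skill_ge] at h1
      linarith
    · have hsub : S ⊆ {x | sInf A < x.1} := fun x hx =>
        lt_of_le_of_ne (csInf_le hbdd (hS x hx)) fun he => hs (he ▸ hS x hx)
      have h1 := measureReal_mono (μ := H) hsub
      rw [real_skill_gt] at h1
      have h2 : 1 - m ≤ skillCdf H (sInf A) := le_skillCdf_of_forall_gt fun t ht => by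
        obtain ⟨a, ha, hta⟩ := exists_lt_of_csInf_lt (s := A) ⟨_, hS x₀ hx₀⟩ ht
        exact le_trans ha ((skillCdfLeft_le_skillCdf a).trans (skillCdf_mono hta.le))
      linarith
  · have h1 : 1 - m ≤ 0 := by
      refine ge_of_tendsto (tendsto_skillCdf_atBot (H := H)) (Eventually.of_forall fun b => ?_)
      obtain ⟨a, ha, hba⟩ := not_bddBelow_iff.1 hbdd b
      exact le_trans ha ((skillCdfLeft_le_skillCdf a).trans (skillCdf_mono hba.le))
    linarith [measureReal_le_one (μ := H) (s := S)]

end skills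

namespace IsImproved

variable [IsProbabilityMeasure H] {k₁ k₂ : ℝ} {μ μB : ℝ × ℝ → ℝ × ℝ} {u : ℝ × ℝ → ℝ} {uB : ℝ → ℝ}
  (h : IsImproved I₁ I₂ H F k₁ k₂ μ u μB uB)
include h

/-- Ranks fall with skill, so almost all workers of skill at most `a` have ranks above `v`; uniform
ranks give these mass `1 - v`. -/
lemma skillCdf_add_le_one {a v : ℝ} (ha : a ∈ I₁) (hv0 : 0 ≤ v) (hv1 : v ≤ 1)
    (hv : ∀ t ∈ I₂, v ≤ gainRank H F k₂ k₁ (a, t)) : skillCdf H a + v ≤ 1 := by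
  have h1 : skillCdf H a ≤ H.real {x | v < gainRank H F k₂ k₁ x} := by
    refine ENNReal.toReal_mono (measure_ne_top _ _) (measure_mono_ae ?_)
    filter_upwards [h.ranked.pop.ae_mem, h.ranked.ae_rank_ne v] with x hx hne hxa
    exact lt_of_le_of_ne ((hv _ hx.2).trans (h.rank_le_of_skill_le hx.1 ha hx.2 hxa)) hne.symm
  rw [h.ranked.real_lt_rank_eq hv0 hv1] at h1
  linarith

lemma one_le_skillCdfLeft_add {b v : ℝ} (hb : b ∈ I₁) (hv0 : 0 ≤ v) (hv1 : v ≤ 1)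
    (hv : ∀ t ∈ I₂, gainRank H F k₂ k₁ (b, t) ≤ v) : 1 ≤ skillCdfLeft H b + v := by
  have h1 : H.real {x | b ≤ x.1} ≤ H.real {x | gainRank H F k₂ k₁ x ≤ v} := by
    refine ENNReal.toReal_mono (measure_ne_top _ _) (measure_mono_ae ?_)
    filter_upwards [h.ranked.pop.ae_mem] with x hx hxb
    exact (h.rank_le_of_skill_le hb hx.1 hx.2 hxb).trans (hv _ hx.2)
  rw [h.ranked.real_rank_le_eq hv0 hv1, real_skill_ge] at h1
  linarith

lemma skillCdf_le_half {b : ℝ} (hb : b ∈ I₁) (hA : RanksAbove I₂ H F k₁ k₂ b) :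
    skillCdf H b ≤ 1 / 2 := by
  linarith [h.skillCdf_add_le_one hb (skillCdf_nonneg b) (skillCdf_le_one b) hA]

lemma half_le_skillCdfLeft {b : ℝ} (hb : b ∈ I₁) (hB : RanksBelow I₂ H F k₁ k₂ b) :
    1 / 2 ≤ skillCdfLeft H b := by
  linarith [h.one_le_skillCdfLeft_add hb (skillCdfLeft_nonneg b) (skillCdfLeft_le_one b) hB]

lemma ranksAbove_of_lt_half {b : ℝ} (hb : b ∈ I₁) (hlt : skillCdfLeft H b < 1 / 2) :
    RanksAbove I₂ H F k₁ k₂ b :=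
  (h.ranksAbove_or_below hb).resolve_right fun hB => (h.half_le_skillCdfLeft hb hB).not_gt hlt

lemma ranksBelow_of_half_lt {b : ℝ} (hb : b ∈ I₁) (hlt : 1 / 2 < skillCdf H b) :
    RanksBelow I₂ H F k₁ k₂ b :=
  (h.ranksAbove_or_below hb).resolve_left fun hA => (h.skillCdf_le_half hb hA).not_gt hlt

/-- The skills with left limit below one half carry at least half of the population, so a bound on
their distribution function is at least one half. -/
lemma half_le_of_forall_low {m : ℝ}
    (hm : ∀ b ∈ I₁, skillCdfLeft H b < 1 / 2 → skillCdf H b ≤ m) : 1 / 2 ≤ m := by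
  have h1 : H.real {x | x ∈ I₁ ×ˢ I₂ ∧ skillCdfLeft H x.1 < 1 / 2} ≤ max m 0 :=
    real_le_of_skillCdf_le (le_max_right _ _) fun x hx =>
      (hm x.1 hx.1.1 hx.2).trans (le_max_left _ _)
  have h2 : H.real {x | 1 / 2 ≤ skillCdfLeft H x.1} ≤ 1 / 2 :=
    real_le_of_le_skillCdfLeft (by norm_num) fun x hx => by
      have : 1 / 2 ≤ skillCdfLeft H x.1 := hx
      linarith
  have h3 : (1 : ℝ) ≤ H.real {x | x ∈ I₁ ×ˢ I₂ ∧ skillCdfLeft H x.1 < 1 / 2} +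
      H.real {x | 1 / 2 ≤ skillCdfLeft H x.1} := by
    refine le_trans ?_ (measureReal_union_le _ _)
    refine (probReal_univ (μ := H)).ge.trans ?_
    refine ENNReal.toReal_mono (measure_ne_top _ _) (measure_mono_ae ?_)
    filter_upwards [h.ranked.pop.ae_mem] with x hx _
    exact (lt_or_ge (skillCdfLeft H x.1) (1 / 2)).imp (fun hlt => ⟨hx, hlt⟩) id
  rcases le_max_iff.1 (show 1 / 2 ≤ max m 0 by linarith) with h4 | h4
  · exact h4
  · norm_num at h4

lemma le_half_of_forall_high {m : ℝ}
    (hm : ∀ b ∈ I₁, 1 / 2 < skillCdf H b → m ≤ skillCdfLeft H b) : m ≤ 1 / 2 := by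
  have h1 : H.real {x | x ∈ I₁ ×ˢ I₂ ∧ 1 / 2 < skillCdf H x.1} ≤ max (1 - m) 0 :=
    real_le_of_le_skillCdfLeft (le_max_right _ _) fun x hx => by
      linarith [hm x.1 hx.1.1 hx.2, le_max_left (1 - m) 0]
  have h2 : H.real {x | skillCdf H x.1 ≤ 1 / 2} ≤ 1 / 2 :=
    real_le_of_skillCdf_le (by norm_num) fun x hx => hx
  have h3 : (1 : ℝ) ≤ H.real {x | x ∈ I₁ ×ˢ I₂ ∧ 1 / 2 < skillCdf H x.1} +
      H.real {x | skillCdf H x.1 ≤ 1 / 2} := by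
    refine le_trans ?_ (measureReal_union_le _ _)
    refine (probReal_univ (μ := H)).ge.trans ?_
    refine ENNReal.toReal_mono (measure_ne_top _ _) (measure_mono_ae ?_)
    filter_upwards [h.ranked.pop.ae_mem] with x hx _
    exact (lt_or_ge (1 / 2) (skillCdf H x.1)).imp (fun hlt => ⟨hx, hlt⟩) id
  rcases le_max_iff.1 (show 1 / 2 ≤ max (1 - m) 0 by linarith) with h4 | h4
  · linarith
  · norm_num at h4

lemma exists_low : ∃ b ∈ I₁, skillCdfLeft H b < 1 / 2 := by
  by_contra! hc
  have := h.half_le_of_forall_low (m := 0) fun b hb hlt => absurd hlt (hc b hb).not_gt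
  norm_num at this

lemma exists_high : ∃ b ∈ I₁, 1 / 2 < skillCdf H b := by
  by_contra! hc
  have := h.le_half_of_forall_high (m := 1) fun b hb hlt => absurd hlt (hc b hb).not_gt
  norm_num at this

lemma lt_of_low_of_high {a b : ℝ} (ha : a ∈ I₁) (hlo : skillCdfLeft H a < 1 / 2)
    (hhi : 1 / 2 < skillCdf H b) : a < b := by
  by_contra! hle
  linarith [skillCdf_mono (H := H) hle, h.skillCdf_le_half ha (h.ranksAbove_of_lt_half ha hlo)]

/-- The rank bounds `skillCdf H c` for every low skill `c`: through the ranks at `c` if `c ≥ b`,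
through those at `b` otherwise. -/
lemma half_le_rank_of_low {b t : ℝ} (hb : b ∈ I₁) (hlt : skillCdfLeft H b < 1 / 2) (ht : t ∈ I₂) :
    1 / 2 ≤ gainRank H F k₂ k₁ (b, t) := by
  refine h.half_le_of_forall_low fun c hc hcl => ?_
  rcases le_total b c with hbc | hbc
  · exact (h.ranksAbove_of_lt_half hc hcl t ht).trans (h.rank_le_of_skill_le hb hc ht hbc)
  · exact (skillCdf_mono hbc).trans (h.ranksAbove_of_lt_half hb hlt t ht)

lemma rank_le_half_of_high {b t : ℝ} (hb : b ∈ I₁) (hlt : 1 / 2 < skillCdf H b) (ht : t ∈ I₂) :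
    gainRank H F k₂ k₁ (b, t) ≤ 1 / 2 := by
  refine h.le_half_of_forall_high fun c hc hcl => ?_
  rcases le_total c b with hbc | hbc
  · exact (h.rank_le_of_skill_le hc hb ht hbc).trans (h.ranksBelow_of_half_lt hc hcl t ht)
  · exact (h.ranksBelow_of_half_lt hb hlt t ht).trans (skillCdfLeft_mono hbc)

lemma output_gain_pos {c : ℝ} (hc : c ∈ I₁) : 0 < F c k₂ - F c k₁ :=
  sub_pos.2 (h.ranked.prod.lt_right hc h.ranked.mem_left h.ranked.mem_right h.ranked.lt)

lemma output_gain_lt {c c' : ℝ} (hc : c ∈ I₁) (hc' : c' ∈ I₁) (hlt : c < c') :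
    F c' k₂ - F c' k₁ < F c k₂ - F c k₁ := by
  linarith [h.submodular c hc c' hc' k₁ h.ranked.mem_left k₂ h.ranked.mem_right hlt h.ranked.lt]

/-- Less able workers with weak relative concerns have ranks bounded away from one half. -/
lemma exists_rank_gap_low {s t : ℝ} (hs : s ∈ I₂) (ht : t ∈ I₂) (hst : s < t) :
    ∃ ε > 0, ∀ y ∈ I₁ ×ˢ I₂, skillCdfLeft H y.1 < 1 / 2 → y.2 ≤ s →
      1 / 2 + ε ≤ gainRank H F k₂ k₁ y := by
  obtain ⟨a, ha, hal⟩ := h.exists_low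
  obtain ⟨b, hb, hbh⟩ := h.exists_high
  set r := (s + t) / 2 with hr
  have hrI : r ∈ I₂ := h.ranked.ord.out hs ht ⟨by linarith, by linarith⟩
  -- Output gains of low skills are bounded below by that of a high skill, so their infimum is
  -- positive. A skill `c` nearly attaining it, with the intermediate preference `r`, has a smaller
  -- gain than every `y` in question but still a rank above one half.
  set L := (fun c => F c k₂ - F c k₁) '' {c ∈ I₁ | skillCdfLeft H c < 1 / 2} with hL
  have hLb : ∀ l ∈ L, F b k₂ - F b k₁ ≤ l := by
    rintro _ ⟨c, ⟨hc, hcl⟩, rfl⟩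
    exact (h.output_gain_lt hc hb (h.lt_of_low_of_high hc hcl hbh)).le
  have hLne : L.Nonempty := ⟨_, a, ⟨ha, hal⟩, rfl⟩
  have hbdd : BddBelow L := ⟨_, hLb⟩
  have hpos : 0 < sInf L := (h.output_gain_pos hb).trans_le (le_csInf hLne hLb)
  have hws : wt (b, r) < wt (b, s) := (h.ranked.wt_lt_iff ⟨hb, hrI⟩ ⟨hb, hs⟩).2 (by
    show s < r
    linarith)
  have hwr : 0 < wt (b, r) := h.ranked.wt_pos ⟨hb, hrI⟩
  obtain ⟨_, ⟨c, ⟨hc, hcl⟩, rfl⟩, hlt⟩ := exists_lt_of_csInf_lt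
    (b := sInf L * wt (b, s) / wt (b, r))
    hLne (by
      rw [lt_div_iff₀ hwr]
      exact mul_lt_mul_of_pos_left hws hpos)
  rw [lt_div_iff₀ hwr] at hlt
  have h1 := h.ranked.rank_lt_of_pref_lt hc hrI ht (show r < t by linarith)
  have h2 := h.half_le_rank_of_low hc hcl ht
  refine ⟨gainRank H F k₂ k₁ (c, r) - 1 / 2, by linarith, fun y hy hyl hys => ?_⟩
  have h3 : gainRank H F k₂ k₁ (c, r) ≤ gainRank H F k₂ k₁ y := by
    refine h.ranked.rank_le_of_gain_le h.ranked.mem_right h.ranked.mem_left h.ranked.lt ⟨hc, hrI⟩ hy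
      ?_
    rw [gain_eq, gain_eq]
    have h4 : wt (b, s) ≤ wt y := by
      by_contra! hcon
      exact ((h.ranked.wt_lt_iff hy (x := y) (z := (b, s)) ⟨hb, hs⟩).1 hcon).not_ge hys
    have h5 : sInf L ≤ F y.1 k₂ - F y.1 k₁ := csInf_le hbdd ⟨y.1, ⟨hy.1, hyl⟩, rfl⟩
    have h6 : sInf L * wt (b, s) ≤ (F y.1 k₂ - F y.1 k₁) * wt y :=
      mul_le_mul h5 h4 (hwr.trans hws).le (hpos.le.trans h5)
    exact hlt.le.trans h6
  linarith

/-- More able workers with strong relative concerns have ranks bounded away from one half. -/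
lemma exists_rank_gap_high {s t : ℝ} (hs : s ∈ I₂) (ht : t ∈ I₂) (hst : s < t) :
    ∃ ε > 0, ∀ y ∈ I₁ ×ˢ I₂, 1 / 2 < skillCdf H y.1 → t ≤ y.2 →
      gainRank H F k₂ k₁ y ≤ 1 / 2 - ε := by
  obtain ⟨a, ha, hal⟩ := h.exists_low
  obtain ⟨b, hb, hbh⟩ := h.exists_high
  set r := (s + t) / 2 with hr
  have hrI : r ∈ I₂ := h.ranked.ord.out hs ht ⟨by linarith, by linarith⟩
  set L := (fun c => F c k₂ - F c k₁) '' {c ∈ I₁ | 1 / 2 < skillCdf H c} with hL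
  have hLb : ∀ l ∈ L, l ≤ F a k₂ - F a k₁ := by
    rintro _ ⟨c, ⟨hc, hcl⟩, rfl⟩
    exact (h.output_gain_lt ha hc (h.lt_of_low_of_high ha hal hcl)).le
  have hLne : L.Nonempty := ⟨_, b, ⟨hb, hbh⟩, rfl⟩
  have hbdd : BddAbove L := ⟨_, hLb⟩
  have hpos : 0 < sSup L := (h.output_gain_pos hb).trans_le (le_csSup hbdd ⟨b, ⟨hb, hbh⟩, rfl⟩)
  have hwt : wt (b, t) < wt (b, r) := (h.ranked.wt_lt_iff ⟨hb, ht⟩ ⟨hb, hrI⟩).2 (by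
    show r < t
    linarith)
  have hwr : 0 < wt (b, r) := h.ranked.wt_pos ⟨hb, hrI⟩
  have hwt0 : 0 < wt (b, t) := h.ranked.wt_pos ⟨hb, ht⟩
  obtain ⟨_, ⟨c, ⟨hc, hcl⟩, rfl⟩, hlt⟩ := exists_lt_of_lt_csSup
    (b := sSup L * wt (b, t) / wt (b, r))
    hLne (by
      rw [div_lt_iff₀ hwr]
      exact mul_lt_mul_of_pos_left hwt hpos)
  rw [div_lt_iff₀ hwr] at hlt
  have h1 := h.ranked.rank_lt_of_pref_lt hc hs hrI (show s < r by linarith)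
  have h2 := h.rank_le_half_of_high hc hcl hs
  refine ⟨1 / 2 - gainRank H F k₂ k₁ (c, r), by linarith, fun y hy hyl hys => ?_⟩
  have h3 : gainRank H F k₂ k₁ y ≤ gainRank H F k₂ k₁ (c, r) := by
    refine h.ranked.rank_le_of_gain_le h.ranked.mem_right h.ranked.mem_left h.ranked.lt hy ⟨hc, hrI⟩
      ?_
    rw [gain_eq, gain_eq]
    have h4 : wt y ≤ wt (b, t) := by
      by_contra! hcon
      exact ((h.ranked.wt_lt_iff (x := (b, t)) (z := y) ⟨hb, ht⟩ hy).1 hcon).not_ge hys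
    have h5 : F y.1 k₂ - F y.1 k₁ ≤ sSup L := le_csSup hbdd ⟨y.1, ⟨hy.1, hyl⟩, rfl⟩
    have h6 : (F y.1 k₂ - F y.1 k₁) * wt y ≤ sSup L * wt (b, t) :=
      mul_le_mul h5 h4 (h.ranked.wt_pos hy).le hpos.le
    exact h6.trans hlt.le
  linarith

/-- The distribution function of skills jumps above one half. -/
lemma exists_skillCdf_gap_high : ∃ ε > 0, ∀ c ∈ I₁, 1 / 2 < skillCdf H c →
    1 / 2 + ε ≤ skillCdf H c := by
  by_contra! hcon
  obtain ⟨s, hs, t, ht, hst⟩ := h.exists_pref_lt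
  set r := (s + t) / 2 with hr
  have hrI : r ∈ I₂ := h.ranked.ord.out hs ht ⟨by linarith, by linarith⟩
  obtain ⟨ε, hε, hgap⟩ := h.exists_rank_gap_low hrI ht (show r < t by linarith)
  -- Three skills just above the median, so that the middle one has a neighbourhood inside. A weakly
  -- concerned worker there has a low partner with even weaker concerns, whose rank is at least `1 /
  -- 2 + ε` yet at most `skillCdf H c₂`.
  obtain ⟨c₂, hc₂, hc₂h, hc₂ε⟩ := hcon ε hε
  obtain ⟨c₁, hc₁, hc₁h, hc₁ε⟩ := hcon _ (sub_pos.2 hc₂h)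
  obtain ⟨c₀, hc₀, hc₀h, hc₀ε⟩ := hcon _ (sub_pos.2 hc₁h)
  have h01 : c₀ < c₁ := by
    by_contra! hle
    linarith [skillCdf_mono (H := H) hle]
  have h12 : c₁ < c₂ := by
    by_contra! hle
    linarith [skillCdf_mono (H := H) hle]
  set q := (s + r) / 2 with hq
  have hqI : q ∈ I₂ := h.ranked.ord.out hs hrI ⟨by linarith, by linarith⟩
  obtain ⟨x, y, ⟨⟨hx1, hx2⟩, hx3⟩, hxy⟩ := h.exists_isBetterPair (x := (c₁, q)) ⟨hc₁, hqI⟩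
    (p := fun x => x.1 ∈ Ioo c₀ c₂ ∧ x.2 < r)
    (mem_nhdsWithin_of_mem_nhds ((continuous_fst.continuousAt.eventually
      (Ioo_mem_nhds h01 h12)).and (continuous_snd.continuousAt.eventually
        (gt_mem_nhds (show q < r by linarith)))))
  have hxh : 1 / 2 < skillCdf H x.1 := hc₀h.trans_le (skillCdf_mono hx1.le)
  have hxr : gainRank H F k₂ k₁ x < 1 / 2 := lt_of_le_of_ne
    (h.rank_le_half_of_high hxy.mem_left.1 hxh hxy.mem_left.2) hxy.rank_left_ne
  have hyl : skillCdfLeft H y.1 < 1 / 2 := hxy.le_rank_left.trans_lt hxr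
  have hlt := h.lt_of_low_of_high hxy.mem_right.1 hyl hxh
  have hpref := h.pref_lt_of_skill_lt (hxy.symm h.ranked.prod) hlt
  have h1 := hgap y hxy.mem_right hyl (hpref.trans hx3).le
  linarith [hxy.rank_right_le, skillCdf_mono (H := H) hx2.le]

/-- The distribution function of skills jumps below one half. -/
lemma exists_skillCdf_gap_low : ∃ ε > 0, ∀ c ∈ I₁, skillCdfLeft H c < 1 / 2 →
    skillCdfLeft H c ≤ 1 / 2 - ε := by
  by_contra! hcon
  obtain ⟨s, hs, t, ht, hst⟩ := h.exists_pref_lt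
  set r := (s + t) / 2 with hr
  have hrI : r ∈ I₂ := h.ranked.ord.out hs ht ⟨by linarith, by linarith⟩
  obtain ⟨ε, hε, hgap⟩ := h.exists_rank_gap_high hs hrI (show s < r by linarith)
  obtain ⟨c₀, hc₀, hc₀h, hc₀ε⟩ := hcon ε hε
  obtain ⟨c₁, hc₁, hc₁h, hc₁ε⟩ := hcon _ (sub_pos.2 hc₀h)
  obtain ⟨c₂, hc₂, hc₂h, hc₂ε⟩ := hcon _ (sub_pos.2 hc₁h)
  have h01 : c₀ < c₁ := by
    by_contra! hle
    linarith [skillCdfLeft_mono (H := H) hle]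
  have h12 : c₁ < c₂ := by
    by_contra! hle
    linarith [skillCdfLeft_mono (H := H) hle]
  set q := (r + t) / 2 with hq
  have hqI : q ∈ I₂ := h.ranked.ord.out hrI ht ⟨by linarith, by linarith⟩
  obtain ⟨x, y, ⟨⟨hx1, hx2⟩, hx3⟩, hxy⟩ := h.exists_isBetterPair (x := (c₁, q)) ⟨hc₁, hqI⟩
    (p := fun x => x.1 ∈ Ioo c₀ c₂ ∧ r < x.2)
    (mem_nhdsWithin_of_mem_nhds ((continuous_fst.continuousAt.eventually
      (Ioo_mem_nhds h01 h12)).and (continuous_snd.continuousAt.eventually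
        (lt_mem_nhds (show r < q by linarith)))))
  have hxl : skillCdfLeft H x.1 < 1 / 2 := (skillCdfLeft_mono hx2.le).trans_lt hc₂h
  have hxr : 1 / 2 < gainRank H F k₂ k₁ x := lt_of_le_of_ne
    (h.half_le_rank_of_low hxy.mem_left.1 hxl hxy.mem_left.2) hxy.rank_left_ne.symm
  have hyh : 1 / 2 < skillCdf H y.1 := hxr.trans_le hxy.rank_left_le
  have hlt := h.lt_of_low_of_high hxy.mem_left.1 hxl hyh
  have hpref := h.pref_lt_of_skill_lt hxy hlt
  have h1 := hgap y hxy.mem_right hyh (hx3.trans hpref).le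
  linarith [hxy.le_rank_right, skillCdfLeft_mono (H := H) hx1.le]

end IsImproved

end

/-! ### Contradiction at the median -/

section

open Filter Topology

variable {I₁ I₂ : Set ℝ} {H : Measure (ℝ × ℝ)} {F : ℝ → ℝ → ℝ}

lemma tendsto_skill (b t : ℝ) :
    Tendsto (Prod.fst : ℝ × ℝ → ℝ) (𝓝[I₁ ×ˢ I₂] (b, t)) (𝓝[I₁] b) :=
  (continuous_fst.continuousWithinAt (x := (b, t))).tendsto_nhdsWithin fun _ hx => hx.1

lemma continuousOn_output_left_mul_wt (hF : IsProduction I₁ F)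
    (h2 : ∀ x₂ ∈ I₂, -(1 / 2 : ℝ) < x₂) {a m : ℝ} (hm : m ∈ I₁) :
    ContinuousOn (fun x : ℝ × ℝ => (F a m - F x.1 m) * wt x) (I₁ ×ˢ I₂) :=
  (continuousOn_const.sub ((hF.continuousOn_left hm).comp continuousOn_fst fun _ hx => hx.1)).mul
    (continuousOn_wt h2)

namespace IsImproved

variable [IsProbabilityMeasure H] {k₁ k₂ : ℝ} {μ μB : ℝ × ℝ → ℝ × ℝ} {u : ℝ × ℝ → ℝ} {uB : ℝ → ℝ}
  (h : IsImproved I₁ I₂ H F k₁ k₂ μ u μB uB)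
include h

/-- The most able of the less able workers. -/
lemma exists_greatest_low : ∃ a ∈ I₁, skillCdfLeft H a < 1 / 2 ∧ skillCdf H a = 1 / 2 := by
  obtain ⟨ε, hε, hgap⟩ := h.exists_skillCdf_gap_low
  obtain ⟨a, ha, hal, hmax⟩ : ∃ a ∈ I₁, skillCdfLeft H a < 1 / 2 ∧
      ∀ c ∈ I₁, skillCdfLeft H c < 1 / 2 → c ≤ a := by
    -- Without a greatest low skill, the gap below one half would pass from left limits to the
    -- distribution function itself.
    by_contra! hcon
    have := h.half_le_of_forall_low (m := 1 / 2 - ε) fun b hb hbl => by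
      obtain ⟨c, hc, hcl, hbc⟩ := hcon b hb hbl
      exact (skillCdf_le_skillCdfLeft hbc).trans (hgap c hc hcl)
    linarith
  exact ⟨a, ha, hal, le_antisymm (h.skillCdf_le_half ha (h.ranksAbove_of_lt_half ha hal))
    (h.half_le_of_forall_low fun b hb hbl => skillCdf_mono (hmax b hb hbl))⟩

/-- The least able of the more able workers. -/
lemma exists_least_high : ∃ b ∈ I₁, 1 / 2 < skillCdf H b ∧ skillCdfLeft H b = 1 / 2 := by
  obtain ⟨ε, hε, hgap⟩ := h.exists_skillCdf_gap_high
  obtain ⟨b, hb, hbl, hmin⟩ : ∃ b ∈ I₁, 1 / 2 < skillCdf H b ∧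
      ∀ c ∈ I₁, 1 / 2 < skillCdf H c → b ≤ c := by
    by_contra! hcon
    have := h.le_half_of_forall_high (m := 1 / 2 + ε) fun b hb hbl => by
      obtain ⟨c, hc, hcl, hbc⟩ := hcon b hb hbl
      exact (hgap c hc hcl).trans (skillCdf_le_skillCdfLeft hbc)
    linarith
  exact ⟨b, hb, hbl, le_antisymm
    (h.le_half_of_forall_high fun c hc hcl => skillCdfLeft_mono (hmin c hc hcl))
    (h.half_le_skillCdfLeft hb (h.ranksBelow_of_half_lt hb hbl))⟩

/-- The weights of partners have no a priori bound. A fixed type `w` of higher rank bounds their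
gains instead, and its own gain vanishes as the skill tends to `b`. -/
lemma exists_rank_dominating {b : ℝ} (t : ℝ) (hb : b ∈ I₁) : ∃ w ∈ I₁ ×ˢ I₂,
    ∀ᶠ z in 𝓝[I₁ ×ˢ I₂] (b, t), b < z.1 → skillCdf H z.1 < gainRank H F k₂ k₁ w := by
  by_cases hfr : ∃ᶠ c in 𝓝[I₁] b, b < c
  · obtain ⟨c₁, hc₁, hbc₁⟩ := (hfr.and_eventually self_mem_nhdsWithin).exists
    obtain ⟨c₀, hc₀, hcI, hcc⟩ := (hfr.and_eventually (eventually_mem_nhdsWithin.and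
      (mem_nhdsWithin_of_mem_nhds (gt_mem_nhds hc₁)))).exists
    have h1 : skillCdf H c₀ < 1 :=
      (h.skillCdf_lt_skillCdfLeft hbc₁ hcc (lt_add_one c₁)).trans_le (skillCdfLeft_le_one _)
    obtain ⟨w, hw, hwc, -⟩ := h.ranked.exists_rank_mem (skillCdf_nonneg c₀) h1 le_rfl
      h.ranked.pop.ae_mem
    refine ⟨w, hw, ?_⟩
    filter_upwards [(tendsto_skill b t).eventually (mem_nhdsWithin_of_mem_nhds (gt_mem_nhds hc₀))]
      with z hz _
    exact (skillCdf_mono hz.le).trans_lt hwc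
  · obtain ⟨t₀, ht₀⟩ := h.nonempty_pref
    refine ⟨(b, t₀), ⟨hb, ht₀⟩, ?_⟩
    filter_upwards [(tendsto_skill b t).eventually (not_frequently.1 hfr)] with z hz hlt
    exact absurd hlt hz

/-- It is impossible that almost all workers are better off than in the benchmark. -/
theorem false : False := by
  obtain ⟨ε₀, hε₀, hgap₀⟩ := h.exists_skillCdf_gap_low
  obtain ⟨ε₁, hε₁, hgap₁⟩ := h.exists_skillCdf_gap_high
  obtain ⟨a, ha, hal, haG⟩ := h.exists_greatest_low
  obtain ⟨b, hb, hbh, hbG⟩ := h.exists_least_high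
  have hab := h.lt_of_low_of_high ha hal hbh
  have hbetween : ∀ c ∈ I₁, a < c → b ≤ c := fun c hc hac => by
    by_contra! hcb
    linarith [h.skillCdf_lt_skillCdfLeft hc hac hcb]
  have ha₀ := hgap₀ a ha hal
  have hb₁ := hgap₁ b hb hbh
  have hF := h.ranked.prod
  have h2 := h.ranked.pop.pref_gt
  -- If all ranks at skill `a` were at least `1 / 2 + ε₁`, the workers up to `a`, half of the
  -- population, would not fit among those ranks.
  obtain ⟨tₐ, htₐ, hVa⟩ : ∃ t ∈ I₂, gainRank H F k₂ k₁ (a, t) < 1 / 2 + ε₁ := by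
    by_contra! hcon
    linarith [h.skillCdf_add_le_one ha (by linarith) (hb₁.trans (skillCdf_le_one b)) hcon]
  obtain ⟨tb, htb, hVb⟩ : ∃ t ∈ I₂, 1 / 2 - ε₀ < gainRank H F k₂ k₁ (b, t) := by
    by_contra! hcon
    linarith [h.one_le_skillCdfLeft_add hb ((skillCdfLeft_nonneg a).trans ha₀) (by linarith) hcon]
  obtain ⟨s, hs, t, ht, hst⟩ := h.exists_pref_lt
  -- Ranks fall with the preference, so the preference at `a` may be raised to `t`, and below the
  -- one at `b` lowered to `s`; this orders the weights.
  obtain ⟨tx, htx, htxt, hVx⟩ : ∃ r ∈ I₂, t ≤ r ∧ gainRank H F k₂ k₁ (a, r) < 1 / 2 + ε₁ := by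
    rcases le_or_gt t tₐ with hle | hlt
    · exact ⟨tₐ, htₐ, hle, hVa⟩
    · exact ⟨t, ht, le_rfl, (h.ranked.rank_lt_of_pref_lt ha htₐ ht hlt).trans hVa⟩
  obtain ⟨tz, htz, htzs, hVz⟩ : ∃ r ∈ I₂, r ≤ s ∧ 1 / 2 - ε₀ < gainRank H F k₂ k₁ (b, r) := by
    rcases le_or_gt tb s with hle | hlt
    · exact ⟨tb, htb, hle, hVb⟩
    · exact ⟨s, hs, le_rfl, hVb.trans (h.ranked.rank_lt_of_pref_lt hb hs htb hlt)⟩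
  have hx₀ : (a, tx) ∈ I₁ ×ˢ I₂ := ⟨ha, htx⟩
  have hz₀ : (b, tz) ∈ I₁ ×ˢ I₂ := ⟨hb, htz⟩
  have hγ : wt (a, tx) < wt (b, tz) := (h.ranked.wt_lt_iff hx₀ hz₀).2 (by
    show tz < tx
    linarith)
  set γ := wt (b, tz) - wt (a, tx) with hγe
  have huab := h.benchmark_strictMonoOn ha hb hab
  -- A lower bound for `(wt z - wt x) (uB b - uB a) / 2` once each weight is within `γ / 4` of its
  -- limit. The approximation errors in the final sum stay below `κ`.
  set κ := γ / 2 * (uB b - uB a) / 2 with hκ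
  have hγ0 : 0 < γ := sub_pos.2 hγ
  have hκ0 : 0 < κ := by
    have := sub_pos.2 huab
    positivity
  obtain ⟨m, hm, hme⟩ := h.exists_benchmark_partner ha
  obtain ⟨w, hw, hwz⟩ := h.exists_rank_dominating tz hb
  -- a worker close to `(a, tx)` has a partner of skill `b`
  obtain ⟨x, x', ⟨hx1, hx2, hx3, hx4⟩, hxx⟩ := h.exists_isBetterPair hx₀
    (((h.ranked.continuousOn_rank _ hx₀).eventually (gt_mem_nhds hVx)).and
      (((tendsto_skill a tx).eventually (mem_nhdsWithin_of_mem_nhds (gt_mem_nhds hab))).and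
        (((continuousOn_wt h2 _ hx₀).eventually (gt_mem_nhds
          (show wt (a, tx) < wt (a, tx) + γ / 4 by
          linarith))).and
          ((continuousOn_output_left_mul_wt hF h2 (a := a) hm _ hx₀).eventually
            (gt_mem_nhds (show (F a m - F a m) * wt (a, tx) < κ / 2 by
              rw [sub_self, zero_mul]; linarith))))))
  have hxa : x.1 ≤ a := by
    by_contra! hlt
    exact hx2.not_ge (hbetween _ hxx.mem_left.1 hlt)
  have hxl : skillCdfLeft H x.1 < 1 / 2 := (skillCdfLeft_mono hxa).trans_lt hal
  have hxV : 1 / 2 < gainRank H F k₂ k₁ x := lt_of_le_of_ne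
    (h.half_le_rank_of_low hxx.mem_left.1 hxl hxx.mem_left.2) hxx.rank_left_ne.symm
  have hx'h : 1 / 2 < skillCdf H x'.1 := hxV.trans_le hxx.rank_left_le
  have hx'b : x'.1 = b := by
    refine le_antisymm ?_ (hbetween _ hxx.mem_right.1 (h.lt_of_low_of_high ha hal hx'h))
    by_contra! hlt
    linarith [skillCdf_le_skillCdfLeft (H := H) hlt, hxx.le_rank_left]
  -- a worker close to `(b, tz)` has a partner of skill `a`
  have hc₁ : ContinuousOn (fun z : ℝ × ℝ => (F a z.1 - F a b) * wt z) (I₁ ×ˢ I₂) :=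
    (((hF.continuousOn_right ha).comp continuousOn_fst fun _ hx => hx.1).sub
      continuousOn_const).mul (continuousOn_wt h2)
  have hc₂ : ContinuousOn (fun z : ℝ × ℝ => (F w.1 z.1 - F w.1 b) * wt w) (I₁ ×ˢ I₂) :=
    (((hF.continuousOn_right hw.1).comp continuousOn_fst fun _ hx => hx.1).sub
      continuousOn_const).mul continuousOn_const
  obtain ⟨z, z', ⟨hz1, hz2, hz3, hz4, hz5, hz6⟩, hzz⟩ := h.exists_isBetterPair hz₀
    (((h.ranked.continuousOn_rank _ hz₀).eventually (lt_mem_nhds hVz)).and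
      (((tendsto_skill b tz).eventually (mem_nhdsWithin_of_mem_nhds (lt_mem_nhds hab))).and
        (((continuousOn_wt h2 _ hz₀).eventually (lt_mem_nhds
          (show wt (b, tz) - γ / 4 < wt (b, tz) by
          linarith))).and
          (((hc₁ _ hz₀).eventually
            (gt_mem_nhds (show (F a b - F a b) * wt (b, tz) < κ / 2 by
              rw [sub_self, zero_mul]; linarith))).and
            (((hc₂ _ hz₀).eventually
              (gt_mem_nhds (show (F w.1 b - F w.1 b) * wt w < κ / 2 by
              rw [sub_self, zero_mul]; linarith))).and
              hwz)))))
  have hzb : b ≤ z.1 := hbetween _ hzz.mem_left.1 hz2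
  have hzh : 1 / 2 < skillCdf H z.1 := hbh.trans_le (skillCdf_mono hzb)
  have hzV : gainRank H F k₂ k₁ z < 1 / 2 := lt_of_le_of_ne
    (h.rank_le_half_of_high hzz.mem_left.1 hzh hzz.mem_left.2) hzz.rank_left_ne
  have hz'l : skillCdfLeft H z'.1 < 1 / 2 := hzz.le_rank_left.trans_lt hzV
  have hz'a : z'.1 = a := by
    refine le_antisymm ?_ ?_
    · by_contra! hlt
      exact (h.lt_of_low_of_high hzz.mem_right.1 hz'l hbh).not_ge
        (hbetween _ hzz.mem_right.1 hlt)
    · by_contra! hlt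
      linarith [skillCdf_le_skillCdfLeft (H := H) hlt, hzz.rank_left_le]
  -- The partner `z'` has rank at most `skillCdf H z.1`, below that of `w`, so its gain is below the
  -- small gain of `w`.
  have hR : (F a z.1 - F a b) * wt z' < κ / 2 := by
    rcases hzb.eq_or_lt with he | hlt
    · rw [← he, sub_self, zero_mul]
      linarith
    · have h1 := h.ranked.gain_lt_of_rank_lt hzz.mem_left.1 hb hlt hzz.mem_right hw
        (hzz.rank_right_le.trans_lt (hz6 hlt))
      rw [gain_eq, gain_eq, hz'a] at h1
      exact h1.trans hz5
  -- the four workers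
  have e1 := hxx.surplus
  have e2 := hzz.surplus
  -- The partners `x'` and `z'` do not block. Adding the two team surpluses and subtracting this
  -- leaves the payoffs of `x` and `z` alone, at most `F a b (wt x + wt z) / 2` up to errors.
  have e3 := h.eqm.surplus_le h2 hzz.mem_right hxx.mem_right
  rw [hx'b] at e1 e3
  rw [hz'a] at e2 e3
  rw [hF.symm _ hzz.mem_left.1 _ ha] at e2
  have hwx := h.ranked.wt_pos hxx.mem_left
  have hwx' := h.ranked.wt_pos hxx.mem_right
  have hwz' := h.ranked.wt_pos hzz.mem_left
  have e4 := mul_lt_mul_of_pos_left hxx.better_left hwx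
  have e5 := mul_lt_mul_of_pos_left hzz.better_left hwz'
  have e6 : F x.1 b * (wt x + wt x') ≤ F a b * (wt x + wt x') :=
    mul_le_mul_of_nonneg_right (hF.le_left hb hxx.mem_left.1 ha hxa) (add_pos hwx hwx').le
  have e7 : wt z * uB b ≤ wt z * uB z.1 :=
    mul_le_mul_of_nonneg_left (h.benchmark_strictMonoOn.monotoneOn hb hzz.mem_left.1 hzb) hwz'.le
  have e8 : wt x * (F x.1 m - uB m) ≤ wt x * uB x.1 :=
    mul_le_mul_of_nonneg_left (by linarith [h.benchmark_le hxx.mem_left.1 hm]) hwx.le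
  have e9 : F a b * (wt x + wt z) ≤ (uB a + uB b) * (wt x + wt z) :=
    mul_le_mul_of_nonneg_right (h.benchmark_le ha hb) (add_pos hwx hwz').le
  have e10 : γ / 2 * (uB b - uB a) ≤ (wt z - wt x) * (uB b - uB a) :=
    mul_le_mul_of_nonneg_right (by linarith) (sub_pos.2 huab).le
  have e11 : uB a = F a m - uB m := by linarith
  have e12 : wt x * uB a = wt x * (F a m - uB m) := by rw [e11]
  linarith

end IsImproved

end

/-! ### Conclusion under strict submodularity -/

section

variable {I₁ I₂ : Set ℝ} {H : Measure (ℝ × ℝ)} {F : ℝ → ℝ → ℝ} [IsProbabilityMeasure H]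
  {μ μB : ℝ × ℝ → ℝ × ℝ} {u : ℝ × ℝ → ℝ} {uB : ℝ → ℝ}

/-- Outer measure one yields an almost sure statement only for a measurable set, so the set is
replaced by one defined through measurable versions of the payoffs. -/
lemma ae_better_of_measure_ge (hH : IsPopulation I₁ I₂ H) (hF : IsProduction I₁ F)
    (hu : IsEquilibrium I₁ I₂ H F 1 μ u) (huB : IsEquilibrium I₁ I₂ H F 0 μB fun x => uB x.1)
    (h1 : 1 ≤ H {x | uB x.1 < u x}) : ∀ᵐ x ∂H, uB x.1 < u x := by
  set f := (I₁ ×ˢ I₂).indicator fun x => wt x * u x with hf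
  set g := (I₁ ×ˢ I₂).indicator fun x => uB x.1 with hg
  have hfm : Measurable f := measurable_indicator_of_domRestrict hH.measurableSet
    (hu.measurable_weighted_payoff hF hH.pref_gt subset_rfl)
  have hgm : Measurable g := measurable_indicator_of_domRestrict hH.measurableSet
    (huB.measurable_benchmark hF)
  have hS : MeasurableSet {x | wt x * g x < f x} :=
    measurableSet_lt (measurable_wt.mul hgm) hfm
  have hiff : ∀ x ∈ I₁ ×ˢ I₂, (wt x * g x < f x ↔ uB x.1 < u x) := by
    intro x hx
    rw [hf, hg, indicator_of_mem hx, indicator_of_mem hx]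
    exact mul_lt_mul_iff_right₀ (wt_pos_of (hH.pref_gt _ hx.2))
  have hSae : ∀ᵐ x ∂H, x ∈ {x | wt x * g x < f x} := by
    refine (mem_ae_iff_prob_eq_one hS).2 (le_antisymm prob_le_one (h1.trans ?_))
    refine measure_mono_ae ?_
    filter_upwards [hH.ae_mem] with x hx hxu using (hiff x hx).2 hxu
  filter_upwards [hH.ae_mem, hSae] with x hx hxS using (hiff x hx).1 hxS

/-- Under strict submodularity, social comparisons do not make almost all workers better off. -/
theorem measure_better_lt_one (hH : IsPopulation I₁ I₂ H) (hF : IsProduction I₁ F)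
    (hA1 : CommonRankings I₁ I₂ H F) (hA2 : ExchangeableIndex I₁ H F)
    (hu : IsEquilibrium I₁ I₂ H F 1 μ u) (huB : IsEquilibrium I₁ I₂ H F 0 μB fun x => uB x.1)
    (hfull : FullSupport I₁ I₂ H) (hord : I₂.OrdConnected) (hsub : StrictlySubmodular I₁ F) :
    H {x | uB x.1 < u x} < 1 := by
  by_contra! hc
  have hbetter := ae_better_of_measure_ge hH hF hu huB hc
  rcases I₁.subsingleton_or_nontrivial with hI | hI
  -- With a single skill both partners would earn more than half of the common output.
  · have hbetter' : ∀ᵐ x ∂H, uB (μ x).1 < u (μ x) := by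
      refine ae_of_ae_map (p := fun x => uB x.1 < u x) hu.feasible.1 ?_
      rw [hu.feasible.2]
      exact hbetter
    obtain ⟨x, hx, h1, h2⟩ := (hH.ae_mem.and (hbetter.and hbetter')).exists
    have hm := hu.mapsTo hx
    have e := hu.surplus_eq hH.pref_gt hx
    have e1 := mul_lt_mul_of_pos_left h1 (wt_pos_of (hH.pref_gt _ hx.2))
    have e2 := mul_lt_mul_of_pos_left h2 (wt_pos_of (hH.pref_gt _ hm.2))
    have e3 := huB.half_le_benchmark hx
    have hw := wt_pos_of (hH.pref_gt _ hx.2)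
    have hw' := wt_pos_of (hH.pref_gt _ hm.2)
    rw [hI hm.1 hx.1] at e e2
    have e4 := mul_le_mul_of_nonneg_right e3 (add_pos hw hw').le
    linarith
  · obtain ⟨k₁, hk₁, k₂, hk₂, hlt⟩ := hI.exists_lt
    exact IsImproved.false (k₁ := k₁) (k₂ := k₂) (μ := μ) (μB := μB)
      ⟨⟨hH, hF, hfull, hord, hk₁, hk₂, hlt, hA1, hA2⟩, hu, huB, hsub, hbetter⟩

end

end TeamFormation

end

theorem proposition5 (I₁ I₂ : Set ℝ) (H : MeasureTheory.Measure (ℝ × ℝ))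
    [MeasureTheory.IsProbabilityMeasure H] (F : ℝ → ℝ → ℝ)
    (hH : TeamFormation.IsPopulation I₁ I₂ H) (hF : TeamFormation.IsProduction I₁ F)
    (hA1 : TeamFormation.CommonRankings I₁ I₂ H F)
    (hA2 : TeamFormation.ExchangeableIndex I₁ H F)
    -- the competitive equilibrium with social comparisons
    (μ : ℝ × ℝ → ℝ × ℝ) (u : ℝ × ℝ → ℝ) (hu : TeamFormation.IsEquilibrium I₁ I₂ H F 1 μ u)
    -- the benchmark equilibrium, in which nobody has relative concerns
    (μB : ℝ × ℝ → ℝ × ℝ) (uB : ℝ → ℝ)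
    (huB : TeamFormation.IsEquilibrium I₁ I₂ H F 0 μB (fun x => uB x.1)) :
    (TeamFormation.Supermodular I₁ F →
      (∀ᵐ x ∂H, uB x.1 ≤ u x) ∧
      (TeamFormation.FullSupport I₁ I₂ H →
        ((TeamFormation.AdditiveSpec I₁ H F ∧ (∀ a, H.fst {a} = 0)) ∨
          (TeamFormation.MultiplicativeSpec I₁ H F ∧ I₁.Nontrivial)) →
        ∀ᵐ x ∂H, uB x.1 < u x)) ∧
    (TeamFormation.FullSupport I₁ I₂ H → I₂.OrdConnected →
      TeamFormation.StrictlySubmodular I₁ F →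
      (∃ x' ∈ I₁ ×ˢ I₂, (μ x').1 = x'.1) →
      H {x | uB x.1 < u x} < 1) := by
  open TeamFormation in
  refine ⟨fun hs => ⟨?_, fun hfull hspec => ?_⟩, fun hfull hord hsub _ =>
    measure_better_lt_one hH hF hA1 hA2 hu huB hfull hord hsub⟩
  · filter_upwards [hH.ae_mem] with x hx
    rw [huB.benchmark_eq_half hF hs hx]
    exact hu.half_le hH.pref_gt hx
  · refine ae_lt_of_null hH hF hs huB ?_
    rcases hspec with ⟨⟨⟨K, hK⟩, -⟩, ha⟩ | ⟨⟨hpos, ⟨A, c, hc, hA⟩, hell⟩, hI⟩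
    · exact null_self_matched_of_additive hH hF hu hK ha
    · exact null_self_matched_of_multiplicative hH hu hpos hc hA
        (no_atoms_of_elliptical hH hfull hpos hI hell)
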